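/- Let $n\ge 1$ be an integer, $s\in(0,1)$ with $n>2s$, $0<\mu<n$, $\lambda>0$, and let $\Omega\subset\mathbb R^n$ be a bounded domain with Lipschitz boundary. Put $p=2^*_{\mu,s}=\frac{2n-\mu}{n-2s}$ and $Q=\mathbb R^{2n}\setminus\big((\mathbb R^n\setminus\Omega)\times(\mathbb R^n\setminus\Omega)\big)$. Let $X_0$ be the space of measurable functions $u:\mathbb R^n\to\mathbb R$ such that $u|_\Omega\in L^2(\Omega)$, $\frac{u(x)-u(y)}{|x-y|^{n/2+s}}\in L^2(Q)$, and $u=0$ a.e. in $\mathbb R^n\setminus\Omega$. Suppose that $u\in X_0$, $u\ge 0$ a.e., is a weak solution of $$(-\Delta)^s u=\Big(\int_\Omega\frac{|u(y)|^{p}}{|x-y|^\mu}\,dy\Big)|u|^{p-2}u+\lambda u\ \text{ in }\Omega,\qquad u=0\ \text{ in }\mathbb R^n\setminus\Omega,$$ that is, for every $\varphi\in C_c^\infty(\Omega)$, $$\int_Q\frac{(u(x)-u(y))(\varphi(x)-\varphi(y))}{|x-y|^{n+2s}}\,dx\,dy=\int_\Omega\int_\Omega\frac{|u(x)|^{p}\,|u(y)|^{p-2}u(y)\varphi(y)}{|x-y|^\mu}\,dx\,dy+\lambda\int_\Omega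 u\varphi\,dx,$$ where $|t|^{p-2}t$ is understood as $0$ at $t=0$. Then $u\in L^\infty(\Omega)$. -/

import Mathlib

open MeasureTheory
open scoped ContDiff NNReal

noncomputable section

namespace Choquard

/-- `Ω ⊆ ℝⁿ` has Lipschitz boundary: near each boundary point, after a rotation taking the last
axis to the direction `ν`, the set `Ω` is the region strictly above the graph of a Lipschitz
function of the remaining variables. The point `y - ⟪ν, y⟫ ν` is the orthogonal projection of `y`
onto the hyperplane orthogonal to `ν`, so only the restriction of `g` to that hyperplane matters
(a Lipschitz function on a hyperplane always extends to a Lipschitz function on the space). -/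
def HasLipschitzBoundary {n : ℕ} (Ω : Set (EuclideanSpace ℝ (Fin n))) : Prop :=
  ∀ x ∈ frontier Ω, ∃ (r : ℝ) (ν : EuclideanSpace ℝ (Fin n))
    (K : ℝ≥0) (g : EuclideanSpace ℝ (Fin n) → ℝ),
    0 < r ∧ ‖ν‖ = 1 ∧ LipschitzWith K g ∧
      ∀ y ∈ Metric.ball x r, y ∈ Ω ↔ g (y - inner ℝ ν y • ν) < inner ℝ ν y

/-- A bounded domain (nonempty, connected, open set) with Lipschitz boundary. -/
structure IsBoundedLipschitzDomain {n : ℕ} (Ω : Set (EuclideanSpace ℝ (Fin n))) : Prop where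
  isOpen : IsOpen Ω
  isConnected : IsConnected Ω
  isBounded : Bornology.IsBounded Ω
  lipschitz : HasLipschitzBoundary Ω

/-- The set `Q = ℝ²ⁿ \ (Ωᶜ × Ωᶜ)`. -/
def regionQ {n : ℕ} (Ω : Set (EuclideanSpace ℝ (Fin n))) :
    Set (EuclideanSpace ℝ (Fin n) × EuclideanSpace ℝ (Fin n)) :=
  (Ωᶜ ×ˢ Ωᶜ)ᶜ

/-- Membership in the space `X`: `u` is (Lebesgue) measurable on `ℝⁿ`, `u ∈ L²(Ω)`, and
`(u(x) - u(y)) / |x - y|^(n/2 + s) ∈ L²(Q)`. -/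
structure MemX {n : ℕ} (s : ℝ) (Ω : Set (EuclideanSpace ℝ (Fin n)))
    (u : EuclideanSpace ℝ (Fin n) → ℝ) : Prop where
  aemeasurable : AEMeasurable u volume
  memLp_two : MemLp u 2 (volume.restrict Ω)
  memLp_quotient :
    MemLp (fun p : EuclideanSpace ℝ (Fin n) × EuclideanSpace ℝ (Fin n) =>
      (u p.1 - u p.2) / ‖p.1 - p.2‖ ^ ((n : ℝ) / 2 + s)) 2 (volume.restrict (regionQ Ω))

/-- Membership in the space `X₀`: `u ∈ X` and `u = 0` a.e. in `ℝⁿ \ Ω`. -/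
structure MemX₀ {n : ℕ} (s : ℝ) (Ω : Set (EuclideanSpace ℝ (Fin n)))
    (u : EuclideanSpace ℝ (Fin n) → ℝ) : Prop extends MemX s Ω u where
  ae_eq_zero : ∀ᵐ x ∂(volume.restrict Ωᶜ), u x = 0

/-- The class `C_c^∞(Ω)` of test functions (extended by zero to `ℝⁿ`). -/
structure IsTestFunction {n : ℕ} (Ω : Set (EuclideanSpace ℝ (Fin n)))
    (φ : EuclideanSpace ℝ (Fin n) → ℝ) : Prop where
  contDiff : ContDiff ℝ ∞ φ
  hasCompactSupport : HasCompactSupport φ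
  tsupport_subset : tsupport φ ⊆ Ω

/-- The upper critical exponent `(2n - μ) / (n - 2s)`. -/
def critExp (n : ℕ) (s μ : ℝ) : ℝ := (2 * (n : ℝ) - μ) / ((n : ℝ) - 2 * s)

/-- `u ∈ X₀` is a weak solution of
`(-Δ)^s u = (∫_Ω |u(y)|^p / |x - y|^μ dy) |u|^(p-2) u + lam u` in `Ω`, `u = 0` in `ℝⁿ \ Ω`,
where `p = (2n - μ) / (n - 2s)`. -/
structure IsWeakSolution {n : ℕ} (s μ lam : ℝ) (Ω : Set (EuclideanSpace ℝ (Fin n)))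
    (u : EuclideanSpace ℝ (Fin n) → ℝ) : Prop where
  memX₀ : MemX₀ s Ω u
  weak_eq : ∀ φ : EuclideanSpace ℝ (Fin n) → ℝ, IsTestFunction Ω φ →
    ∫ p in regionQ Ω,
        (u p.1 - u p.2) * (φ p.1 - φ p.2) / ‖p.1 - p.2‖ ^ ((n : ℝ) + 2 * s) =
      (∫ p in Ω ×ˢ Ω,
        |u p.1| ^ critExp n s μ * |u p.2| ^ (critExp n s μ - 2) * u p.2 * φ p.2
          / ‖p.1 - p.2‖ ^ μ)
      + lam * ∫ x in Ω, u x * φ x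

end Choquard

end

set_option linter.unusedSectionVars false

noncomputable section

namespace Choquard

open Set Metric Module Filter
open scoped ENNReal Topology

/-! ### Riesz kernels and the Hardy–Littlewood–Sobolev inequality -/

variable {E : Type*} [NormedAddCommGroup E] [NormedSpace ℝ E] [FiniteDimensional ℝ E]
  [MeasureSpace E] [BorelSpace E] [(volume : Measure E).IsAddHaarMeasure]

/-! Write d for the dimension and q = 2d/(d - 2s). The exponents satisfy 1 < p < q and 2p/q + μ/d =
2, so the Choquard term is exactly critical for the Hardy–Littlewood–Sobolev inequality (`hls`) on
L^q, the space given by the fractional Sobolev inequality (`sobolev`). Plain Moser iteration gains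
nothing at a critical exponent, so the concentrated part of the interaction has to be absorbed into
the energy.

The weak formulation first has to accept functions of u as test functions. By HLS the right-hand
side f is a bounded functional on L^q (`exists_lintegral_forcing_mul_le`). Near each point of its
closure a Lipschitz domain can be pushed into itself by small translations, so mollifying and
shifting turns a localized energy function into a smooth function supported in Ω. With a finite
cover by balls this gives the identity for every finite-energy w vanishing outside Ω
(`integral_diffQuot_eq_of_isAdmissible`). Testing with g(u) and using Sobolev on G(u), where (G a -
G b)² ≤ c (a - b)(g a - g b), yields `energy_inequality`.

Integrability then improves in three stages. (1) Take g(t) = t min(t,k)^(2β-2) and G(t) = t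
min(t,k)^(β-1). Where u is small at one of the two points the interaction is of lower order; where
both values exceed M, HLS bounds it by a power of ∫_{u>M} u^q times the Sobolev norm of G(u), which
is absorbed for M large (`lintegral_rpow_lt_top_of_energy`). HLS admits only β with p + 1 - q < 1/β,
but this range already reaches an exponent at which the potential of u^p is bounded
(`exists_potential_le`). (2) With a bounded potential the equation is local with a subcritical
power, and the iteration reaches every Lebesgue space (`lintegral_rpow_lt_top_of_potential_le`). (3)
Testing with (u - k)⁺ gives superlinear decay of the measure of {u > k}, and Stampacchia's lemma
makes it vanish at a finite level (`exists_ae_le_of_levels`). -/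

theorem lintegral_min_norm_rpow_lt_top [Nontrivial E] {α β : ℝ} (hα : α < finrank ℝ E)
    (hβ : finrank ℝ E < β) :
    ∫⁻ z : E, ENNReal.ofReal (min (‖z‖ ^ (-α)) (‖z‖ ^ (-β))) < ⊤ := by
  have hd : 1 ≤ finrank ℝ E := finrank_pos
  have key : Integrable (fun z : E => min (‖z‖ ^ (-α)) (‖z‖ ^ (-β))) := by
    rw [integrable_fun_norm_addHaar (volume : Measure E)
      (f := fun y : ℝ => min (y ^ (-α)) (y ^ (-β)))]
    have hpow : ∀ γ y : ℝ, 0 < y →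
        y ^ (finrank ℝ E - 1) * y ^ (-γ) = y ^ ((finrank ℝ E : ℝ) - 1 - γ) := by
      intro γ y hy
      rw [← Real.rpow_natCast, ← Real.rpow_add hy]
      push_cast [hd]
      ring_nf
    have hm : Measurable fun y : ℝ => y ^ (finrank ℝ E - 1) • min (y ^ (-α)) (y ^ (-β)) := by
      fun_prop
    rw [← Ioc_union_Ioi_eq_Ioi (zero_le_one' ℝ)]
    refine IntegrableOn.union ?_ ?_
    · have h1 : IntegrableOn (fun y : ℝ => y ^ ((finrank ℝ E : ℝ) - 1 - α)) (Ioc 0 1) := by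
        rw [integrableOn_Ioc_iff_integrableOn_Ioo,
          intervalIntegral.integrableOn_Ioo_rpow_iff zero_lt_one]
        linarith
      refine Integrable.mono' h1 hm.aestronglyMeasurable ?_
      filter_upwards [ae_restrict_mem measurableSet_Ioc] with y hy
      rw [smul_eq_mul, Real.norm_of_nonneg, ← hpow α y hy.1]
      · exact mul_le_mul_of_nonneg_left (min_le_left _ _) (by have := hy.1; positivity)
      · have := hy.1; positivity
    · have h1 : IntegrableOn (fun y : ℝ => y ^ ((finrank ℝ E : ℝ) - 1 - β)) (Ioi 1) :=
        integrableOn_Ioi_rpow_of_lt (by linarith) zero_lt_one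
      refine Integrable.mono' h1 hm.aestronglyMeasurable ?_
      filter_upwards [ae_restrict_mem measurableSet_Ioi] with y hy
      have hy0 : (0 : ℝ) < y := zero_lt_one.trans hy
      rw [smul_eq_mul, Real.norm_of_nonneg, ← hpow β y hy0]
      · exact mul_le_mul_of_nonneg_left (min_le_right _ _) (by positivity)
      · positivity
  exact key.lintegral_lt_top

theorem lintegral_norm_rpow_ball_lt_top [Nontrivial E] {α : ℝ} (hα : α < finrank ℝ E) (R : ℝ) :
    ∫⁻ z in ball (0 : E) R, ENNReal.ofReal (‖z‖ ^ (-α)) < ⊤ := by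
  have h := integrableOn_ball_of_norm_le_rpow (μ := (volume : Measure E)) (r := R) (C := 1)
    (f := fun z : E => ‖z‖ ^ (-α)) (α := α) (finrank_pos (R := ℝ)) hα
    (Eventually.of_forall fun z => by
      rw [one_mul, Real.norm_of_nonneg (by positivity)])
    (by
      have : Measurable fun z : E => ‖z‖ ^ (-α) := measurable_norm.pow_const _
      exact this.aestronglyMeasurable)
  exact Integrable.lintegral_lt_top h

theorem lintegral_comp_smul {c : ℝ} (hc : 0 < c) {g : E → ℝ≥0∞} (hg : Measurable g) :
    ∫⁻ z, g (c • z) = ENNReal.ofReal (c ^ (-(finrank ℝ E : ℝ))) * ∫⁻ z, g z := by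
  have h := lintegral_map (μ := (volume : Measure E)) hg (measurable_const_smul c)
  rw [← h, Measure.map_addHaar_smul _ hc.ne', lintegral_smul_measure, smul_eq_mul,
    abs_of_pos (by positivity), Real.rpow_neg hc.le, Real.rpow_natCast]

/-- The scalar inequality behind the Hardy–Littlewood–Sobolev inequality, in the region where
the first density dominates. -/
theorem hls_pointwise_aux {F G ρ A B : ℝ} (hF : 0 < F) (hG : 0 < G) (hρ : 0 < ρ)
    (hB : 0 < B) (hB1 : B < 1) (hGF : G ≤ F) (hnear : F ^ A * G ^ B * ρ ^ (A + B) < 1) :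
    F ^ (1 - A) * G ^ (1 - B) * ρ ^ (-(A + B)) ≤
      F ^ (2 : ℝ) * min ((F * ρ) ^ (-(A + B))) ((F * ρ) ^ (-((A + B) / B))) := by
  have hw : 0 < F * ρ := by positivity
  have hsplit : F ^ (1 - A) * G ^ (1 - B) * ρ ^ (-(A + B)) =
      F ^ (2 : ℝ) * ((G / F) ^ (1 - B) * (F * ρ) ^ (-(A + B))) := by
    rw [Real.div_rpow hG.le hF.le, Real.mul_rpow hF.le hρ.le, div_eq_mul_inv,
      ← Real.rpow_neg hF.le]
    have : F ^ (1 - A) = F ^ (2 : ℝ) * F ^ (-(1 - B)) * F ^ (-(A + B)) := by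
      rw [← Real.rpow_add hF, ← Real.rpow_add hF]; ring_nf
    rw [this]; ring
  rw [hsplit]
  refine mul_le_mul_of_nonneg_left (le_min ?_ ?_) (by positivity)
  · have : (G / F) ^ (1 - B) ≤ 1 :=
      Real.rpow_le_one (by positivity) ((div_le_one hF).2 hGF) (by linarith)
    exact mul_le_of_le_one_left (by positivity) this
  -- The condition `hnear` is exactly this bound on G/F. Raised to the power (1 - B)/B and
  -- multiplied by (Fρ)^(-(A+B)), it produces the exponent -(A+B)/B, which beats the dimension at
  -- infinity.
  · have h1 : (G / F) ^ B ≤ (F * ρ) ^ (-(A + B)) := by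
      rw [Real.div_rpow hG.le hF.le, Real.rpow_neg hw.le, div_le_iff₀ (by positivity),
        ← div_eq_inv_mul, le_div_iff₀ (by positivity), Real.mul_rpow hF.le hρ.le,
        Real.rpow_add hF]
      have h2 : F ^ B * (F ^ A * G ^ B * ρ ^ (A + B)) ≤ F ^ B * 1 :=
        mul_le_mul_of_nonneg_left hnear.le (by positivity)
      calc _ = F ^ B * (F ^ A * G ^ B * ρ ^ (A + B)) := by ring
        _ ≤ _ := by simpa using h2
    have h3 : (G / F) ^ (1 - B) ≤ (F * ρ) ^ (-(A + B) * ((1 - B) / B)) := by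
      have := Real.rpow_le_rpow (by positivity) h1 (z := (1 - B) / B)
        (div_nonneg (by linarith) hB.le)
      rwa [← Real.rpow_mul (by positivity), ← Real.rpow_mul hw.le,
        mul_div_cancel₀ _ hB.ne'] at this
    calc _ ≤ (F * ρ) ^ (-(A + B) * ((1 - B) / B)) * (F * ρ) ^ (-(A + B)) :=
          mul_le_mul_of_nonneg_right h3 (by positivity)
      _ = _ := by
          rw [← Real.rpow_add hw]
          congr 1
          field_simp
          ring

/-- Here ρ stands for |x - y|^d. Far from the diagonal, where F^A G^B ρ^(A+B) ≥ 1, the left side is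
at most FG. Near it, the larger density controls everything through a profile in Fρ or Gρ alone, so
the other variable can be integrated out. -/
theorem hls_pointwise_real {F G ρ A B : ℝ} (hF : 0 < F) (hG : 0 < G) (hρ : 0 < ρ)
    (hA : 0 < A) (hA1 : A < 1) (hB : 0 < B) (hB1 : B < 1) :
    F ^ (1 - A) * G ^ (1 - B) * ρ ^ (-(A + B)) ≤ F * G +
      F ^ (2 : ℝ) * min ((F * ρ) ^ (-(A + B))) ((F * ρ) ^ (-((A + B) / B))) +
      G ^ (2 : ℝ) * min ((G * ρ) ^ (-(A + B))) ((G * ρ) ^ (-((A + B) / A))) := by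
  have h1 : 0 ≤ F ^ (2 : ℝ) * min ((F * ρ) ^ (-(A + B))) ((F * ρ) ^ (-((A + B) / B))) := by
    positivity
  have h2 : 0 ≤ G ^ (2 : ℝ) * min ((G * ρ) ^ (-(A + B))) ((G * ρ) ^ (-((A + B) / A))) := by
    positivity
  have h0 : 0 ≤ F * G := by positivity
  rcases le_or_gt 1 (F ^ A * G ^ B * ρ ^ (A + B)) with h | h
  · have : F ^ (1 - A) * G ^ (1 - B) * ρ ^ (-(A + B)) ≤ F * G := by
      rw [Real.rpow_sub hF, Real.rpow_sub hG, Real.rpow_neg hρ.le, Real.rpow_one, Real.rpow_one]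
      have h3 : F / F ^ A * (G / G ^ B) * (ρ ^ (A + B))⁻¹ =
          F * G / (F ^ A * G ^ B * ρ ^ (A + B)) := by field_simp
      rw [h3]
      exact div_le_self h0 h
    linarith
  · rcases le_total G F with hGF | hFG
    · have := hls_pointwise_aux hF hG hρ hB hB1 hGF h
      linarith
    · have := hls_pointwise_aux (A := B) (B := A) hG hF hρ hA hA1 hFG (by
        rw [add_comm B A]; calc _ = F ^ A * G ^ B * ρ ^ (A + B) := by ring
          _ < 1 := h)
      rw [add_comm B A] at this
      linarith [mul_comm (F ^ (1 - A)) (G ^ (1 - B))]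

/-- The Riesz kernel `‖z‖ ^ (-μ)`, as an extended nonnegative number. -/
def riesz (μ : ℝ) (z : E) : ℝ≥0∞ := ENNReal.ofReal (‖z‖ ^ (-μ))

/-- A radial profile that is integrable if `α` is below and `β` above the dimension. -/
def rieszMin (α β : ℝ) (z : E) : ℝ≥0∞ := ENNReal.ofReal (min (‖z‖ ^ (-α)) (‖z‖ ^ (-β)))

@[fun_prop]
theorem measurable_riesz (μ : ℝ) : Measurable (riesz μ : E → ℝ≥0∞) :=
  (measurable_norm.pow_const _).ennreal_ofReal

@[fun_prop]
theorem measurable_rieszMin (α β : ℝ) : Measurable (rieszMin α β : E → ℝ≥0∞) :=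
  ((measurable_norm.pow_const _).min (measurable_norm.pow_const _)).ennreal_ofReal

theorem riesz_neg (μ : ℝ) (z : E) : riesz μ (-z) = riesz μ z := by simp [riesz]

theorem riesz_sub_comm (μ : ℝ) (x y : E) : riesz μ (x - y) = riesz μ (y - x) := by
  rw [← riesz_neg, neg_sub]

theorem hls_pointwise [Nontrivial E] {F G : ℝ≥0∞} (hF : F ≠ ⊤) (hG : G ≠ ⊤) {z : E} (hz : z ≠ 0)
    {A B μ : ℝ} (hA : 0 < A) (hA1 : A < 1) (hB : 0 < B) (hB1 : B < 1)
    (hAB : A + B = μ / finrank ℝ E) :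
    F ^ (1 - A) * G ^ (1 - B) * riesz μ z ≤ F * G +
      F ^ (2 : ℝ) * rieszMin μ (μ / B) ((F ^ (1 / (finrank ℝ E : ℝ))).toReal • z) +
      G ^ (2 : ℝ) * rieszMin μ (μ / A) ((G ^ (1 / (finrank ℝ E : ℝ))).toReal • z) := by
  have hd : (0 : ℝ) < finrank ℝ E := by exact_mod_cast finrank_pos (R := ℝ) (M := E)
  rcases eq_or_ne F 0 with rfl | hF0
  · simp [ENNReal.zero_rpow_of_pos (sub_pos.2 hA1)]
  rcases eq_or_ne G 0 with rfl | hG0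
  · simp [ENNReal.zero_rpow_of_pos (sub_pos.2 hB1)]
  lift F to ℝ≥0 using hF
  lift G to ℝ≥0 using hG
  have hF' : (0 : ℝ) < F := by
    have : F ≠ 0 := by simpa using hF0
    positivity
  have hG' : (0 : ℝ) < G := by
    have : G ≠ 0 := by simpa using hG0
    positivity
  have hz' : 0 < ‖z‖ := norm_pos_iff.2 hz
  have key := hls_pointwise_real hF' hG' (ρ := ‖z‖ ^ (finrank ℝ E : ℝ)) (by positivity)
    hA hA1 hB hB1
  have hmin : ∀ (H : ℝ≥0) (D : ℝ), 0 < (H : ℝ) →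
      (H : ℝ≥0∞) ^ (2 : ℝ) * rieszMin μ (μ / D)
        (((H : ℝ≥0∞) ^ (1 / (finrank ℝ E : ℝ))).toReal • z) =
      ENNReal.ofReal ((H : ℝ) ^ (2 : ℝ) *
        min (((H : ℝ) * ‖z‖ ^ (finrank ℝ E : ℝ)) ^ (-(A + B)))
          (((H : ℝ) * ‖z‖ ^ (finrank ℝ E : ℝ)) ^ (-((A + B) / D)))) := by
    intro H D hH
    have hpow : ∀ γ : ℝ, ((H : ℝ) * ‖z‖ ^ (finrank ℝ E : ℝ)) ^ (γ / finrank ℝ E) =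
        ((H : ℝ) ^ (1 / (finrank ℝ E : ℝ)) * ‖z‖) ^ γ := by
      intro γ
      rw [Real.mul_rpow hH.le (by positivity), Real.mul_rpow (by positivity) hz'.le,
        ← Real.rpow_mul hz'.le, ← Real.rpow_mul hH.le]
      congr 2 <;> field_simp
    have e1 : -(A + B) = (-μ) / finrank ℝ E := by rw [hAB]; ring
    have e2 : -((A + B) / D) = (-(μ / D)) / finrank ℝ E := by rw [hAB]; ring
    rw [rieszMin, norm_smul, e1, e2, hpow, hpow, ENNReal.ofReal_mul (by positivity)]
    congr 1
    · rw [← ENNReal.ofReal_rpow_of_pos hH, ENNReal.ofReal_coe_nnreal]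
    · rw [← ENNReal.toReal_rpow, ENNReal.coe_toReal, Real.norm_of_nonneg (by positivity)]
  rw [hmin F B hF', hmin G A hG', riesz]
  have e3 : ‖z‖ ^ (-μ) = (‖z‖ ^ (finrank ℝ E : ℝ)) ^ (-(A + B)) := by
    rw [← Real.rpow_mul hz'.le, hAB]
    congr 1
    field_simp
  have hcoe : ∀ (H : ℝ≥0) (r : ℝ), 0 < (H : ℝ) → (H : ℝ≥0∞) ^ r = ENNReal.ofReal ((H : ℝ) ^ r) := by
    intro H r hH
    rw [← ENNReal.ofReal_rpow_of_pos hH, ENNReal.ofReal_coe_nnreal]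
  rw [e3, hcoe F _ hF', hcoe G _ hG', ← ENNReal.ofReal_coe_nnreal (p := F),
    ← ENNReal.ofReal_coe_nnreal (p := G), ← ENNReal.ofReal_mul (by positivity),
    ← ENNReal.ofReal_mul (by positivity), ← ENNReal.ofReal_mul (by positivity),
    ← ENNReal.ofReal_add (by positivity) (by positivity),
    ← ENNReal.ofReal_add (by positivity) (by positivity)]
  exact ENNReal.ofReal_le_ofReal key

/-- Dilating by F^(1/d) costs a factor 1/F, which turns F² into F. The error terms of
`hls_pointwise` therefore integrate to a multiple of ∫F or ∫G, with no higher power of the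
densities. -/
theorem lintegral_rpow_two_mul_rieszMin [Nontrivial E] {F : ℝ≥0∞} (hF : F ≠ ⊤) (α β : ℝ) (x : E) :
    ∫⁻ y, F ^ (2 : ℝ) * rieszMin α β ((F ^ (1 / (finrank ℝ E : ℝ))).toReal • (x - y)) =
      F * ∫⁻ z : E, rieszMin α β z := by
  have hd : (0 : ℝ) < finrank ℝ E := by exact_mod_cast finrank_pos (R := ℝ) (M := E)
  rcases eq_or_ne F 0 with rfl | hF0
  · simp
  lift F to ℝ≥0 using hF
  have hF' : (0 : ℝ) < F := by
    have : F ≠ 0 := by simpa using hF0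
    positivity
  have hc : 0 < ((F : ℝ≥0∞) ^ (1 / (finrank ℝ E : ℝ))).toReal := by
    rw [← ENNReal.toReal_rpow, ENNReal.coe_toReal]
    positivity
  rw [lintegral_const_mul _ (by fun_prop),
    lintegral_sub_left_eq_self
      (fun z => rieszMin α β (((F : ℝ≥0∞) ^ (1 / (finrank ℝ E : ℝ))).toReal • z)) x,
    lintegral_comp_smul hc (by fun_prop), ← mul_assoc]
  congr 1
  rw [← ENNReal.toReal_rpow, ENNReal.coe_toReal, ← Real.rpow_mul hF'.le,
    ← ENNReal.ofReal_coe_nnreal, ENNReal.ofReal_rpow_of_pos hF',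
    ← ENNReal.ofReal_mul (by positivity), ← Real.rpow_add hF']
  congr 1
  rw [show (2 : ℝ) + 1 / (finrank ℝ E : ℝ) * -(finrank ℝ E : ℝ) = 1 by field_simp; norm_num,
    Real.rpow_one]

theorem hls_of_lintegral_le_one [Nontrivial E] {A B μ : ℝ} (hA : 0 < A) (hA1 : A < 1) (hB : 0 < B)
    (hB1 : B < 1) (hAB : A + B = μ / finrank ℝ E) {F G : E → ℝ≥0∞} (hF : Measurable F)
    (hG : Measurable G) (hF1 : ∫⁻ x, F x ≤ 1) (hG1 : ∫⁻ x, G x ≤ 1) :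
    ∫⁻ x, ∫⁻ y, F x ^ (1 - A) * G y ^ (1 - B) * riesz μ (x - y) ≤
      1 + (∫⁻ z : E, rieszMin μ (μ / B) z) + ∫⁻ z : E, rieszMin μ (μ / A) z := by
  have hFt : ∀ᵐ x, F x ≠ ⊤ := by
    filter_upwards [ae_lt_top hF (hF1.trans_lt ENNReal.one_lt_top).ne] with x hx using hx.ne
  have hGt : ∀ᵐ x, G x ≠ ⊤ := by
    filter_upwards [ae_lt_top hG (hG1.trans_lt ENNReal.one_lt_top).ne] with x hx using hx.ne
  have m1 : Measurable (Function.uncurry fun x y : E => F x * G y) := by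
    simp only [Function.uncurry_def]; fun_prop
  have m2 : Measurable (Function.uncurry fun x y : E => F x ^ (2 : ℝ) *
      rieszMin μ (μ / B) ((F x ^ (1 / (finrank ℝ E : ℝ))).toReal • (x - y))) := by
    simp only [Function.uncurry_def]; fun_prop
  have m3 : Measurable (Function.uncurry fun x y : E => G y ^ (2 : ℝ) *
      rieszMin μ (μ / A) ((G y ^ (1 / (finrank ℝ E : ℝ))).toReal • (x - y))) := by
    simp only [Function.uncurry_def]; fun_prop
  calc _ ≤ ∫⁻ x, ∫⁻ y, (F x * G y + F x ^ (2 : ℝ) *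
          rieszMin μ (μ / B) ((F x ^ (1 / (finrank ℝ E : ℝ))).toReal • (x - y)) +
          G y ^ (2 : ℝ) *
          rieszMin μ (μ / A) ((G y ^ (1 / (finrank ℝ E : ℝ))).toReal • (x - y))) := by
        refine lintegral_mono_ae ?_
        filter_upwards [hFt] with x hx
        refine lintegral_mono_ae ?_
        have hne : ∀ᵐ y : E, y ≠ x := by
          simp [ae_iff, measure_singleton]
        filter_upwards [hGt, hne] with y hy hyx
        exact hls_pointwise hx hy (sub_ne_zero.2 hyx.symm) hA hA1 hB hB1 hAB
    _ = (∫⁻ x, ∫⁻ y, F x * G y) + (∫⁻ x, ∫⁻ y, F x ^ (2 : ℝ) *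
          rieszMin μ (μ / B) ((F x ^ (1 / (finrank ℝ E : ℝ))).toReal • (x - y))) +
          ∫⁻ x, ∫⁻ y, G y ^ (2 : ℝ) *
          rieszMin μ (μ / A) ((G y ^ (1 / (finrank ℝ E : ℝ))).toReal • (x - y)) := by
        rw [← lintegral_add_left m1.lintegral_prod_right,
          ← lintegral_add_left (m1.lintegral_prod_right.fun_add m2.lintegral_prod_right)]
        refine lintegral_congr fun x => ?_
        have a1 : Measurable fun y => F x * G y := m1.comp measurable_prodMk_left
        have a2 : Measurable fun y => F x ^ (2 : ℝ) *
          rieszMin μ (μ / B) ((F x ^ (1 / (finrank ℝ E : ℝ))).toReal • (x - y)) :=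
          m2.comp measurable_prodMk_left
        rw [lintegral_add_left (a1.fun_add a2), lintegral_add_left a1]
    _ ≤ _ := by
        refine add_le_add (add_le_add ?_ ?_) ?_
        · simp_rw [lintegral_const_mul _ hG]
          rw [lintegral_mul_const _ hF]
          exact mul_le_one' hF1 hG1
        · calc _ = ∫⁻ x, F x * ∫⁻ z : E, rieszMin μ (μ / B) z := by
                refine lintegral_congr_ae ?_
                filter_upwards [hFt] with x hx
                exact lintegral_rpow_two_mul_rieszMin hx _ _ x
            _ ≤ _ := by
                rw [lintegral_mul_const _ hF]
                exact mul_le_of_le_one_left zero_le hF1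
        · rw [lintegral_lintegral_swap m3.aemeasurable]
          calc _ = ∫⁻ y, G y * ∫⁻ z : E, rieszMin μ (μ / A) z := by
                refine lintegral_congr_ae ?_
                filter_upwards [hGt] with y hy
                rw [← lintegral_rpow_two_mul_rieszMin hy _ _ y]
                refine lintegral_congr fun x => ?_
                congr 1
                rw [← neg_sub y x, smul_neg]
                simp [rieszMin]
            _ ≤ _ := by
                rw [lintegral_mul_const _ hG]
                exact mul_le_of_le_one_left zero_le hG1

/-- **Hardy–Littlewood–Sobolev inequality.** -/
theorem hls [Nontrivial E] {a b μ : ℝ} (ha : 1 < a) (hb : 1 < b) (hμ : μ < finrank ℝ E)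
    (hab : 1 / a + 1 / b + μ / finrank ℝ E = 2) :
    ∃ C : ℝ≥0, ∀ f g : E → ℝ≥0∞, Measurable f → Measurable g →
      ∫⁻ x, ∫⁻ y, f x * g y * riesz μ (x - y) ≤
        C * (∫⁻ x, f x ^ a) ^ (1 / a) * (∫⁻ x, g x ^ b) ^ (1 / b) := by
  have hd : (0 : ℝ) < finrank ℝ E := by exact_mod_cast finrank_pos (R := ℝ) (M := E)
  have ha0 : 0 < a := by linarith
  have hb0 : 0 < b := by linarith
  have ha1 : 1 / a < 1 := (div_lt_one ha0).2 ha
  have hb1 : 1 / b < 1 := (div_lt_one hb0).2 hb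
  have ha2 : 0 < 1 / a := by positivity
  have hb2 : 0 < 1 / b := by positivity
  set A := 1 - 1 / a with hA
  set B := 1 - 1 / b with hB
  have hAB : A + B = μ / finrank ℝ E := by linarith
  have hμ' : μ = (A + B) * finrank ℝ E := by rw [hAB]; field_simp
  have hA0 : 0 < A := by linarith
  have hB0 : 0 < B := by linarith
  have hμd : μ / finrank ℝ E < 1 := (div_lt_one hd).2 hμ
  -- Since A + B = μ/d, any D < A + B makes μ/D exceed d. Used with D = A and D = B, this gives the
  -- integrable decay at infinity of the two profiles.
  have hlt : ∀ D : ℝ, 0 < D → D < A + B → (finrank ℝ E : ℝ) < μ / D := by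
    intro D hD hDA
    rw [lt_div_iff₀ hD, hμ', mul_comm]
    gcongr
  have h1 := lintegral_min_norm_rpow_lt_top (E := E) hμ (hlt B hB0 (by linarith))
  have h2 := lintegral_min_norm_rpow_lt_top (E := E) hμ (hlt A hA0 (by linarith))
  have hC : 1 + (∫⁻ z : E, rieszMin μ (μ / B) z) + ∫⁻ z : E, rieszMin μ (μ / A) z ≠ ⊤ :=
    ENNReal.add_ne_top.2 ⟨ENNReal.add_ne_top.2 ⟨ENNReal.one_ne_top, h1.ne⟩, h2.ne⟩
  refine ⟨(1 + (∫⁻ z : E, rieszMin μ (μ / B) z) + ∫⁻ z : E, rieszMin μ (μ / A) z).toNNReal,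
    fun f g hf hg => ?_⟩
  rw [ENNReal.coe_toNNReal hC]
  set C := 1 + (∫⁻ z : E, rieszMin μ (μ / B) z) + ∫⁻ z : E, rieszMin μ (μ / A) z with hCdef
  have hC0 : C ≠ 0 := by
    intro h
    have : (1 : ℝ≥0∞) ≤ C := by rw [hCdef, add_assoc]; exact le_self_add
    simp [h] at this
  set I := ∫⁻ x, f x ^ a with hI
  set J := ∫⁻ x, g x ^ b with hJ
  have hzero : ∀ (r : ℝ), 0 < r → ∀ h : E → ℝ≥0∞, Measurable h → ∫⁻ x, h x ^ r = 0 →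
      ∀ᵐ x, h x = 0 := by
    intro r hr h hm h0
    filter_upwards [(lintegral_eq_zero_iff (hm.pow_const r)).1 h0] with x hx
    simpa [hr, hr.le, not_lt.2 hr.le] using hx
  rcases eq_or_ne I 0 with hI0 | hI0
  · have : ∫⁻ x, ∫⁻ y, f x * g y * riesz μ (x - y) = 0 := by
      rw [← lintegral_zero (μ := (volume : Measure E))]
      refine lintegral_congr_ae ?_
      filter_upwards [hzero a ha0 f hf hI0] with x hx
      simp [hx]
    rw [this]; exact zero_le
  rcases eq_or_ne J 0 with hJ0 | hJ0
  · have : ∫⁻ x, ∫⁻ y, f x * g y * riesz μ (x - y) = 0 := by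
      rw [← lintegral_zero (μ := (volume : Measure E))]
      refine lintegral_congr fun x => ?_
      rw [← lintegral_zero (μ := (volume : Measure E))]
      refine lintegral_congr_ae ?_
      filter_upwards [hzero b hb0 g hg hJ0] with y hy
      simp [hy]
    rw [this]; exact zero_le
  rcases eq_or_ne I ⊤ with hIt | hIt
  · rw [hIt, ENNReal.top_rpow_of_pos ha2, ENNReal.mul_top hC0, ENNReal.top_mul]
    · exact le_top
    · simp [hJ0, hb0, not_lt.2 hb0.le]
  rcases eq_or_ne J ⊤ with hJt | hJt
  · rw [hJt, ENNReal.top_rpow_of_pos hb2, ENNReal.mul_top]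
    · exact le_top
    · simp [hC0, hI0, ha0, not_lt.2 ha0.le]
  have hnorm : ∀ (h : E → ℝ≥0∞) (r : ℝ), Measurable h → ∫⁻ x, h x ^ r ≠ 0 →
      ∫⁻ x, h x ^ r ≠ ⊤ → ∫⁻ x, h x ^ r * (∫⁻ x, h x ^ r)⁻¹ ≤ 1 := by
    intro h r hm h0 ht
    rw [lintegral_mul_const _ (hm.pow_const r), ENNReal.mul_inv_cancel h0 ht]
  have key := hls_of_lintegral_le_one hA0 (by linarith) hB0 (by linarith) hAB
    ((hf.pow_const a).mul_const I⁻¹) ((hg.pow_const b).mul_const J⁻¹)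
    (hnorm f a hf hI0 hIt) (hnorm g b hg hJ0 hJt)
  have hpow : ∀ (K t : ℝ≥0∞) (r : ℝ), 1 < r → (t ^ r * K⁻¹) ^ (1 / r) = t * (K ^ (1 / r))⁻¹ := by
    intro K t r hr
    have hr0 : 0 < r := by linarith
    rw [ENNReal.mul_rpow_of_nonneg _ _ (by positivity), ← ENNReal.rpow_mul,
      mul_one_div_cancel hr0.ne', ENNReal.rpow_one, ENNReal.inv_rpow]
  rw [show 1 - A = 1 / a by rw [hA]; ring, show 1 - B = 1 / b by rw [hB]; ring] at key
  simp_rw [hpow _ _ _ ha, hpow _ _ _ hb] at key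
  set I' := I ^ (1 / a)
  set J' := J ^ (1 / b)
  have hI'0 : I' ≠ 0 := by simp [I', hI0, hIt]
  have hJ'0 : J' ≠ 0 := by simp [J', hJ0, hJt]
  have hI't : I' ≠ ⊤ := ENNReal.rpow_ne_top_of_nonneg ha2.le hIt
  have hJ't : J' ≠ ⊤ := ENNReal.rpow_ne_top_of_nonneg hb2.le hJt
  have hmul : ∫⁻ x, ∫⁻ y, f x * g y * riesz μ (x - y) =
      (∫⁻ x, ∫⁻ y, f x * I'⁻¹ * (g y * J'⁻¹) * riesz μ (x - y)) * (I' * J') := by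
    rw [← lintegral_mul_const' _ _ (ENNReal.mul_ne_top hI't hJ't)]
    refine lintegral_congr fun x => ?_
    rw [← lintegral_mul_const' _ _ (ENNReal.mul_ne_top hI't hJ't)]
    refine lintegral_congr fun y => ?_
    calc _ = f x * g y * riesz μ (x - y) * (I'⁻¹ * I') * (J'⁻¹ * J') := by
          rw [ENNReal.inv_mul_cancel hI'0 hI't, ENNReal.inv_mul_cancel hJ'0 hJ't, mul_one, mul_one]
      _ = _ := by ring
  rw [hmul, mul_assoc C]
  exact mul_le_mul_left key _

/-! ### Gagliardo seminorm and the fractional Sobolev inequality -/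

/-- The squared Gagliardo seminorm of order `s`. -/
def gagliardo (s : ℝ) (v : E → ℝ) : ℝ≥0∞ :=
  ∫⁻ x, ∫⁻ y, ENNReal.ofReal ((v x - v y) ^ 2 / ‖x - y‖ ^ (finrank ℝ E + 2 * s))

theorem measurable_gagliardo_integrand (s : ℝ) {v : E → ℝ} (hv : Measurable v) :
    Measurable (Function.uncurry fun x y : E =>
      ENNReal.ofReal ((v x - v y) ^ 2 / ‖x - y‖ ^ (finrank ℝ E + 2 * s))) := by
  simp only [Function.uncurry_def]
  have : Measurable fun p : E × E => ‖p.1 - p.2‖ ^ ((finrank ℝ E : ℝ) + 2 * s) :=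
    (by fun_prop : Measurable fun p : E × E => ‖p.1 - p.2‖).pow_const _
  fun_prop

/-- With t = v(x) and N = ∫v^q, Chebyshev bounds the measure of {v > t/2} by a = (2/t)^q N. A ball
about x of measure 2a hence contains a set of measure at least a where v ≤ t/2, and there the
difference quotient is large. The inner integral is at least a constant times t² a^(-2s/d), and q ·
2s/d = q - 2 turns this into t^q N^(-(1-2/q)). Integrating in x gives Sobolev's inequality. -/
theorem rpow_le_gagliardo_at [Nontrivial E] {s q : ℝ} (hs : 0 < s) (hsd : 2 * s < finrank ℝ E)
    (hq : q = 2 * finrank ℝ E / (finrank ℝ E - 2 * s)) :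
    ∃ C : ℝ≥0, ∀ v : E → ℝ, Measurable v → (∀ x, 0 ≤ v x) →
      ∫⁻ x, ENNReal.ofReal (v x) ^ q ≠ 0 → ∫⁻ x, ENNReal.ofReal (v x) ^ q ≠ ⊤ → ∀ x,
      ENNReal.ofReal (v x) ^ q ≤ C * (∫⁻ x, ENNReal.ofReal (v x) ^ q) ^ (1 - 2 / q) *
        ∫⁻ y, ENNReal.ofReal ((v x - v y) ^ 2 / ‖x - y‖ ^ (finrank ℝ E + 2 * s)) := by
  have hd : (0 : ℝ) < finrank ℝ E := by exact_mod_cast finrank_pos (R := ℝ) (M := E)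
  have hds : 0 < (finrank ℝ E : ℝ) - 2 * s := by linarith
  set d : ℝ := (finrank ℝ E : ℝ) with hd_def
  set κ : ℝ := 2 * s / d with hκ
  have hq0 : 0 < q := by rw [hq]; positivity
  have hκq : 1 - 2 / q = κ := by rw [hq, hκ]; field_simp; ring
  have hqκ : q * κ = q - 2 := by rw [← hκq]; field_simp
  set ϖ : ℝ := volume.real (ball (0 : E) 1) with hϖ_def
  have hϖ : 0 < ϖ := by
    rw [hϖ_def, measureReal_def]
    exact ENNReal.toReal_pos (measure_ball_pos _ _ one_pos).ne' measure_ball_lt_top.ne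
  set C : ℝ := 2 ^ q * (2 / ϖ) ^ (1 + κ) with hC
  have hC0 : 0 < C := by positivity
  refine ⟨C.toNNReal, fun v hv hv0 hN0 hNt x => ?_⟩
  rcases (hv0 x).eq_or_lt with hx | ht
  · rw [← hx]; simp [hq0]
  set N := ∫⁻ x, ENNReal.ofReal (v x) ^ q with hN
  set N' := N.toReal with hN'
  have hN'0 : 0 < N' := ENNReal.toReal_pos hN0 hNt
  set t := v x with ht_def
  -- The Chebyshev bound for the measure of {v > t/2}; the radius r below is the one for which the
  -- ball has measure 2a.
  set a : ℝ := (2 / t) ^ q * N' with ha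
  have ha0 : 0 < a := by positivity
  set r : ℝ := (2 * a / ϖ) ^ (1 / d) with hr
  have hr0 : 0 < r := by positivity
  have hrd : r ^ d = 2 * a / ϖ := by
    rw [hr, ← Real.rpow_mul (by positivity), one_div_mul_cancel hd.ne', Real.rpow_one]
  have hrds : r ^ (d + 2 * s) = (2 * a / ϖ) ^ (1 + κ) := by
    rw [hr, ← Real.rpow_mul (by positivity)]
    congr 1
    rw [hκ]; field_simp
  have hball : volume (ball x r) = ENNReal.ofReal (2 * a) := by
    rw [Measure.addHaar_ball_of_pos _ _ hr0, ← ENNReal.ofReal_toReal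
      (measure_ball_lt_top (μ := (volume : Measure E)) (x := 0) (r := 1)).ne,
      ← ENNReal.ofReal_mul (by positivity), ← Real.rpow_natCast, ← hd_def, hrd]
    congr 1
    change 2 * a / ϖ * ϖ = 2 * a
    field_simp
  set S : Set E := {y | v y ≤ t / 2} with hS
  have hSm : MeasurableSet S := measurableSet_le hv measurable_const
  have hcheb : volume Sᶜ ≤ ENNReal.ofReal a := by
    have h1 := mul_meas_ge_le_lintegral (μ := (volume : Measure E))
      (hv.ennreal_ofReal.pow_const q) (ENNReal.ofReal (t / 2) ^ q)
    have h2 : volume Sᶜ ≤ volume {y | ENNReal.ofReal (t / 2) ^ q ≤ ENNReal.ofReal (v y) ^ q} := by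
      refine measure_mono fun y hy => ?_
      have : t / 2 < v y := not_le.1 hy
      exact ENNReal.rpow_le_rpow (ENNReal.ofReal_le_ofReal this.le) hq0.le
    have hpos : 0 < t / 2 := by positivity
    rw [ENNReal.ofReal_rpow_of_pos hpos] at h1 h2
    have h3 : ENNReal.ofReal a = ENNReal.ofReal ((t / 2) ^ q)⁻¹ * N := by
      rw [ha, ENNReal.ofReal_mul (by positivity), hN', ENNReal.ofReal_toReal hNt,
        ← Real.inv_rpow hpos.le, inv_div]
    rw [h3, ENNReal.ofReal_inv_of_pos (by positivity), ← ENNReal.div_eq_inv_mul,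
      ENNReal.le_div_iff_mul_le
        (Or.inl (by rw [ne_eq, ENNReal.ofReal_eq_zero, not_le]; positivity))
        (Or.inl ENNReal.ofReal_ne_top), mul_comm]
    exact (mul_le_mul_right h2 _).trans h1
  have hSball : ENNReal.ofReal a ≤ volume (S ∩ ball x r) := by
    have h1 : volume (ball x r) ≤ volume (S ∩ ball x r) + volume Sᶜ := by
      rw [← measure_inter_add_sdiff (ball x r) hSm, inter_comm]
      gcongr
      exact fun y hy => hy.2
    rw [hball, two_mul, ENNReal.ofReal_add ha0.le ha0.le] at h1
    exact (ENNReal.add_le_add_iff_right ENNReal.ofReal_ne_top).1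
      (h1.trans (add_le_add_right hcheb _))
  have hD : ENNReal.ofReal ((t / 2) ^ 2 / r ^ (d + 2 * s) * a) ≤
      ∫⁻ y, ENNReal.ofReal ((t - v y) ^ 2 / ‖x - y‖ ^ (d + 2 * s)) := by
    calc _ ≤ ENNReal.ofReal ((t / 2) ^ 2 / r ^ (d + 2 * s)) * volume (S ∩ ball x r) := by
          rw [ENNReal.ofReal_mul (by positivity)]
          gcongr
      _ = ∫⁻ y in S ∩ ball x r, ENNReal.ofReal ((t / 2) ^ 2 / r ^ (d + 2 * s)) := by
          rw [setLIntegral_const]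
      _ ≤ ∫⁻ y in S ∩ ball x r, ENNReal.ofReal ((t - v y) ^ 2 / ‖x - y‖ ^ (d + 2 * s)) := by
          refine setLIntegral_mono' (hSm.inter measurableSet_ball) fun y hy => ?_
          apply ENNReal.ofReal_le_ofReal
          have hy1 : v y ≤ t / 2 := hy.1
          have hyx : x ≠ y := by
            rintro rfl
            linarith
          have hy2 : ‖x - y‖ ≤ r := by
            have := mem_ball'.1 hy.2
            rw [dist_eq_norm] at this
            exact this.le
          have hpos : 0 < ‖x - y‖ := norm_pos_iff.2 (sub_ne_zero.2 hyx)
          gcongr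
          linarith
      _ ≤ _ := setLIntegral_le_lintegral _ _
  have hident : t ^ q = C * N' ^ κ * ((t / 2) ^ 2 / r ^ (d + 2 * s) * a) := by
    have e1 : (2 * a / ϖ) ^ (1 + κ) = (2 / ϖ) ^ (1 + κ) * (a * a ^ κ) := by
      rw [mul_div_right_comm, Real.mul_rpow (by positivity) ha0.le, Real.rpow_add ha0,
        Real.rpow_one]
    have e2 : a ^ κ = (2 / t) ^ (q - 2) * N' ^ κ := by
      rw [ha, Real.mul_rpow (by positivity) hN'0.le, ← Real.rpow_mul (by positivity), hqκ]
    have e3 : t ^ q = 2 ^ q * ((t / 2) ^ 2 / (2 / t) ^ (q - 2)) := by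
      have : (2 / t) ^ (q - 2) = ((t / 2) ^ q)⁻¹ * (t / 2) ^ 2 := by
        rw [← inv_div t 2, Real.inv_rpow (by positivity), Real.rpow_sub (by positivity),
          Real.rpow_ofNat, inv_div, div_eq_inv_mul]
      rw [this, Real.div_rpow ht.le (by positivity)]
      field_simp
    rw [hrds, e1, e2, hC, e3]
    field_simp
  rw [ENNReal.ofReal_rpow_of_pos ht, hident, ENNReal.ofReal_mul (by positivity),
    ENNReal.ofReal_mul hC0.le, ← ENNReal.ofReal_rpow_of_pos hN'0, hN', ENNReal.ofReal_toReal hNt,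
    hκq]
  exact mul_le_mul_right hD _

theorem gagliardo_mono {s : ℝ} {v w : E → ℝ} (h : ∀ x y, |v x - v y| ≤ |w x - w y|) :
    gagliardo s v ≤ gagliardo s w := by
  refine lintegral_mono fun x => lintegral_mono fun y => ENNReal.ofReal_le_ofReal ?_
  have := sq_le_sq.2 (h x y)
  gcongr

/-- **Fractional Sobolev inequality.** -/
theorem sobolev [Nontrivial E] {s q : ℝ} (hs : 0 < s) (hsd : 2 * s < finrank ℝ E)
    (hq : q = 2 * finrank ℝ E / (finrank ℝ E - 2 * s)) :
    ∃ C : ℝ≥0, ∀ v : E → ℝ, Measurable v → (∀ x, 0 ≤ v x) →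
      volume (Function.support v) ≠ ⊤ →
      (∫⁻ x, ENNReal.ofReal (v x) ^ q) ^ (2 / q) ≤ C * gagliardo s v := by
  have hd : (0 : ℝ) < finrank ℝ E := by exact_mod_cast finrank_pos (R := ℝ) (M := E)
  have hds : 0 < (finrank ℝ E : ℝ) - 2 * s := by linarith
  have hq0 : 0 < q := by rw [hq]; positivity
  obtain ⟨C, hC⟩ := rpow_le_gagliardo_at (E := E) hs hsd hq
  have hfin : ∀ v : E → ℝ, Measurable v → (∀ x, 0 ≤ v x) →
      ∫⁻ x, ENNReal.ofReal (v x) ^ q ≠ ⊤ →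
      (∫⁻ x, ENNReal.ofReal (v x) ^ q) ^ (2 / q) ≤ C * gagliardo s v := by
    intro v hv hv0 hNt
    rcases eq_or_ne (∫⁻ x, ENNReal.ofReal (v x) ^ q) 0 with hN0 | hN0
    · rw [hN0, ENNReal.zero_rpow_of_pos (by positivity)]
      exact zero_le
    have h := lintegral_mono (μ := (volume : Measure E)) (hC v hv hv0 hN0 hNt)
    rw [lintegral_const_mul _ (measurable_gagliardo_integrand s hv).lintegral_prod_right] at h
    set N := ∫⁻ x, ENNReal.ofReal (v x) ^ q with hN
    have hNp0 : N ^ (1 - 2 / q) ≠ 0 := by simp [hN0, hNt]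
    have hNpt : N ^ (1 - 2 / q) ≠ ⊤ := ENNReal.rpow_ne_top_of_ne_zero hN0 hNt
    have h2 : N ^ (1 - 2 / q) * N ^ (2 / q) ≤ N ^ (1 - 2 / q) * (C * gagliardo s v) := by
      rw [← ENNReal.rpow_add _ _ hN0 hNt, sub_add_cancel, ENNReal.rpow_one]
      calc N ≤ _ := h
        _ = _ := by rw [gagliardo]; ring
    exact (ENNReal.mul_le_mul_iff_right hNp0 hNpt).1 h2
  refine ⟨C, fun v hv hv0 hsupp => ?_⟩
  -- Dividing by N^(1-2/q) in `hfin` requires N < ∞. Truncation at k, together with a support of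
  -- finite measure, ensures this and does not increase the seminorm; monotone convergence removes
  -- k.
  have htrunc : ∀ k : ℕ, (∫⁻ x, ENNReal.ofReal (min (v x) k) ^ q) ^ (2 / q) ≤
      C * gagliardo s v := by
    intro k
    refine (hfin (fun x => min (v x) k) (hv.min measurable_const)
      (fun x => le_min (hv0 x) k.cast_nonneg) ?_).trans ?_
    · have : ∫⁻ x, ENNReal.ofReal (min (v x) k) ^ q ≤
          ∫⁻ x, (toMeasurable volume (Function.support v)).indicator
            (fun _ => ENNReal.ofReal k ^ q) x := by
        refine lintegral_mono fun x => ?_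
        by_cases hx : v x = 0
        · simp [hx, hq0]
        · rw [indicator_of_mem (subset_toMeasurable _ _ hx)]
          exact ENNReal.rpow_le_rpow (ENNReal.ofReal_le_ofReal (min_le_right _ _)) hq0.le
      refine (this.trans_lt ?_).ne
      rw [lintegral_indicator_const (measurableSet_toMeasurable _ _), measure_toMeasurable]
      exact ENNReal.mul_lt_top (ENNReal.rpow_lt_top_of_nonneg hq0.le ENNReal.ofReal_ne_top)
        hsupp.lt_top
    · gcongr
      refine gagliardo_mono fun x y => ?_
      have := abs_min_sub_min_le_max (v x) k (v y) k
      simpa using this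
  have hlim : Tendsto (fun k : ℕ => (∫⁻ x, ENNReal.ofReal (min (v x) k) ^ q) ^ (2 / q)) atTop
      (𝓝 ((∫⁻ x, ENNReal.ofReal (v x) ^ q) ^ (2 / q))) := by
    refine (ENNReal.continuous_rpow_const.tendsto _).comp ?_
    refine lintegral_tendsto_of_tendsto_of_monotone (fun k => ?_) ?_ ?_
    · exact (((hv.min measurable_const).ennreal_ofReal).pow_const q).aemeasurable
    · refine Eventually.of_forall fun x k l hkl => ?_
      refine ENNReal.rpow_le_rpow (ENNReal.ofReal_le_ofReal ?_) hq0.le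
      exact min_le_min le_rfl (by exact_mod_cast hkl)
    · refine Eventually.of_forall fun x => tendsto_const_nhds.congr' ?_
      filter_upwards [eventually_ge_atTop ⌈v x⌉₊] with k hk
      rw [min_eq_left ((Nat.le_ceil _).trans (by exact_mod_cast hk))]
  exact le_of_tendsto' hlim htrunc

/-! ### Continuity of translations and mollification -/

theorem tendsto_eLpNorm_comp_sub {X : Type*} [NormedAddCommGroup X] [NormedSpace ℝ X]
    [FiniteDimensional ℝ X] [MeasurableSpace X] [BorelSpace X] {m : Measure X} [m.IsAddHaarMeasure]
    {p : ℝ≥0∞} [Fact (1 ≤ p)] (hp : p ≠ ⊤) {g : X → ℝ} (hg : MemLp g p m) :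
    Tendsto (fun h : X => eLpNorm (fun x => g (x - h) - g x) p m) (𝓝 0) (𝓝 0) := by
  let τ : C(X, C(X, X)) := ContinuousMap.curry ⟨fun a : X × X => a.2 - a.1, by fun_prop⟩
  have hτ : ∀ h, MeasurePreserving (τ h) m m := fun h => measurePreserving_sub_right m h
  have h1 : Tendsto (fun h : X => Lp.compMeasurePreserving (τ h) (hτ h) (hg.toLp g)) (𝓝 0)
      (𝓝 (Lp.compMeasurePreserving (τ 0) (hτ 0) (hg.toLp g))) :=
    Filter.Tendsto.compMeasurePreservingLp tendsto_const_nhds (τ.continuous.tendsto 0) hτ (hτ 0) hp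
  rw [tendsto_iff_edist_tendsto_0] at h1
  refine h1.congr fun h => ?_
  rw [Lp.toLp_compMeasurePreserving, Lp.toLp_compMeasurePreserving, Lp.edist_toLp_toLp]
  congr 1
  ext x
  simp [τ]

/-- Averaging translates of `g` against a bump function barely changes the pairing with `U`. -/
theorem abs_integral_mul_average_sub_le {X : Type*} [NormedAddCommGroup X] [NormedSpace ℝ X]
    [FiniteDimensional ℝ X] [MeasurableSpace X] [BorelSpace X] {m : Measure X} [m.IsAddHaarMeasure]
    {p : ℝ≥0∞} [Fact (1 ≤ p)] (hp : p ≠ ⊤) {U g : X → ℝ} (hU : Measurable U) (hg : Measurable g)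
    (hgp : MemLp g p m) {C : ℝ≥0∞} (hC : C ≠ ⊤)
    (hUC : ∀ k : X → ℝ, Measurable k → ∫⁻ x, ‖U x‖ₑ * ‖k x‖ₑ ∂m ≤ C * eLpNorm k p m)
    {ι : E → X} (hι : Continuous ι) (hι0 : ι 0 = 0) {ε : ℝ} (hε : 0 < ε) :
    ∃ r > 0, ∀ (z : E) (φ : ContDiffBump (0 : E)), ‖z‖ + φ.rOut < r →
      |∫ x, U x * (∫ t, φ.normed volume t * g (x - ι (z + t))) ∂m - ∫ x, U x * g x ∂m| ≤ ε := by
  have hint : ∀ k : X → ℝ, Measurable k → MemLp k p m → Integrable (fun x => U x * k x) m := by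
    intro k hk hkp
    refine ⟨(hU.mul hk).aestronglyMeasurable, ?_⟩
    rw [hasFiniteIntegral_iff_enorm]
    simp_rw [enorm_mul]
    exact (hUC k hk).trans_lt (ENNReal.mul_lt_top hC.lt_top hkp.eLpNorm_lt_top)
  have htr : ∀ h : X, MemLp (fun x => g (x - h)) p m := fun h =>
    hgp.comp_measurePreserving (measurePreserving_sub_right m h)
  have hgm : ∀ h : X, Measurable fun x => g (x - h) := fun h => by fun_prop
  have hlim : Tendsto (fun h : E => C * eLpNorm (fun x => g (x - ι h) - g x) p m) (𝓝 0) (𝓝 0) := by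
    have h1 : Tendsto ι (𝓝 0) (𝓝 0) := by simpa [hι0] using hι.tendsto 0
    have h2 := ENNReal.Tendsto.const_mul ((tendsto_eLpNorm_comp_sub hp hgp).comp h1)
      (Or.inr hC)
    simpa using h2
  obtain ⟨r, hr, hball⟩ := Metric.eventually_nhds_iff.1
    (hlim.eventually (gt_mem_nhds (ENNReal.ofReal_pos.2 hε)))
  refine ⟨r, hr, fun z φ hzφ => ?_⟩
  have hclose : ∀ t ∈ ball (0 : E) φ.rOut,
      |∫ x, U x * g (x - ι (z + t)) ∂m - ∫ x, U x * g x ∂m| ≤ ε := by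
    intro t ht
    have hb : C * eLpNorm (fun x => g (x - ι (z + t)) - g x) p m < ENNReal.ofReal ε := by
      refine hball ?_
      rw [dist_zero_right]
      have := norm_add_le z t
      have h3 : ‖t‖ < φ.rOut := by simpa using ht
      linarith
    rw [← integral_sub (hint _ (hgm _) (htr _)) (hint g hg hgp), ← Real.norm_eq_abs,
      ← ENNReal.ofReal_le_ofReal_iff hε.le, ofReal_norm]
    refine (enorm_integral_le_lintegral_enorm _).trans (le_trans ?_ hb.le)
    refine le_trans (le_of_eq ?_) (hUC _ ((hgm _).sub hg))
    refine lintegral_congr fun x => ?_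
    rw [← mul_sub, enorm_mul]
  set ψ : E → ℝ := φ.normed volume with hψ
  have hψm : Measurable ψ := φ.continuous_normed.measurable
  have hψint : Integrable ψ := φ.integrable_normed
  have hprod : Integrable (Function.uncurry fun (x : X) (t : E) =>
      U x * (ψ t * g (x - ι (z + t)))) (m.prod volume) := by
    have hm : Measurable (Function.uncurry fun (x : X) (t : E) =>
        U x * (ψ t * g (x - ι (z + t)))) := by
      simp only [Function.uncurry_def]
      have := hι.measurable
      fun_prop
    refine ⟨hm.aestronglyMeasurable, ?_⟩
    rw [hasFiniteIntegral_iff_enorm, lintegral_prod_symm' _ hm.enorm]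
    calc _ ≤ ∫⁻ t : E, ‖ψ t‖ₑ * (C * eLpNorm g p m) := by
          refine lintegral_mono fun t => ?_
          calc _ = ∫⁻ x, ‖ψ t‖ₑ * (‖U x‖ₑ * ‖g (x - ι (z + t))‖ₑ) ∂m := by
                refine lintegral_congr fun x => ?_
                simp only [Function.uncurry_apply_pair, enorm_mul]
                ring
            _ = ‖ψ t‖ₑ * ∫⁻ x, (‖U x‖ₑ * ‖g (x - ι (z + t))‖ₑ) ∂m :=
                lintegral_const_mul _ (by fun_prop)
            _ ≤ _ := by
                gcongr
                refine (hUC _ (hgm _)).trans (le_of_eq ?_)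
                congr 1
                exact eLpNorm_comp_measurePreserving hgp.1
                  (measurePreserving_sub_right m (ι (z + t)))
      _ < ⊤ := by
          rw [lintegral_mul_const _ hψm.enorm]
          exact ENNReal.mul_lt_top hψint.2 (ENNReal.mul_lt_top hC.lt_top hgp.eLpNorm_lt_top)
  -- By Fubini the pairing with the average is the average of the pairings with translates. Each
  -- translate with t in the support of the bump is within ε by `hclose`, and the bump has total
  -- mass 1.
  have hswap : ∫ x, U x * (∫ t, ψ t * g (x - ι (z + t))) ∂m =
      ∫ t, ψ t * ∫ x, U x * g (x - ι (z + t)) ∂m := by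
    simp_rw [← integral_const_mul]
    rw [integral_integral_swap hprod]
    refine integral_congr_ae (Eventually.of_forall fun t => ?_)
    refine integral_congr_ae (Eventually.of_forall fun x => ?_)
    simp only
    ring
  have hψb : Integrable (fun t => ψ t * ∫ x, U x * g (x - ι (z + t)) ∂m) := by
    have := hprod.swap.integral_prod_left
    refine this.congr (Eventually.of_forall fun t => ?_)
    simp only [Function.comp, Prod.swap, Function.uncurry]
    rw [← integral_const_mul]
    refine integral_congr_ae (Eventually.of_forall fun x => ?_)
    simp only
    ring
  have hone : ∫ t, ψ t = 1 := φ.integral_normed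
  have h0 : ∫ x, U x * g x ∂m = ∫ t, ψ t * ∫ x, U x * g x ∂m := by
    rw [integral_mul_const, hone, one_mul]
  rw [hswap, h0, ← integral_sub hψb (hψint.mul_const _), ← Real.norm_eq_abs]
  refine (norm_integral_le_of_norm_le (hψint.mul_const ε) (Eventually.of_forall fun t => ?_)).trans
    (le_of_eq (by rw [integral_mul_const, hone, one_mul]))
  rw [← mul_sub, norm_mul, Real.norm_of_nonneg (φ.nonneg_normed t)]
  by_cases ht : t ∈ ball (0 : E) φ.rOut
  · exact mul_le_mul_of_nonneg_left (hclose t ht) (φ.nonneg_normed t)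
  · have : ψ t = 0 := by
      rw [← φ.support_normed_eq (μ := volume)] at ht
      simpa using ht
    rw [← hψ, this, zero_mul, zero_mul]

/-! ### Difference quotients and Lipschitz cutoffs -/

/-- The difference quotient of order `s`, normalized for `L²` on the product. -/
def diffQuot (s : ℝ) (v : E → ℝ) (p : E × E) : ℝ :=
  (v p.1 - v p.2) / ‖p.1 - p.2‖ ^ ((finrank ℝ E : ℝ) / 2 + s)

@[fun_prop]
theorem measurable_diffQuot (s : ℝ) {v : E → ℝ} (hv : Measurable v) : Measurable (diffQuot s v) := by
  have : Measurable fun p : E × E => ‖p.1 - p.2‖ ^ ((finrank ℝ E : ℝ) / 2 + s) :=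
    (by fun_prop : Measurable fun p : E × E => ‖p.1 - p.2‖).pow_const _
  unfold diffQuot
  fun_prop

theorem diffQuot_mul_diffQuot (s : ℝ) (v w : E → ℝ) (p : E × E) :
    diffQuot s v p * diffQuot s w p =
      (v p.1 - v p.2) * (w p.1 - w p.2) / ‖p.1 - p.2‖ ^ ((finrank ℝ E : ℝ) + 2 * s) := by
  rcases eq_or_ne p.1 p.2 with h | h
  · simp [diffQuot, h]
  · have hpos : 0 < ‖p.1 - p.2‖ := norm_pos_iff.2 (sub_ne_zero.2 h)
    rw [diffQuot, diffQuot, div_mul_div_comm, ← Real.rpow_add hpos]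
    congr 2
    ring

theorem enorm_diffQuot_rpow_two (s : ℝ) (v : E → ℝ) (p : E × E) :
    ‖diffQuot s v p‖ₑ ^ (2 : ℝ) =
      ENNReal.ofReal ((v p.1 - v p.2) ^ 2 / ‖p.1 - p.2‖ ^ (finrank ℝ E + 2 * s)) := by
  rw [← ofReal_norm, ENNReal.ofReal_rpow_of_nonneg (norm_nonneg _) (by norm_num), Real.rpow_two,
    Real.norm_eq_abs, sq_abs, sq, diffQuot_mul_diffQuot, sq]

theorem lintegral_enorm_diffQuot_rpow_two (s : ℝ) {v : E → ℝ} (hv : Measurable v) :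
    ∫⁻ p, ‖diffQuot s v p‖ₑ ^ (2 : ℝ) ∂(volume.prod volume) = gagliardo s v := by
  simp_rw [enorm_diffQuot_rpow_two]
  exact lintegral_prod _ (measurable_gagliardo_integrand s hv).aemeasurable

theorem memLp_diffQuot_iff (s : ℝ) {v : E → ℝ} (hv : Measurable v) :
    MemLp (diffQuot s v) 2 (volume.prod volume) ↔ gagliardo s v < ⊤ := by
  rw [← lintegral_enorm_diffQuot_rpow_two s hv, MemLp,
    eLpNorm_lt_top_iff_lintegral_rpow_enorm_lt_top two_ne_zero ENNReal.ofNat_ne_top]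
  simp [(measurable_diffQuot s hv).aestronglyMeasurable]

/-- Split χ(x)w(x) - χ(y)w(y) = χ(x)(w(x) - w(y)) + w(y)(χ(x) - χ(y)). The second term is bounded
near the diagonal by the Lipschitz constant and far away by |χ(x) - χ(y)| ≤ 1. The two exponents of
the resulting kernel lie on either side of the dimension precisely when 0 < s < 1. -/
theorem ofReal_sq_mul_sub_mul_le {s : ℝ} {w χ : E → ℝ}
    (hχ0 : ∀ x, 0 ≤ χ x) (hχ1 : ∀ x, χ x ≤ 1) {L : ℝ} (hL : 1 ≤ L)
    (hχL : ∀ x y, |χ x - χ y| ≤ L * ‖x - y‖) (x y : E) :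
    ENNReal.ofReal ((χ x * w x - χ y * w y) ^ 2 / ‖x - y‖ ^ (finrank ℝ E + 2 * s)) ≤
      2 * ENNReal.ofReal ((w x - w y) ^ 2 / ‖x - y‖ ^ (finrank ℝ E + 2 * s)) +
      ENNReal.ofReal (2 * L ^ 2) * ‖w y‖ₑ ^ (2 : ℝ) *
        rieszMin (finrank ℝ E - 2 * (1 - s)) (finrank ℝ E + 2 * s) (x - y) := by
  set d : ℝ := (finrank ℝ E : ℝ) with hd_def
  rcases eq_or_ne x y with rfl | hxy
  · simp
  have hpos : 0 < ‖x - y‖ := norm_pos_iff.2 (sub_ne_zero.2 hxy)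
  have h1 : (χ x * w x - χ y * w y) ^ 2 ≤
      2 * (w x - w y) ^ 2 + 2 * (w y ^ 2 * (χ x - χ y) ^ 2) := by
    have e : χ x * w x - χ y * w y = χ x * (w x - w y) + w y * (χ x - χ y) := by ring
    have h2 : (χ x * (w x - w y)) ^ 2 ≤ (w x - w y) ^ 2 := by
      rw [mul_pow]
      have : χ x ^ 2 ≤ 1 := pow_le_one₀ (hχ0 x) (hχ1 x)
      nlinarith [sq_nonneg (w x - w y)]
    rw [e]
    nlinarith [sq_nonneg (χ x * (w x - w y) - w y * (χ x - χ y))]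
  have hχ2 : (χ x - χ y) ^ 2 ≤ 1 := by
    rw [sq_le_one_iff_abs_le_one, abs_le]
    constructor <;> linarith [hχ0 x, hχ0 y, hχ1 x, hχ1 y]
  have hχ3 : (χ x - χ y) ^ 2 ≤ L ^ 2 * ‖x - y‖ ^ 2 := by
    rw [← mul_pow, ← sq_abs]
    exact pow_le_pow_left₀ (abs_nonneg _) (hχL x y) 2
  have h3 : (χ x - χ y) ^ 2 / ‖x - y‖ ^ (d + 2 * s) ≤
      L ^ 2 * min (‖x - y‖ ^ (-(d - 2 * (1 - s)))) (‖x - y‖ ^ (-(d + 2 * s))) := by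
    rw [mul_min_of_nonneg _ _ (by positivity)]
    refine le_min ?_ ?_
    · have e : ‖x - y‖ ^ (-(d - 2 * (1 - s))) = ‖x - y‖ ^ 2 / ‖x - y‖ ^ (d + 2 * s) := by
        rw [← Real.rpow_ofNat, ← Real.rpow_sub hpos]
        congr 1
        ring
      rw [e, ← mul_div_assoc]
      gcongr
    · rw [Real.rpow_neg hpos.le, ← div_eq_mul_inv]
      exact div_le_div_of_nonneg_right (hχ2.trans (one_le_pow₀ hL)) (by positivity)
  rw [rieszMin, ← ofReal_norm, ENNReal.ofReal_rpow_of_nonneg (norm_nonneg _) (by norm_num),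
    Real.rpow_two, Real.norm_eq_abs, sq_abs, ← ENNReal.ofReal_mul (by positivity),
    ← ENNReal.ofReal_mul (by positivity), ← ENNReal.ofReal_ofNat,
    ← ENNReal.ofReal_mul (by positivity), ← ENNReal.ofReal_add (by positivity) (by positivity)]
  apply ENNReal.ofReal_le_ofReal
  calc _ ≤ (2 * (w x - w y) ^ 2 + 2 * (w y ^ 2 * (χ x - χ y) ^ 2)) / ‖x - y‖ ^ (d + 2 * s) := by
        gcongr
    _ = 2 * ((w x - w y) ^ 2 / ‖x - y‖ ^ (d + 2 * s)) +
        2 * w y ^ 2 * ((χ x - χ y) ^ 2 / ‖x - y‖ ^ (d + 2 * s)) := by ring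
    _ ≤ 2 * ((w x - w y) ^ 2 / ‖x - y‖ ^ (d + 2 * s)) + 2 * w y ^ 2 *
        (L ^ 2 * min (‖x - y‖ ^ (-(d - 2 * (1 - s)))) (‖x - y‖ ^ (-(d + 2 * s)))) := by
        gcongr
    _ = _ := by ring

/-- Multiplication by a Lipschitz cutoff preserves finiteness of the Gagliardo seminorm. -/
theorem gagliardo_mul_lt_top [Nontrivial E] {s : ℝ} (hs0 : 0 < s) (hs1 : s < 1) {w χ : E → ℝ}
    (hw : Measurable w) (hw2 : MemLp w 2) (hwg : gagliardo s w < ⊤)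
    (hχ0 : ∀ x, 0 ≤ χ x) (hχ1 : ∀ x, χ x ≤ 1) {L : ℝ} (hL : 1 ≤ L)
    (hχL : ∀ x y, |χ x - χ y| ≤ L * ‖x - y‖) :
    gagliardo s (fun x => χ x * w x) < ⊤ := by
  have hd : (0 : ℝ) < finrank ℝ E := by exact_mod_cast finrank_pos (R := ℝ) (M := E)
  set d : ℝ := (finrank ℝ E : ℝ) with hd_def
  have hm1 : Measurable (Function.uncurry fun x y : E =>
      2 * ENNReal.ofReal ((w x - w y) ^ 2 / ‖x - y‖ ^ (d + 2 * s))) :=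
    (measurable_gagliardo_integrand s hw).const_mul 2
  have hm2 : Measurable (Function.uncurry fun x y : E =>
      ENNReal.ofReal (2 * L ^ 2) * ‖w y‖ₑ ^ (2 : ℝ) *
        rieszMin (d - 2 * (1 - s)) (d + 2 * s) (x - y)) := by
    simp only [Function.uncurry_def]
    fun_prop
  have hle : gagliardo s (fun x => χ x * w x) ≤ 2 * gagliardo s w +
      ∫⁻ x, ∫⁻ y, ENNReal.ofReal (2 * L ^ 2) * ‖w y‖ₑ ^ (2 : ℝ) *
        rieszMin (d - 2 * (1 - s)) (d + 2 * s) (x - y) := by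
    refine (lintegral_mono fun x => lintegral_mono fun y =>
      ofReal_sq_mul_sub_mul_le hχ0 hχ1 hL hχL x y).trans (le_of_eq ?_)
    rw [gagliardo, ← lintegral_const_mul _ (measurable_gagliardo_integrand s hw).lintegral_prod_right,
      ← lintegral_add_right _ hm2.lintegral_prod_right]
    refine lintegral_congr fun x => ?_
    have a1 : Measurable fun y =>
        ENNReal.ofReal ((w x - w y) ^ 2 / ‖x - y‖ ^ ((finrank ℝ E : ℝ) + 2 * s)) :=
      (measurable_gagliardo_integrand s hw).of_uncurry_left (x := x)
    have a2 : Measurable fun y => ENNReal.ofReal (2 * L ^ 2) * ‖w y‖ₑ ^ (2 : ℝ) *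
        rieszMin (d - 2 * (1 - s)) (d + 2 * s) (x - y) := hm2.of_uncurry_left (x := x)
    rw [lintegral_add_right _ a2, lintegral_const_mul _ a1]
  refine hle.trans_lt (ENNReal.add_lt_top.2 ⟨ENNReal.mul_lt_top (by simp) hwg, ?_⟩)
  rw [lintegral_lintegral_swap hm2.aemeasurable]
  have hin : ∀ y, ∫⁻ x, ENNReal.ofReal (2 * L ^ 2) * ‖w y‖ₑ ^ (2 : ℝ) *
        rieszMin (d - 2 * (1 - s)) (d + 2 * s) (x - y) =
      ‖w y‖ₑ ^ (2 : ℝ) * (ENNReal.ofReal (2 * L ^ 2) *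
        ∫⁻ z : E, rieszMin (d - 2 * (1 - s)) (d + 2 * s) z) := by
    intro y
    rw [lintegral_const_mul _ (by fun_prop),
      lintegral_sub_right_eq_self (fun z : E => rieszMin (d - 2 * (1 - s)) (d + 2 * s) z) y]
    ring
  simp_rw [hin]
  rw [lintegral_mul_const _ (by fun_prop)]
  refine ENNReal.mul_lt_top ?_ (ENNReal.mul_lt_top ENNReal.ofReal_lt_top ?_)
  · have := lintegral_rpow_enorm_lt_top_of_eLpNorm_lt_top two_ne_zero ENNReal.ofNat_ne_top
      hw2.eLpNorm_lt_top
    simpa using this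
  · exact lintegral_min_norm_rpow_lt_top (by linarith) (by linarith)

/-! ### From smooth test functions to the whole energy space -/

/-- Arbitrarily small translations push `K` into `Ω`, uniformly near some shift. -/
def PushesInto (K Ω : Set E) : Prop :=
  ∀ ε > 0, ∃ z : E, ∃ δ > 0, ‖z‖ + δ < ε ∧ ∀ y ∈ K, ∀ t ∈ closedBall (0 : E) δ, y + (z + t) ∈ Ω

/-- Finite-energy functions vanishing outside `K`. -/
structure IsAdmissible (s : ℝ) (q : ℝ≥0∞) (K : Set E) (w : E → ℝ) : Prop where
  measurable : Measurable w
  eq_zero : ∀ x ∉ K, w x = 0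
  memLp : MemLp w q
  memLp_two : MemLp w 2
  gagliardo_lt_top : gagliardo s w < ⊤

theorem IsAdmissible.cutoff [Nontrivial E] {s : ℝ} {q : ℝ≥0∞} {K : Set E} {w : E → ℝ}
    (hw : IsAdmissible s q K w) (hs0 : 0 < s) (hs1 : s < 1) {χ : E → ℝ}
    (hχ0 : ∀ x, 0 ≤ χ x) (hχ1 : ∀ x, χ x ≤ 1) {L : ℝ} (hL : 1 ≤ L)
    (hχL : ∀ x y, |χ x - χ y| ≤ L * ‖x - y‖) {K' : Set E} (hK' : ∀ x ∈ K, x ∉ K' → χ x = 0) :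
    IsAdmissible s q K' (fun x => χ x * w x) := by
  have hχc : Continuous χ := by
    have : LipschitzWith (L.toNNReal) χ := LipschitzWith.of_dist_le_mul fun x y => by
      rw [Real.dist_eq, dist_eq_norm, Real.coe_toNNReal _ (by linarith)]
      exact hχL x y
    exact this.continuous
  have hm : Measurable fun x => χ x * w x := hχc.measurable.mul hw.measurable
  have hle : ∀ x, ‖χ x * w x‖ ≤ ‖w x‖ := fun x => by
    rw [norm_mul, Real.norm_of_nonneg (hχ0 x)]
    exact mul_le_of_le_one_left (norm_nonneg _) (hχ1 x)
  refine ⟨hm, fun x hx => ?_, ?_, ?_, ?_⟩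
  · by_cases hxK : x ∈ K
    · rw [hK' x hxK hx, zero_mul]
    · rw [hw.eq_zero x hxK, mul_zero]
  · exact hw.memLp.mono hm.aestronglyMeasurable (Eventually.of_forall hle)
  · exact hw.memLp_two.mono hm.aestronglyMeasurable (Eventually.of_forall hle)
  · exact gagliardo_mul_lt_top hs0 hs1 hw.measurable hw.memLp_two hw.gagliardo_lt_top hχ0 hχ1 hL hχL

theorem lintegral_enorm_mul_le_eLpNorm_two {X : Type*} [MeasurableSpace X] {m : Measure X}
    {U k : X → ℝ} (hU : Measurable U) (hk : Measurable k) :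
    ∫⁻ x, ‖U x‖ₑ * ‖k x‖ₑ ∂m ≤ eLpNorm U 2 m * eLpNorm k 2 m := by
  have h := eLpNorm_smul_le_mul_eLpNorm (μ := m) (p := 2) (q := 2) (r := 1)
    hk.aestronglyMeasurable hU.aestronglyMeasurable
  rw [eLpNorm_one_eq_lintegral_enorm] at h
  simpa only [Pi.smul_apply', smul_eq_mul, enorm_mul] using h

section WeakForm

variable {s : ℝ} {q : ℝ≥0∞} {Ω : Set E} {u f : E → ℝ} {C : ℝ≥0∞}

/-- Mollify w at scale δ/2 to δ and shift it by z: the push moves its support into Ω, so the result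
is an admissible smooth test function. Both sides of the identity change by an arbitrarily small
amount, the left because difference quotients are continuous under translation in L², the right
because f acts boundedly on L^q. -/
theorem integral_diffQuot_eq_of_pushesInto [Fact (1 ≤ q)] (hq : q ≠ ⊤)
    (hu : Measurable u) (hug : gagliardo s u < ⊤) (hf : Measurable f) (hC : C ≠ ⊤)
    (hfC : ∀ k : E → ℝ, Measurable k → ∫⁻ x, ‖f x‖ₑ * ‖k x‖ₑ ≤ C * eLpNorm k q)
    (hweak : ∀ φ : E → ℝ, ContDiff ℝ ∞ φ → HasCompactSupport φ → tsupport φ ⊆ Ω →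
      ∫ p, diffQuot s u p * diffQuot s φ p ∂(volume.prod volume) = ∫ x, f x * φ x)
    {K : Set E} (hK : IsCompact K) (hpush : PushesInto K Ω) {w : E → ℝ}
    (hw : IsAdmissible s q K w) :
    ∫ p, diffQuot s u p * diffQuot s w p ∂(volume.prod volume) = ∫ x, f x * w x := by
  have huL := (memLp_diffQuot_iff s hu).2 hug
  have hwL := (memLp_diffQuot_iff s hw.measurable).2 hw.gagliardo_lt_top
  refine eq_of_abs_sub_le_all fun ε hε => ?_
  have : Fact ((1 : ℝ≥0∞) ≤ 2) := ⟨one_le_two⟩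
  -- On E × E the shift is the diagonal one, since taking difference quotients commutes with
  -- translating both variables by the same vector.
  obtain ⟨r₁, hr₁, h₁⟩ := abs_integral_mul_average_sub_le (E := E) (X := E × E) (p := 2)
    (m := volume.prod volume) ENNReal.ofNat_ne_top
    (measurable_diffQuot s hu) (measurable_diffQuot s hw.measurable) hwL huL.eLpNorm_lt_top.ne
    (fun k hk => lintegral_enorm_mul_le_eLpNorm_two (measurable_diffQuot s hu) hk)
    (ι := fun h => (h, h)) (by fun_prop) rfl (half_pos hε)
  obtain ⟨r₂, hr₂, h₂⟩ := abs_integral_mul_average_sub_le (E := E) (X := E) hq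
    hf hw.measurable hw.memLp hC hfC (ι := fun h => h) (by fun_prop) rfl (half_pos hε)
  obtain ⟨z, δ, hδ, hzδ, hzΩ⟩ := hpush (min r₁ r₂) (lt_min hr₁ hr₂)
  let φ : ContDiffBump (0 : E) := ⟨δ / 2, δ, half_pos hδ, half_lt_self hδ⟩
  have hφδ : φ.rOut = δ := rfl
  have hwloc : LocallyIntegrable w := hw.memLp_two.locallyIntegrable one_le_two
  set ψ₀ : E → ℝ := convolution (φ.normed volume) w (ContinuousLinearMap.lsmul ℝ ℝ) volume with hψ₀
  have hψ₀eq : ∀ x, ψ₀ x = ∫ t, φ.normed volume t * w (x - t) := fun x => rfl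
  have hint : ∀ x, Integrable fun t => φ.normed volume t * w (x - t) := fun x =>
    φ.hasCompactSupport_normed.convolutionExists_left (ContinuousLinearMap.lsmul ℝ ℝ)
      φ.continuous_normed hwloc x
  set ψ : E → ℝ := fun x => ψ₀ (x - z) with hψ
  have hψeq : ∀ x, ψ x = ∫ t, φ.normed volume t * w (x - (z + t)) := fun x => by
    rw [hψ]
    simp only [hψ₀eq, sub_sub]
  have hint' : ∀ x, Integrable fun t => φ.normed volume t * w (x - (z + t)) := fun x => by
    simpa only [sub_sub] using hint (x - z)
  have hψsmooth : ContDiff ℝ ∞ ψ :=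
    (φ.hasCompactSupport_normed.contDiff_convolution_left _ φ.contDiff_normed hwloc).comp
      (contDiff_id.sub contDiff_const)
  -- A compact set containing the support of the shifted mollification; the push places all of it
  -- inside Ω.
  set K' : Set E := (fun a : E × E => a.1 + (z + a.2)) '' (K ×ˢ closedBall 0 δ) with hK'
  have hK'c : IsCompact K' := (hK.prod (isCompact_closedBall _ _)).image (by fun_prop)
  have hK'Ω : K' ⊆ Ω := by
    rintro _ ⟨⟨y, t⟩, ⟨hy, ht⟩, rfl⟩
    exact hzΩ y hy t ht
  have hψ0 : ∀ x ∉ K', ψ x = 0 := by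
    intro x hx
    rw [hψeq]
    refine integral_eq_zero_of_ae (Eventually.of_forall fun t => ?_)
    by_cases ht : t ∈ ball (0 : E) δ
    · have : x - (z + t) ∉ K := fun h =>
        hx ⟨(x - (z + t), t), ⟨h, ball_subset_closedBall ht⟩, by simp⟩
      simp [hw.eq_zero _ this]
    · rw [← hφδ, ← φ.support_normed_eq (μ := volume)] at ht
      have : φ.normed volume t = 0 := by simpa using ht
      simp [this]
  have hψsupp : HasCompactSupport ψ := HasCompactSupport.intro hK'c hψ0
  have hψts : tsupport ψ ⊆ Ω := by
    refine (closure_minimal (fun x hx => ?_) hK'c.isClosed).trans hK'Ω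
    by_contra h
    exact hx (hψ0 x h)
  have hdq : ∀ p : E × E, diffQuot s ψ p =
      ∫ t, φ.normed volume t * diffQuot s w (p - (z + t, z + t)) := by
    intro p
    have e : ∀ t, φ.normed volume t * diffQuot s w (p - (z + t, z + t)) =
        (φ.normed volume t * w (p.1 - (z + t)) - φ.normed volume t * w (p.2 - (z + t))) /
          ‖p.1 - p.2‖ ^ ((finrank ℝ E : ℝ) / 2 + s) := by
      intro t
      simp only [diffQuot, Prod.fst_sub, Prod.snd_sub, sub_sub_sub_cancel_right]
      ring
    simp_rw [e]
    rw [integral_div, integral_sub (hint' _) (hint' _), ← hψeq, ← hψeq]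
    rfl
  have key := hweak ψ hψsmooth hψsupp hψts
  simp_rw [hdq, hψeq] at key
  have a₁ := h₁ z φ (hzδ.trans_le (min_le_left _ _))
  have a₂ := h₂ z φ (hzδ.trans_le (min_le_right _ _))
  rw [key] at a₁
  rw [abs_le] at a₁ a₂ ⊢
  constructor <;> linarith [a₁.1, a₁.2, a₂.1, a₂.2]

/-- A weak formulation against smooth test functions extends to all finite-energy functions, if
`Ω` can locally be pushed into itself. -/
theorem integral_diffQuot_eq_of_isAdmissible [Nontrivial E] [Fact (1 ≤ q)] (hq : q ≠ ⊤)
    (hs0 : 0 < s) (hs1 : s < 1)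
    (hu : Measurable u) (hug : gagliardo s u < ⊤) (hf : Measurable f) (hC : C ≠ ⊤)
    (hfC : ∀ k : E → ℝ, Measurable k → ∫⁻ x, ‖f x‖ₑ * ‖k x‖ₑ ≤ C * eLpNorm k q)
    (hweak : ∀ φ : E → ℝ, ContDiff ℝ ∞ φ → HasCompactSupport φ → tsupport φ ⊆ Ω →
      ∫ p, diffQuot s u p * diffQuot s φ p ∂(volume.prod volume) = ∫ x, f x * φ x)
    (hΩ : Bornology.IsBounded Ω)
    (hpush : ∀ x ∈ closure Ω, ∃ r > 0, PushesInto (closure Ω ∩ closedBall x r) Ω) {w : E → ℝ}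
    (hw : IsAdmissible s q Ω w) :
    ∫ p, diffQuot s u p * diffQuot s w p ∂(volume.prod volume) = ∫ x, f x * w x := by
  have hcomp : IsCompact (closure Ω) := hΩ.isCompact_closure
  have hpush' : ∀ x : closure Ω, ∃ r > 0, PushesInto (closure Ω ∩ closedBall (x : E) r) Ω :=
    fun x => hpush x x.2
  choose r hr hrp using hpush'
  have hint₁ : ∀ {K : Set E} {w : E → ℝ}, IsAdmissible s q K w →
      Integrable (fun p => diffQuot s u p * diffQuot s w p) (volume.prod volume) := fun h =>
    ((memLp_diffQuot_iff s hu).2 hug).integrable_mul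
      ((memLp_diffQuot_iff s h.measurable).2 h.gagliardo_lt_top)
  have hint₂ : ∀ {K : Set E} {w : E → ℝ}, IsAdmissible s q K w →
      Integrable (fun x => f x * w x) := by
    intro K w h
    refine ⟨(hf.mul h.measurable).aestronglyMeasurable, ?_⟩
    rw [hasFiniteIntegral_iff_enorm]
    simp_rw [enorm_mul]
    exact (hfC w h.measurable).trans_lt (ENNReal.mul_lt_top hC.lt_top h.memLp.eLpNorm_lt_top)
  classical
  -- Induction on the number of half-radius balls needed to cover the set outside which w vanishes.
  have main : ∀ (t : Finset (closure Ω)) (w : E → ℝ),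
      IsAdmissible s q (closure Ω ∩ ⋃ x ∈ t, ball (x : E) (r x / 2)) w →
      ∫ p, diffQuot s u p * diffQuot s w p ∂(volume.prod volume) = ∫ x, f x * w x := by
    intro t
    induction t using Finset.induction_on with
    | empty =>
      intro w hw
      have : w = fun _ => 0 := funext fun x => hw.eq_zero x (by simp)
      subst this
      simp [diffQuot]
    | insert a t ha ih =>
      intro w hw
      -- This cutoff is 1 on the half-radius ball and 0 off the ball of radius `r a`. So χw lives
      -- where the push is available, and (1 - χ)w vanishes on the half ball of `a` and falls under
      -- the induction hypothesis.
      set χ : E → ℝ := fun y => max 0 (min 1 (2 - ‖y - a‖ / (r a / 2))) with hχ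
      have hr2 : 0 < r a / 2 := half_pos (hr a)
      have hχ0 : ∀ y, 0 ≤ χ y := fun y => le_max_left _ _
      have hχ1 : ∀ y, χ y ≤ 1 := fun y => max_le zero_le_one (min_le_left _ _)
      have hχL : ∀ x y, |χ x - χ y| ≤ max 1 (r a / 2)⁻¹ * ‖x - y‖ := by
        intro x y
        have h1 := abs_max_sub_max_le_max 0 (min 1 (2 - ‖x - a‖ / (r a / 2))) 0
          (min 1 (2 - ‖y - a‖ / (r a / 2)))
        have h2 := abs_min_sub_min_le_max 1 (2 - ‖x - a‖ / (r a / 2)) 1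
          (2 - ‖y - a‖ / (r a / 2))
        have h0 : |(0 : ℝ) - 0| ≤ max 1 (r a / 2)⁻¹ * ‖x - y‖ := by
          rw [sub_self, abs_zero]; positivity
        have h0' : |(1 : ℝ) - 1| ≤ max 1 (r a / 2)⁻¹ * ‖x - y‖ := by
          rw [sub_self, abs_zero]; positivity
        refine h1.trans (max_le h0 (h2.trans (max_le h0' ?_)))
        have e : 2 - ‖x - a‖ / (r a / 2) - (2 - ‖y - a‖ / (r a / 2)) =
            (r a / 2)⁻¹ * (‖y - a‖ - ‖x - a‖) := by ring
        rw [e, abs_mul, abs_of_pos (inv_pos.2 hr2)]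
        have h3 := abs_norm_sub_norm_le (y - a) (x - a)
        rw [sub_sub_sub_cancel_right, norm_sub_rev y x] at h3
        exact mul_le_mul (le_max_right _ _) h3 (abs_nonneg _) (by positivity)
      have hχball : ∀ y ∈ ball (a : E) (r a / 2), χ y = 1 := by
        intro y hy
        rw [mem_ball, dist_eq_norm] at hy
        have : ‖y - a‖ / (r a / 2) ≤ 1 := (div_le_one hr2).2 hy.le
        simp only [hχ]
        rw [min_eq_left (by linarith), max_eq_right zero_le_one]
      have hχout : ∀ y ∉ closedBall (a : E) (r a), χ y = 0 := by
        intro y hy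
        rw [mem_closedBall, dist_eq_norm, not_le] at hy
        have : 2 ≤ ‖y - a‖ / (r a / 2) := by
          rw [le_div_iff₀ hr2]; linarith
        simp only [hχ]
        rw [min_eq_right (by linarith), max_eq_left (by linarith)]
      have hA := hw.cutoff hs0 hs1 hχ0 hχ1 (le_max_left _ _) hχL
        (K' := closure Ω ∩ closedBall (a : E) (r a))
        (fun x hx hx' => hχout x fun h => hx' ⟨hx.1, h⟩)
      have hB := hw.cutoff hs0 hs1 (χ := fun y => 1 - χ y) (fun x => sub_nonneg.2 (hχ1 x))
        (fun x => by linarith [hχ0 x]) (le_max_left _ _)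
        (fun x y => by
          rw [sub_sub_sub_cancel_left, abs_sub_comm]
          exact hχL x y)
        (K' := closure Ω ∩ ⋃ x ∈ t, ball (x : E) (r x / 2)) (by
          intro x hx hx'
          have hxa : x ∈ ball (a : E) (r a / 2) := by
            obtain ⟨hx1, hx2⟩ := hx
            rw [Finset.set_biUnion_insert] at hx2
            exact hx2.resolve_right fun h => hx' ⟨hx1, h⟩
          simp [hχball x hxa])
      have eA := integral_diffQuot_eq_of_pushesInto hq hu hug hf hC hfC hweak
        (hcomp.inter_right isClosed_closedBall) (hrp a) hA
      have eB := ih _ hB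
      have hsum₁ : ∀ p, diffQuot s u p * diffQuot s w p =
          diffQuot s u p * diffQuot s (fun x => χ x * w x) p +
          diffQuot s u p * diffQuot s (fun x => (1 - χ x) * w x) p := by
        intro p
        simp only [diffQuot]
        ring
      have hsum₂ : ∀ x, f x * w x = f x * (χ x * w x) + f x * ((1 - χ x) * w x) := by
        intro x
        ring
      simp_rw [hsum₁, hsum₂]
      rw [integral_add (hint₁ hA) (hint₁ hB), integral_add (hint₂ hA) (hint₂ hB), eA, eB]
  obtain ⟨t, ht⟩ := hcomp.elim_finite_subcover (fun x : closure Ω => ball (x : E) (r x / 2))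
    (fun x => isOpen_ball) (fun x hx => mem_iUnion.2 ⟨⟨x, hx⟩, mem_ball_self (half_pos (hr _))⟩)
  refine main t w ⟨hw.measurable, fun x hx => hw.eq_zero x fun hxΩ => hx ?_, hw.memLp,
    hw.memLp_two, hw.gagliardo_lt_top⟩
  exact ⟨subset_closure hxΩ, ht (subset_closure hxΩ)⟩

end WeakForm

/-! ### Pushing a Lipschitz domain into itself -/

/-- A Lipschitz domain can be pushed into itself near each point of its closure. -/
theorem IsBoundedLipschitzDomain.exists_pushesInto {n : ℕ} {Ω : Set (EuclideanSpace ℝ (Fin n))}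
    (hΩ : IsBoundedLipschitzDomain Ω) {x : EuclideanSpace ℝ (Fin n)} (hx : x ∈ closure Ω) :
    ∃ r > 0, PushesInto (closure Ω ∩ closedBall x r) Ω := by
  by_cases hxΩ : x ∈ Ω
  · obtain ⟨r, hr, hball⟩ := Metric.isOpen_iff.1 hΩ.isOpen x hxΩ
    refine ⟨r / 2, half_pos hr, fun ε hε => ⟨0, min (r / 4) (ε / 2), by positivity, ?_, ?_⟩⟩
    · rw [norm_zero, zero_add]
      exact (min_le_right _ _).trans_lt (half_lt_self hε)
    · rintro y ⟨-, hy⟩ t ht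
      apply hball
      rw [mem_closedBall, dist_eq_norm] at hy
      rw [mem_closedBall_zero_iff] at ht
      rw [mem_ball, dist_eq_norm, zero_add, add_sub_right_comm]
      have := norm_add_le (y - x) t
      have := ht.trans (min_le_left _ _)
      linarith
  · have hfr : x ∈ frontier Ω := by
      rw [frontier, hΩ.isOpen.interior_eq]
      exact ⟨hx, hxΩ⟩
    obtain ⟨r, ν, K, g, hr, hν, hg, hgraph⟩ := hΩ.lipschitz x hfr
    refine ⟨r / 2, half_pos hr, fun ε hε => ?_⟩
    -- The shift is τν, upwards from the graph. A perturbation t of norm at most δ changes the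
    -- height by at most δ and the value of g by at most Kδ; with (K + 2)δ = τ a strict margin δ
    -- remains. This is enough for points of the closure, which satisfy only the non-strict graph
    -- inequality.
    set τ : ℝ := min (r / 8) (ε / 4) with hτ
    have hτ0 : 0 < τ := by positivity
    have hτr : τ ≤ r / 8 := min_le_left _ _
    have hτε : τ ≤ ε / 4 := min_le_right _ _
    have hK0 : (0 : ℝ) ≤ K := K.2
    set δ : ℝ := τ / (K + 2) with hδ
    have hδ0 : 0 < δ := by positivity
    have hδτ : δ * (K + 2) = τ := div_mul_cancel₀ _ (by positivity)
    have hδle : δ ≤ τ := by nlinarith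
    have hzn : ‖τ • ν‖ = τ := by rw [norm_smul, hν, mul_one, Real.norm_of_nonneg hτ0.le]
    refine ⟨τ • ν, δ, hδ0, by rw [hzn]; linarith, ?_⟩
    rintro y ⟨hyΩ, hyx⟩ t ht
    rw [mem_closedBall, dist_eq_norm] at hyx
    rw [mem_closedBall_zero_iff] at ht
    have hgc : Continuous g := hg.continuous
    have hyball : y ∈ ball x r := by
      rw [mem_ball, dist_eq_norm]
      linarith
    have hy : g (y - inner ℝ ν y • ν) ≤ inner ℝ ν y := by
      have hcl : IsClosed {y | g (y - inner ℝ ν y • ν) ≤ inner ℝ ν y} :=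
        isClosed_le (by fun_prop) (by fun_prop)
      have hsub : Ω ∩ ball x r ⊆ {y | g (y - inner ℝ ν y • ν) ≤ inner ℝ ν y} :=
        fun y hy => ((hgraph y hy.2).1 hy.1).le
      have h2 : y ∈ closure (Ω ∩ ball x r) := by
        rw [inter_comm]
        exact isOpen_ball.inter_closure ⟨hyball, hyΩ⟩
      exact closure_minimal hsub hcl h2
    have hmem : y + (τ • ν + t) ∈ ball x r := by
      rw [mem_ball, dist_eq_norm, add_sub_right_comm]
      have h1 := norm_add_le (y - x) (τ • ν + t)
      have h2 := norm_add_le (τ • ν) t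
      linarith
    rw [hgraph _ hmem]
    have hνν : inner ℝ ν ν = (1 : ℝ) := by rw [real_inner_self_eq_norm_sq, hν]; norm_num
    have hin : inner ℝ ν (y + (τ • ν + t)) = inner ℝ ν y + (τ + inner ℝ ν t) := by
      rw [inner_add_right, inner_add_right, inner_smul_right, hνν, mul_one]
    have hproj : y + (τ • ν + t) - inner ℝ ν (y + (τ • ν + t)) • ν =
        (y - inner ℝ ν y • ν) + (t - inner ℝ ν t • ν) := by
      rw [hin, add_smul, add_smul]
      abel
    have hνt : |inner ℝ ν t| ≤ δ := by
      have := abs_real_inner_le_norm ν t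
      rw [hν, one_mul] at this
      exact this.trans ht
    have hpt : ‖t - inner ℝ ν t • ν‖ ≤ ‖t‖ := by
      have h1 : ‖t - inner ℝ ν t • ν‖ ^ 2 = ‖t‖ ^ 2 - (inner ℝ ν t) ^ 2 := by
        rw [norm_sub_sq_real, inner_smul_right, norm_smul, hν, mul_one, Real.norm_eq_abs, sq_abs,
          real_inner_comm]
        ring
      refine abs_le_of_sq_le_sq' ?_ (norm_nonneg _) |>.2
      rw [h1]
      linarith [sq_nonneg (inner ℝ ν t : ℝ)]
    have hgl := hg.dist_le_mul ((y - inner ℝ ν y • ν) + (t - inner ℝ ν t • ν))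
      (y - inner ℝ ν y • ν)
    rw [Real.dist_eq, dist_eq_norm, add_sub_cancel_left] at hgl
    have h3 := (abs_le.1 hgl).2
    have h4 : (K : ℝ) * ‖t - inner ℝ ν t • ν‖ ≤ K * δ :=
      mul_le_mul_of_nonneg_left (hpt.trans ht) hK0
    have h5 := (abs_le.1 hνt).1
    rw [hproj, hin]
    nlinarith

/-! ### Scalar inequalities for truncated powers -/

section Truncation

variable {a b T β : ℝ}

/-- `t * min t T ^ γ` has slope at most `(γ + 1) * min t T ^ γ`. -/
theorem mul_min_rpow_sub_le {γ : ℝ} (hb : 0 ≤ b) (hab : b ≤ a) (hT : 0 < T) (hγ : 0 ≤ γ) :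
    a * min a T ^ γ - b * min b T ^ γ ≤ (γ + 1) * min a T ^ γ * (a - b) := by
  have ha : 0 ≤ a := hb.trans hab
  set A := min a T with hA
  set B := min b T with hB
  have hA0 : 0 ≤ A := le_min ha hT.le
  have hB0 : 0 ≤ B := le_min hb hT.le
  have hBA : B ≤ A := min_le_min_right _ hab
  have hABab : A - B ≤ a - b := by
    rcases le_total a T with h | h
    · rw [hA, hB, min_eq_left h, min_eq_left (hab.trans h)]
    · rw [hA, min_eq_right h]
      rcases le_total b T with h' | h'
      · rw [hB, min_eq_left h']; linarith
      · rw [hB, min_eq_right h']; linarith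
  have hAγ : 0 ≤ A ^ γ := Real.rpow_nonneg hA0 _
  -- The left side of the goal is (a - b)A^γ + b(A^γ - B^γ), so the second summand is what has to be
  -- bounded. For b ≤ T it is convexity of t^(γ+1); for b ≥ T both truncations equal T and it
  -- vanishes.
  have key : b * (A ^ γ - B ^ γ) ≤ γ * A ^ γ * (A - B) := by
    rcases le_total b T with h | h
    · have hBb : B = b := min_eq_left h
      rw [hBb] at hBA ⊢
      rcases hA0.eq_or_lt with hA00 | hApos
      · have : b = 0 := le_antisymm (by rw [hA00]; exact hBA) hb
        rw [this, ← hA00]; simp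
      -- Bernoulli's inequality for the ratio
      have hbern := one_add_mul_self_le_rpow_one_add (s := b / A - 1) (p := γ + 1)
        (by have : 0 ≤ b / A := by positivity
            linarith) (by linarith)
      rw [add_sub_cancel, Real.div_rpow hb hA0, Real.rpow_add_one' hA0 (by positivity),
        Real.rpow_add_one' hb (by positivity)] at hbern
      have h2 := mul_le_mul_of_nonneg_left hbern (mul_nonneg hAγ hA0)
      have e : A ^ γ * A * (b ^ γ * b / (A ^ γ * A)) = b ^ γ * b := by
        have : A ^ γ ≠ 0 := (Real.rpow_pos_of_pos hApos _).ne'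
        field_simp
      have e2 : A ^ γ * A * (1 + (γ + 1) * (b / A - 1)) =
          A ^ γ * (A + (γ + 1) * (b - A)) := by
        field_simp
      rw [e, e2] at h2
      linarith
    · have h1 : A = T := min_eq_right (h.trans hab)
      have h2 : B = T := min_eq_right h
      rw [h1, h2]; simp
  have h3 : γ * A ^ γ * (A - B) ≤ γ * A ^ γ * (a - b) :=
    mul_le_mul_of_nonneg_left hABab (by positivity)
  nlinarith

theorem mul_min_rpow_mono {γ : ℝ} (hb : 0 ≤ b) (hab : b ≤ a) (hT : 0 < T) (hγ : 0 ≤ γ) :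
    b * min b T ^ γ ≤ a * min a T ^ γ :=
  mul_le_mul hab (Real.rpow_le_rpow (le_min hb hT.le) (min_le_min_right _ hab) hγ)
    (Real.rpow_nonneg (le_min hb hT.le) _) (hb.trans hab)

theorem abs_mul_min_rpow_sub_le {γ : ℝ} (ha : 0 ≤ a) (hb : 0 ≤ b) (hT : 0 < T) (hγ : 0 ≤ γ) :
    |a * min a T ^ γ - b * min b T ^ γ| ≤ (γ + 1) * T ^ γ * |a - b| := by
  wlog hab : b ≤ a generalizing a b
  · rw [abs_sub_comm, abs_sub_comm a]
    exact this hb ha (le_of_not_ge hab)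
  rw [abs_of_nonneg (sub_nonneg.2 (mul_min_rpow_mono hb hab hT hγ)),
    abs_of_nonneg (sub_nonneg.2 hab)]
  refine (mul_min_rpow_sub_le hb hab hT hγ).trans ?_
  have : min a T ^ γ ≤ T ^ γ := Real.rpow_le_rpow (le_min ha hT.le) (min_le_right _ _) hγ
  have := sub_nonneg.2 hab
  gcongr

/-- The nonlocal chain rule inequality for truncated powers. -/
theorem sq_mul_min_rpow_sub_le (ha : 0 ≤ a) (hb : 0 ≤ b) (hT : 0 < T) (hβ : 1 ≤ β) :
    (a * min a T ^ (β - 1) - b * min b T ^ (β - 1)) ^ 2 ≤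
      β * ((a - b) * (a * min a T ^ (2 * β - 2) - b * min b T ^ (2 * β - 2))) := by
  wlog hab : b ≤ a generalizing a b
  · have := this hb ha (le_of_not_ge hab)
    calc _ = (b * min b T ^ (β - 1) - a * min a T ^ (β - 1)) ^ 2 := by ring
      _ ≤ _ := this
      _ = _ := by ring
  have hγ : 0 ≤ β - 1 := by linarith
  have hA0 : 0 ≤ min a T := le_min ha hT.le
  have hB0 : 0 ≤ min b T := le_min hb hT.le
  have h1 := mul_min_rpow_sub_le hb hab hT hγ
  rw [sub_add_cancel] at h1
  have h0 := sub_nonneg.2 (mul_min_rpow_mono hb hab hT hγ)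
  have hsq : ∀ t : ℝ, 0 ≤ t → t ^ (2 * β - 2) = t ^ (β - 1) * t ^ (β - 1) := by
    intro t ht
    rw [← Real.rpow_add_of_nonneg ht hγ hγ]
    ring_nf
  rw [hsq _ hA0, hsq _ hB0]
  have hBA : min b T ^ (β - 1) ≤ min a T ^ (β - 1) :=
    Real.rpow_le_rpow hB0 (min_le_min_right _ hab) hγ
  set P := min a T ^ (β - 1) with hP
  set R := min b T ^ (β - 1) with hR
  have hR0 : 0 ≤ R := Real.rpow_nonneg hB0 _
  have hP0 : 0 ≤ P := Real.rpow_nonneg hA0 _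
  -- The increment of t min(t,T)^(2β-2) dominates P times that of t min(t,T)^(β-1), because R ≤ P.
  -- The slope bound `h1` replaces one of the two factors aP - bR in the square by βP(a - b).
  have h2 : P * (a * P - b * R) ≤ a * (P * P) - b * (R * R) := by
    have : b * R * R ≤ b * R * P := mul_le_mul_of_nonneg_left hBA (by positivity)
    nlinarith
  have h3 : (a - b) * (P * (a * P - b * R)) ≤ (a - b) * (a * (P * P) - b * (R * R)) :=
    mul_le_mul_of_nonneg_left h2 (sub_nonneg.2 hab)
  calc _ = (a * P - b * R) * (a * P - b * R) := by ring
    _ ≤ β * P * (a - b) * (a * P - b * R) := mul_le_mul_of_nonneg_right h1 h0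
    _ = β * ((a - b) * (P * (a * P - b * R))) := by ring
    _ ≤ _ := mul_le_mul_of_nonneg_left h3 (by linarith)

end Truncation

/-! ### The energy inequality -/

/-- Testing the weak formulation with a Lipschitz function of the solution. -/
theorem energy_inequality [Nontrivial E] {s q : ℝ}
    {Ω : Set E} {u f : E → ℝ} {CS : ℝ≥0∞}
    (hsob : ∀ v : E → ℝ, Measurable v → (∀ x, 0 ≤ v x) → volume (Function.support v) ≠ ⊤ →
      (∫⁻ x, ENNReal.ofReal (v x) ^ q) ^ (2 / q) ≤ CS * gagliardo s v)
    (hΩ : volume Ω ≠ ⊤) (hu : IsAdmissible s (ENNReal.ofReal q) Ω u) (hu0 : ∀ x, 0 ≤ u x)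
    (hf0 : ∀ x, 0 ≤ f x) (hfint : ∀ w, IsAdmissible s (ENNReal.ofReal q) Ω w →
      Integrable fun x => f x * w x)
    (hweak : ∀ w, IsAdmissible s (ENNReal.ofReal q) Ω w →
      ∫ p, diffQuot s u p * diffQuot s w p ∂(volume.prod volume) = ∫ x, f x * w x)
    {g G : ℝ → ℝ} (hgm : Measurable g) (hGm : Measurable G) (hg0 : g 0 = 0) (hG0 : G 0 = 0)
    (hgpos : ∀ t, 0 ≤ t → 0 ≤ g t) (hGpos : ∀ t, 0 ≤ t → 0 ≤ G t) {L c : ℝ} (hc : 0 ≤ c)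
    (hgL : ∀ a b, 0 ≤ a → 0 ≤ b → |g a - g b| ≤ L * |a - b|)
    (hgG : ∀ a b, 0 ≤ a → 0 ≤ b → (G a - G b) ^ 2 ≤ c * ((a - b) * (g a - g b))) :
    (∫⁻ x, ENNReal.ofReal (G (u x)) ^ q) ^ (2 / q) ≤
      CS * ENNReal.ofReal c * ∫⁻ x, ENNReal.ofReal (f x) * ENNReal.ofReal (g (u x)) := by
  have hwm : Measurable fun x => g (u x) := hgm.comp hu.measurable
  have hvm : Measurable fun x => G (u x) := hGm.comp hu.measurable
  have hle : ∀ x, ‖g (u x)‖ ≤ ‖L * u x‖ := fun x => by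
    have := hgL (u x) 0 (hu0 x) le_rfl
    rw [hg0, sub_zero, sub_zero] at this
    rw [norm_mul, Real.norm_eq_abs, Real.norm_eq_abs, Real.norm_eq_abs]
    exact this.trans (mul_le_mul_of_nonneg_right (le_abs_self _) (abs_nonneg _))
  have hLu : gagliardo s (fun x => L * u x) < ⊤ := by
    rw [← memLp_diffQuot_iff s (hu.measurable.const_mul L)]
    have := ((memLp_diffQuot_iff s hu.measurable).2 hu.gagliardo_lt_top).const_mul L
    refine (memLp_congr_ae (Eventually.of_forall fun p => ?_)).1 this
    simp only [diffQuot]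
    ring
  have hw : IsAdmissible s (ENNReal.ofReal q) Ω fun x => g (u x) := by
    refine ⟨hwm, fun x hx => by rw [hu.eq_zero x hx, hg0], ?_, ?_, ?_⟩
    · exact (hu.memLp.const_mul L).mono hwm.aestronglyMeasurable (Eventually.of_forall hle)
    · exact (hu.memLp_two.const_mul L).mono hwm.aestronglyMeasurable (Eventually.of_forall hle)
    · refine (gagliardo_mono fun x y => ?_).trans_lt hLu
      rw [← mul_sub, abs_mul]
      exact (hgL _ _ (hu0 x) (hu0 y)).trans
        (mul_le_mul_of_nonneg_right (le_abs_self _) (abs_nonneg _))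
  have hsupp : volume (Function.support fun x => G (u x)) ≠ ⊤ := by
    refine ((measure_mono fun x hx => ?_).trans_lt hΩ.lt_top).ne
    by_contra h
    exact hx (by simp [hu.eq_zero x h, hG0])
  refine (hsob _ hvm (fun x => hGpos _ (hu0 x)) hsupp).trans ?_
  rw [mul_assoc]
  refine mul_le_mul_right ?_ _
  -- The hypothesis `hgG` divided by the kernel. It also shows that the integrand of the tested
  -- identity is nonnegative, which allows passing from the Bochner integral to the lower integral.
  have hpt : ∀ p : E × E, (diffQuot s (fun x => G (u x)) p) ^ 2 ≤
      c * (diffQuot s u p * diffQuot s (fun x => g (u x)) p) := by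
    intro p
    rw [sq, diffQuot_mul_diffQuot, diffQuot_mul_diffQuot, ← mul_div_assoc, ← sq]
    have := hgG (u p.1) (u p.2) (hu0 _) (hu0 _)
    gcongr
  have hint : Integrable (fun p => c * (diffQuot s u p * diffQuot s (fun x => g (u x)) p))
      (volume.prod volume) :=
    (((memLp_diffQuot_iff s hu.measurable).2 hu.gagliardo_lt_top).integrable_mul
      ((memLp_diffQuot_iff s hwm).2 hw.gagliardo_lt_top)).const_mul c
  calc gagliardo s (fun x => G (u x))
      = ∫⁻ p, ‖diffQuot s (fun x => G (u x)) p‖ₑ ^ (2 : ℝ) ∂(volume.prod volume) :=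
        (lintegral_enorm_diffQuot_rpow_two s hvm).symm
    _ ≤ ∫⁻ p, ENNReal.ofReal (c * (diffQuot s u p * diffQuot s (fun x => g (u x)) p))
          ∂(volume.prod volume) := by
        refine lintegral_mono fun p => ?_
        rw [← ofReal_norm, ENNReal.ofReal_rpow_of_nonneg (norm_nonneg _) (by norm_num),
          Real.rpow_two, Real.norm_eq_abs, sq_abs]
        exact ENNReal.ofReal_le_ofReal (hpt p)
    _ = ENNReal.ofReal (c * ∫ x, f x * g (u x)) := by
        rw [← ofReal_integral_eq_lintegral_ofReal hint
          (Eventually.of_forall fun p => (sq_nonneg _).trans (hpt p)), integral_const_mul,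
          hweak _ hw]
    _ = _ := by
        rw [ENNReal.ofReal_mul hc, ofReal_integral_eq_lintegral_ofReal (hfint _ hw)
          (Eventually.of_forall fun x => mul_nonneg (hf0 x) (hgpos _ (hu0 x)))]
        congr 1
        refine lintegral_congr fun x => ?_
        rw [ENNReal.ofReal_mul (hf0 x)]

/-! ### Products in the Hardy–Littlewood–Sobolev inequality, truncated powers and iteration -/

section Regularity

variable {v : E → ℝ≥0∞} {Ω : Set E} {p q μ : ℝ}

/-- The Riesz-type potential of `h`. -/
def potential (μ : ℝ) (h : E → ℝ≥0∞) (x : E) : ℝ≥0∞ := ∫⁻ y, h y * riesz μ (x - y)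

@[fun_prop]
theorem measurable_potential {h : E → ℝ≥0∞} (hh : Measurable h) : Measurable (potential μ h) := by
  have : Measurable (Function.uncurry fun x y : E => h y * riesz μ (x - y)) := by
    simp only [Function.uncurry_def]; fun_prop
  exact this.lintegral_prod_right

theorem lintegral_rpow_lt_top_of_le (hΩ : volume Ω ≠ ⊤) (hΩm : MeasurableSet Ω)
    (hvΩ : ∀ x ∉ Ω, v x = 0) {l m : ℝ} (hl : 0 < l) (hlm : l ≤ m) (hm : ∫⁻ x, v x ^ m < ⊤) :
    ∫⁻ x, v x ^ l < ⊤ := by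
  have hle : ∀ x, v x ^ l ≤ Ω.indicator (fun _ => 1) x + v x ^ m := by
    intro x
    by_cases hx : x ∈ Ω
    · rw [indicator_of_mem hx]
      rcases le_total (v x) 1 with h | h
      · exact (ENNReal.rpow_le_one h hl.le).trans le_self_add
      · exact (ENNReal.rpow_le_rpow_of_exponent_le h hlm).trans le_add_self
    · rw [hvΩ x hx, ENNReal.zero_rpow_of_pos hl]
      exact zero_le
  refine (lintegral_mono hle).trans_lt ?_
  rw [lintegral_add_left (measurable_const.indicator hΩm)]
  refine ENNReal.add_lt_top.2 ⟨?_, hm⟩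
  rw [lintegral_indicator_const hΩm, one_mul]
  exact hΩ.lt_top

/-- The Hardy–Littlewood–Sobolev inequality for the products occurring in Choquard-type terms. -/
theorem hls_product [Nontrivial E] (hμ : μ < finrank ℝ E) (hp : 1 < p)
    (hpq : 2 * p / q + μ / finrank ℝ E = 2) {θ₁ θ₂ : ℝ} (hθ₁ : 0 ≤ θ₁) (hθ₂ : 0 ≤ θ₂)
    (hθ : θ₁ + θ₂ = 2) (h₁ : p - 1 + θ₁ < q) (h₂ : p - 1 + θ₂ < q) :
    ∃ C : ℝ≥0, ∀ h k₁ k₂ : E → ℝ≥0∞, Measurable h → Measurable k₁ → Measurable k₂ →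
      ∫⁻ x, ∫⁻ y, h x ^ (p - 1) * k₁ x ^ θ₁ * (h y ^ (p - 1) * k₂ y ^ θ₂) * riesz μ (x - y) ≤
        C * (∫⁻ x, h x ^ q) ^ (2 * (p - 1) / q) * (∫⁻ x, k₁ x ^ q) ^ (θ₁ / q) *
          (∫⁻ x, k₂ x ^ q) ^ (θ₂ / q) := by
  have hp1 : 0 < p - 1 := by linarith
  have hq : 0 < q := by linarith
  have e₁ : 0 < p - 1 + θ₁ := by linarith
  have e₂ : 0 < p - 1 + θ₂ := by linarith
  -- With these exponents 1/a + 1/b = (2(p-1) + θ₁ + θ₂)/q = 2p/q, so the HLS relation is the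
  -- criticality assumption. The conditions a, b > 1 are `h₁` and `h₂`. Hölder in `hol` then
  -- separates h from k₁ and k₂.
  obtain ⟨C, hC⟩ := hls (E := E) (a := q / (p - 1 + θ₁)) (b := q / (p - 1 + θ₂)) (μ := μ)
    ((one_lt_div e₁).2 h₁) ((one_lt_div e₂).2 h₂) hμ (by
      rw [one_div_div, one_div_div, ← add_div, ← hpq]
      congr 2
      linarith)
  refine ⟨C, fun h k₁ k₂ hh hk₁ hk₂ => ?_⟩
  have hol : ∀ (k : E → ℝ≥0∞) (θ : ℝ), Measurable k → 0 ≤ θ → 0 < p - 1 + θ →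
      (∫⁻ x, (h x ^ (p - 1) * k x ^ θ) ^ (q / (p - 1 + θ))) ^ (1 / (q / (p - 1 + θ))) ≤
        (∫⁻ x, h x ^ q) ^ ((p - 1) / q) * (∫⁻ x, k x ^ q) ^ (θ / q) := by
    intro k θ hk hθ e
    have h3 := ENNReal.lintegral_mul_norm_pow_le (μ := (volume : Measure E))
      (hh.pow_const q).aemeasurable (hk.pow_const q).aemeasurable
      (p := (p - 1) / (p - 1 + θ)) (q := θ / (p - 1 + θ)) (by positivity) (by positivity)
      (by rw [← add_div, div_self e.ne'])
    have h4 := ENNReal.rpow_le_rpow h3 (z := (p - 1 + θ) / q) (by positivity)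
    rw [ENNReal.mul_rpow_of_nonneg _ _ (by positivity), ← ENNReal.rpow_mul, ← ENNReal.rpow_mul,
      div_mul_div_cancel₀ e.ne', div_mul_div_cancel₀ e.ne'] at h4
    rw [one_div_div]
    refine le_trans (le_of_eq ?_) h4
    congr 1
    refine lintegral_congr fun x => ?_
    rw [ENNReal.mul_rpow_of_nonneg _ _ (by positivity), ← ENNReal.rpow_mul, ← ENNReal.rpow_mul,
      ← ENNReal.rpow_mul, ← ENNReal.rpow_mul]
    congr 2 <;> field_simp
  refine (hC _ _ ((hh.pow_const _).mul (hk₁.pow_const _))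
    ((hh.pow_const _).mul (hk₂.pow_const _))).trans ?_
  have h5 : (∫⁻ x, h x ^ q) ^ (2 * (p - 1) / q) =
      (∫⁻ x, h x ^ q) ^ ((p - 1) / q) * (∫⁻ x, h x ^ q) ^ ((p - 1) / q) := by
    rw [← ENNReal.rpow_add_of_nonneg _ _ (by positivity) (by positivity)]
    congr 1
    ring
  calc _ ≤ (C : ℝ≥0∞) * ((∫⁻ x, h x ^ q) ^ ((p - 1) / q) * (∫⁻ x, k₁ x ^ q) ^ (θ₁ / q)) *
        ((∫⁻ x, h x ^ q) ^ ((p - 1) / q) * (∫⁻ x, k₂ x ^ q) ^ (θ₂ / q)) := by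
        gcongr
        · exact hol k₁ θ₁ hk₁ hθ₁ e₁
        · exact hol k₂ θ₂ hk₂ hθ₂ e₂
    _ = _ := by rw [h5]; ring

/-- The truncated power `t * min t T ^ γ`. -/
def truncPow (T : ℝ≥0∞) (γ : ℝ) (t : ℝ≥0∞) : ℝ≥0∞ := t * min t T ^ γ

@[fun_prop]
theorem measurable_truncPow (T : ℝ≥0∞) (γ : ℝ) : Measurable (truncPow T γ) := by
  unfold truncPow
  fun_prop

theorem truncPow_le {γ : ℝ} (hγ : 0 ≤ γ) (T t : ℝ≥0∞) : truncPow T γ t ≤ t ^ (1 + γ) := by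
  rw [ENNReal.rpow_add_of_nonneg _ _ zero_le_one hγ, ENNReal.rpow_one]
  exact mul_le_mul_right (ENNReal.rpow_le_rpow (min_le_left _ _) hγ) _

theorem truncPow_le_mul {γ : ℝ} (hγ : 0 ≤ γ) (T t : ℝ≥0∞) : truncPow T γ t ≤ T ^ γ * t := by
  rw [mul_comm]
  exact mul_le_mul_right (ENNReal.rpow_le_rpow (min_le_right _ _) hγ) _

/-- Redistribution of powers between two points. -/
theorem mul_truncPow_le {β : ℝ} (hβ : 1 ≤ β) (T a b : ℝ≥0∞) :
    b * truncPow T (2 * β - 2) a ≤ truncPow T (β - 1) a * truncPow T (β - 1) b +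
      truncPow T (β - 1) a ^ (2 - 1 / β) * truncPow T (β - 1) b ^ (1 / β) := by
  have hβ0 : 0 < β := by linarith
  have hγ : 0 ≤ β - 1 := by linarith
  have hsq : ∀ t : ℝ≥0∞, t ^ (2 * β - 2) = t ^ (β - 1) * t ^ (β - 1) := by
    intro t
    rw [← ENNReal.rpow_add_of_nonneg _ _ hγ hγ]
    ring_nf
  have hcase : min a T ≤ min b T →
      b * truncPow T (2 * β - 2) a ≤ truncPow T (β - 1) a * truncPow T (β - 1) b := by
    intro h
    rw [truncPow, hsq, truncPow, truncPow]
    calc _ = a * min a T ^ (β - 1) * (b * min a T ^ (β - 1)) := by ring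
      _ ≤ _ := by gcongr
  rcases le_total a b with hab | hba
  · exact (hcase (min_le_min_right _ hab)).trans le_self_add
  rcases le_total T b with hT | hT
  · refine (hcase ?_).trans le_self_add
    rw [min_eq_right hT]
    exact min_le_right _ _
  refine le_trans ?_ le_add_self
  -- In the remaining case b ≤ a and b ≤ T, the truncated power of b is b^β, so b itself is its
  -- 1/β-th power. The excess power of `a` is then shifted onto its own factor, which is why the
  -- exponents 2 - 1/β and 1/β appear.
  have hb : truncPow T (β - 1) b ^ (1 / β) = b := by
    rw [truncPow, min_eq_left hT]
    nth_rw 1 [← ENNReal.rpow_one b]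
    rw [← ENNReal.rpow_add_of_nonneg _ _ zero_le_one hγ, ← ENNReal.rpow_mul]
    rw [add_sub_cancel, mul_one_div_cancel hβ0.ne', ENNReal.rpow_one]
  have hθ : 0 ≤ 1 - 1 / β := by
    rw [sub_nonneg, div_le_one hβ0]
    exact hβ
  have ha : truncPow T (2 * β - 2) a ≤ truncPow T (β - 1) a ^ (2 - 1 / β) := by
    rw [show 2 - 1 / β = 1 + (1 - 1 / β) by ring,
      ENNReal.rpow_add_of_nonneg _ _ zero_le_one hθ, ENNReal.rpow_one]
    have h1 : min a T ^ (β - 1) ≤ truncPow T (β - 1) a ^ (1 - 1 / β) := by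
      have h2 : min a T ^ β ≤ truncPow T (β - 1) a := by
        rw [truncPow, show β = 1 + (β - 1) by ring, ENNReal.rpow_add_of_nonneg _ _ zero_le_one hγ,
          ENNReal.rpow_one, add_sub_cancel_left]
        gcongr
        exact min_le_left _ _
      calc min a T ^ (β - 1) = (min a T ^ β) ^ (1 - 1 / β) := by
            rw [← ENNReal.rpow_mul]
            congr 1
            field_simp
        _ ≤ _ := ENNReal.rpow_le_rpow h2 hθ
    calc truncPow T (2 * β - 2) a = truncPow T (β - 1) a * min a T ^ (β - 1) := by
          rw [truncPow, truncPow, hsq]; ring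
      _ ≤ _ := by gcongr
  rw [hb, mul_comm]
  gcongr

/-- Uniform bounds on truncated powers give integrability of the full power. -/
theorem lintegral_rpow_lt_top_of_truncPow (hv : Measurable v) (hq : 0 < q)
    {β : ℝ} (hβ : 1 ≤ β) {B : ℝ≥0∞} (hB : B ≠ ⊤)
    (h : ∀ k : ℕ, 1 ≤ k → (∫⁻ x, truncPow k (β - 1) (v x) ^ q) ^ (2 / q) ≤ B) :
    ∫⁻ x, v x ^ (q * β) < ⊤ := by
  have hγ : 0 ≤ β - 1 := by linarith
  have hpow : ∀ t : ℝ≥0∞, t ^ (q * β) = (t * t ^ (β - 1)) ^ q := by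
    intro t
    nth_rw 2 [← ENNReal.rpow_one t]
    rw [← ENNReal.rpow_add_of_nonneg _ _ zero_le_one hγ, ← ENNReal.rpow_mul]
    congr 1
    ring
  have hlim : Tendsto (fun k : ℕ => (∫⁻ x, truncPow k (β - 1) (v x) ^ q) ^ (2 / q)) atTop
      (𝓝 ((∫⁻ x, v x ^ (q * β)) ^ (2 / q))) := by
    refine (ENNReal.continuous_rpow_const.tendsto _).comp ?_
    refine lintegral_tendsto_of_tendsto_of_monotone (fun k => ?_) ?_ ?_
    · exact (((measurable_truncPow _ _).comp hv).pow_const q).aemeasurable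
    · refine Eventually.of_forall fun x k l hkl => ?_
      refine ENNReal.rpow_le_rpow ?_ hq.le
      have : (k : ℝ≥0∞) ≤ l := by exact_mod_cast hkl
      exact mul_le_mul_right (ENNReal.rpow_le_rpow (min_le_min_left _ this) hγ) _
    · refine Eventually.of_forall fun x => ?_
      rw [hpow]
      refine (ENNReal.continuous_rpow_const.tendsto _).comp ?_
      rcases eq_or_ne (v x) ⊤ with hx | hx
      · rw [hx]
        refine tendsto_const_nhds.congr' ?_
        -- Where v = ∞ the truncated power is ∞ · k^(β-1); k ≥ 1 keeps the second factor from being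
        -- zero.
        filter_upwards [eventually_ge_atTop 1] with k hk
        have hk0 : (k : ℝ≥0∞) ^ (β - 1) ≠ 0 := by
          have : (k : ℝ≥0∞) ≠ 0 := by exact_mod_cast (by omega : k ≠ 0)
          simp [this]
        rw [truncPow, min_eq_right le_top, ENNReal.top_mul hk0, ENNReal.top_mul]
        rcases hγ.eq_or_lt with h0 | h0
        · simp [← h0]
        · rw [ENNReal.top_rpow_of_pos h0]
          exact ENNReal.top_ne_zero
      · obtain ⟨N, hN⟩ := ENNReal.exists_nat_gt hx
        refine tendsto_const_nhds.congr' ?_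
        filter_upwards [eventually_ge_atTop N] with k hk
        have : v x ≤ k := hN.le.trans (by exact_mod_cast hk)
        rw [truncPow, min_eq_left this]
  have hle : (∫⁻ x, v x ^ (q * β)) ^ (2 / q) ≤ B :=
    le_of_tendsto hlim ((eventually_ge_atTop 1).mono h)
  by_contra htop
  rw [not_lt, top_le_iff] at htop
  rw [htop, ENNReal.top_rpow_of_pos (by positivity), top_le_iff] at hle
  exact hB hle

/-- Bootstrapping integrability in finitely many steps up to a prescribed power. -/
theorem lintegral_rpow_lt_top_of_step {P βf : ℝ} (hP : 2 ≤ P) (hPq : P < q) (hβf : 1 ≤ βf)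
    (hvq : ∫⁻ x, v x ^ q < ⊤)
    (step : ∀ β m : ℝ, 1 ≤ β → β ≤ βf → q ≤ m → P + 2 * β - 2 ≤ m → ∫⁻ x, v x ^ m < ⊤ →
      ∫⁻ x, v x ^ (q * β) < ⊤) :
    ∫⁻ x, v x ^ (q * βf) < ⊤ := by
  -- The increment of β per step. From exponent qβ₀ one may go to β₀ + δ, because P + 2(β₀ + δ) - 2
  -- = q + 2β₀ - 2 ≤ qβ₀ amounts to (q - 2)(β₀ - 1) ≥ 0. As δ is fixed, finitely many steps suffice.
  set δ := (q - P) / 2 with hδ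
  have hδ0 : 0 < δ := by rw [hδ]; linarith
  have main : ∀ j : ℕ, ∫⁻ x, v x ^ (q * min βf (1 + j * δ)) < ⊤ := by
    intro j
    induction j with
    | zero => simpa [min_eq_right hβf] using hvq
    | succ j ih =>
      have hj : 0 ≤ (j : ℝ) * δ := by positivity
      set β₀ := min βf (1 + j * δ) with hβ₀
      have hβ₀1 : 1 ≤ β₀ := le_min hβf (by linarith)
      refine step _ (q * β₀) (le_min hβf ?_) (min_le_left _ _) ?_ ?_ ih
      · push_cast
        nlinarith
      · nlinarith
      · have h1 : min βf (1 + ((j + 1 : ℕ) : ℝ) * δ) ≤ β₀ + δ := by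
          rw [hβ₀, ← min_add_add_right]
          refine min_le_min (by linarith) (le_of_eq ?_)
          push_cast
          ring
        nlinarith [mul_nonneg (by linarith : (0 : ℝ) ≤ q - 2) (by linarith : 0 ≤ β₀ - 1)]
  obtain ⟨j, hj⟩ := exists_nat_gt ((βf - 1) / δ)
  have := main j
  rwa [min_eq_left] at this
  rw [div_lt_iff₀ hδ0] at hj
  linarith

end Regularity

/-! ### Absorbing the critical interaction -/

section Bootstrap

variable {v : E → ℝ≥0∞} {Ω : Set E} {p q μ : ℝ}

/-- The right-hand side of the Choquard equation. -/
def forcing (μ p : ℝ) (lam : ℝ≥0) (v : E → ℝ≥0∞) (x : E) : ℝ≥0∞ :=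
  potential μ (fun y => v y ^ p) x * v x ^ (p - 1) + lam * v x

@[fun_prop]
theorem measurable_forcing {lam : ℝ≥0} (hv : Measurable v) : Measurable (forcing μ p lam v) := by
  unfold forcing
  fun_prop

theorem lintegral_forcing_mul {lam : ℝ≥0} (hv : Measurable v) {w : E → ℝ≥0∞} (hw : Measurable w) :
    ∫⁻ x, forcing μ p lam v x * w x =
      (∫⁻ x, ∫⁻ y, v y ^ p * (v x ^ (p - 1) * w x) * riesz μ (x - y)) +
        lam * ∫⁻ x, v x * w x := by
  simp_rw [forcing, add_mul]
  rw [lintegral_add_left (by fun_prop)]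
  congr 1
  · refine lintegral_congr fun x => ?_
    rw [potential, mul_assoc, ← lintegral_mul_const _ (by fun_prop)]
    refine lintegral_congr fun y => ?_
    ring
  · rw [← lintegral_const_mul _ (by fun_prop)]
    refine lintegral_congr fun x => ?_
    ring

/-- The Riesz kernel cut off outside the ball of radius `D`. -/
def localRiesz (D μ : ℝ) : E → ℝ≥0∞ := (ball (0 : E) D).indicator (riesz μ)

@[fun_prop]
theorem measurable_localRiesz (D μ : ℝ) : Measurable (localRiesz D μ : E → ℝ≥0∞) :=
  (measurable_riesz μ).indicator measurableSet_ball

theorem lintegral_localRiesz_lt_top [Nontrivial E] (D : ℝ) (hμ : μ < finrank ℝ E) :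
    ∫⁻ z : E, localRiesz D μ z < ⊤ := by
  rw [localRiesz, lintegral_indicator measurableSet_ball]
  exact lintegral_norm_rpow_ball_lt_top hμ D

theorem riesz_eq_localRiesz {D : ℝ} {z : E} (hz : z ∈ ball (0 : E) D) :
    riesz μ z = localRiesz D μ z := by
  rw [localRiesz, indicator_of_mem hz]

/-- Pointwise splitting of the Choquard interaction at the level `M`. -/
theorem interaction_le {D : ℝ} (hD : ∀ x ∈ Ω, ∀ y ∈ Ω, x - y ∈ ball (0 : E) D)
    (hvΩ : ∀ x ∉ Ω, v x = 0) (hp : 1 < p) {β : ℝ} (hβ : 1 ≤ β) (T M : ℝ≥0∞) (x y : E) :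
    v y ^ p * (v x ^ (p - 1) * truncPow T (2 * β - 2) (v x)) * riesz μ (x - y) ≤
      M ^ p * v x ^ (p + 2 * β - 2) * localRiesz D μ (x - y) +
      M ^ (p + 2 * β - 2) * v y ^ p * localRiesz D μ (x - y) +
      {z | M < v z}.indicator v x ^ (p - 1) * truncPow T (β - 1) (v x) ^ (1 : ℝ) *
        ({z | M < v z}.indicator v y ^ (p - 1) * truncPow T (β - 1) (v y) ^ (1 : ℝ)) *
        riesz μ (x - y) +
      {z | M < v z}.indicator v x ^ (p - 1) * truncPow T (β - 1) (v x) ^ (2 - 1 / β) *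
        ({z | M < v z}.indicator v y ^ (p - 1) * truncPow T (β - 1) (v y) ^ (1 / β)) *
        riesz μ (x - y) := by
  have hp0 : 0 < p := by linarith
  have hγ : 0 ≤ 2 * β - 2 := by linarith
  by_cases hy : y ∈ Ω
  swap
  · rw [hvΩ y hy, ENNReal.zero_rpow_of_pos hp0]
    simp
  by_cases hx : x ∈ Ω
  swap
  · rw [hvΩ x hx]
    simp [truncPow]
  have hpow : v x ^ (p - 1) * truncPow T (2 * β - 2) (v x) ≤ v x ^ (p + 2 * β - 2) := by
    rw [show p + 2 * β - 2 = (p - 1) + (1 + (2 * β - 2)) by ring,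
      ENNReal.rpow_add_of_nonneg _ _ (by linarith) (by linarith)]
    gcongr
    exact truncPow_le hγ _ _
  rw [riesz_eq_localRiesz (hD x hx y hy)]
  -- If either value is at most M, that factor is bounded by a power of M and the kernel is
  -- integrable on the bounded set of differences: these are the first two terms. If both exceed M,
  -- the powers are redistributed by `mul_truncPow_le`, giving the last two.
  by_cases hyM : v y ≤ M
  · refine le_trans ?_ (le_self_add.trans (le_self_add.trans le_self_add))
    gcongr
  by_cases hxM : v x ≤ M
  · refine le_trans ?_ ((le_add_self (a := M ^ (p + 2 * β - 2) * v y ^ p *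
      localRiesz D μ (x - y))).trans (le_self_add.trans le_self_add))
    rw [mul_comm (v y ^ p)]
    gcongr
    exact hpow.trans (ENNReal.rpow_le_rpow hxM (by linarith))
  · rw [indicator_of_mem (show y ∈ {z | M < v z} from not_le.1 hyM),
      indicator_of_mem (show x ∈ {z | M < v z} from not_le.1 hxM), add_assoc]
    refine le_trans ?_ le_add_self
    rw [← add_mul, ENNReal.rpow_one, ENNReal.rpow_one]
    gcongr
    have e : v y ^ p = v y ^ (p - 1) * v y := by
      nth_rw 3 [← ENNReal.rpow_one (v y)]
      rw [← ENNReal.rpow_add_of_nonneg _ _ (by linarith) zero_le_one, sub_add_cancel]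
    calc _ = v x ^ (p - 1) * v y ^ (p - 1) * (v y * truncPow T (2 * β - 2) (v x)) := by
          rw [e]; ring
      _ ≤ v x ^ (p - 1) * v y ^ (p - 1) *
          (truncPow T (β - 1) (v x) * truncPow T (β - 1) (v y) +
          truncPow T (β - 1) (v x) ^ (2 - 1 / β) * truncPow T (β - 1) (v y) ^ (1 / β)) := by
          gcongr
          exact mul_truncPow_le hβ T (v x) (v y)
      _ = _ := by ring

/-- Supplies the smallness for the absorption: v is finite everywhere, so the tail over {v > k}
vanishes pointwise for large k and is dominated by v^q. -/
theorem tendsto_lintegral_indicator_lt (hv : Measurable v) (hvt : ∀ x, v x ≠ ⊤) (hq : 0 < q)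
    (hvq : ∫⁻ x, v x ^ q < ⊤) :
    Tendsto (fun k : ℕ => ∫⁻ x, {z | (k : ℝ≥0∞) < v z}.indicator v x ^ q) atTop (𝓝 0) := by
  have h := tendsto_lintegral_of_dominated_convergence (μ := (volume : Measure E))
    (F := fun (k : ℕ) x => {z | (k : ℝ≥0∞) < v z}.indicator v x ^ q) (f := fun _ => 0)
    (fun x => v x ^ q)
    (fun k => (hv.indicator (measurableSet_lt measurable_const hv)).pow_const q)
    (fun k => Eventually.of_forall fun x =>
      ENNReal.rpow_le_rpow (indicator_le_self' (fun _ _ => zero_le) x) hq.le)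
    hvq.ne (Eventually.of_forall fun x => by
      obtain ⟨N, hN⟩ := ENNReal.exists_nat_gt (hvt x)
      refine tendsto_const_nhds.congr' ?_
      filter_upwards [eventually_ge_atTop N] with k hk
      have : v x ≤ k := hN.le.trans (by exact_mod_cast hk)
      rw [indicator_of_notMem (by simpa using this), ENNReal.zero_rpow_of_pos hq])
  simpa using h

theorem lintegral_lintegral_mul_localRiesz {D : ℝ} {g : E → ℝ≥0∞} (hg : Measurable g)
    (c : ℝ≥0∞) (hc : c ≠ ⊤) :
    ∫⁻ x, ∫⁻ y, c * g x * localRiesz D μ (x - y) =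
      c * (∫⁻ x, g x) * ∫⁻ z : E, localRiesz D μ z := by
  have : ∀ x, ∫⁻ y, c * g x * localRiesz D μ (x - y) =
      c * g x * ∫⁻ z : E, localRiesz D μ z := fun x => by
    rw [lintegral_const_mul _ (by fun_prop),
      lintegral_sub_left_eq_self (fun z => localRiesz D μ z) x]
  simp_rw [this]
  rw [lintegral_mul_const _ (by fun_prop), lintegral_const_mul' _ _ hc]

theorem lintegral_lintegral_mul_localRiesz' {D : ℝ} {g : E → ℝ≥0∞} (hg : Measurable g)
    (c : ℝ≥0∞) (hc : c ≠ ⊤) :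
    ∫⁻ x, ∫⁻ y, c * g y * localRiesz D μ (x - y) =
      c * (∫⁻ x, g x) * ∫⁻ z : E, localRiesz D μ z := by
  have hm : Measurable (Function.uncurry fun x y : E => c * g y * localRiesz D μ (x - y)) := by
    simp only [Function.uncurry_def]; fun_prop
  rw [lintegral_lintegral_swap hm.aemeasurable]
  have : ∀ y, ∫⁻ x, c * g y * localRiesz D μ (x - y) =
      c * g y * ∫⁻ z : E, localRiesz D μ z := fun y => by
    rw [lintegral_const_mul _ (by fun_prop),
      lintegral_sub_right_eq_self (fun z => localRiesz D μ z) y]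
  simp_rw [this]
  rw [lintegral_mul_const _ (by fun_prop), lintegral_const_mul' _ _ hc]

theorem lintegral_mul_truncPow_le (v : E → ℝ≥0∞) {β : ℝ} (hβ : 1 ≤ β) (T : ℝ≥0∞) :
    ∫⁻ x, v x * truncPow T (2 * β - 2) (v x) ≤ ∫⁻ x, v x ^ (2 * β) := by
  refine lintegral_mono fun x => ?_
  have e : v x ^ (2 * β) = v x * v x ^ (1 + (2 * β - 2)) := by
    nth_rw 2 [← ENNReal.rpow_one (v x)]
    rw [← ENNReal.rpow_add_of_nonneg _ _ zero_le_one (by linarith)]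
    ring_nf
  rw [e]
  exact mul_le_mul_right (truncPow_le (by linarith) T (v x)) (v x)

/-- Gain of integrability at the critical level: the concentrated part of the interaction is
absorbed by the energy. -/
theorem lintegral_rpow_lt_top_of_energy [Nontrivial E] (hμ : μ < finrank ℝ E) (hp : 1 < p)
    (hpq' : p < q) (hpq : 2 * p / q + μ / finrank ℝ E = 2) (hΩ : volume Ω ≠ ⊤)
    (hΩm : MeasurableSet Ω) {D : ℝ} (hD : ∀ x ∈ Ω, ∀ y ∈ Ω, x - y ∈ ball (0 : E) D)
    (hv : Measurable v) (hvt : ∀ x, v x ≠ ⊤) (hvΩ : ∀ x ∉ Ω, v x = 0) (hvq : ∫⁻ x, v x ^ q < ⊤)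
    {lam : ℝ≥0} {β : ℝ} (hβ : 1 ≤ β) (hβq : p + 1 - q < 1 / β) {m : ℝ} (hm₁ : q ≤ m)
    (hm₂ : p + 2 * β - 2 ≤ m) (hm₃ : 2 * β ≤ m) (hvm : ∫⁻ x, v x ^ m < ⊤)
    {C : ℝ≥0} (hC : ∀ k : ℕ, 1 ≤ k → (∫⁻ x, truncPow k (β - 1) (v x) ^ q) ^ (2 / q) ≤
      C * ∫⁻ x, forcing μ p lam v x * truncPow k (2 * β - 2) (v x)) :
    ∫⁻ x, v x ^ (q * β) < ⊤ := by
  have hq : 0 < q := by linarith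
  have hβ0 : 0 < β := by linarith
  have hβ1 : 1 / β ≤ 1 := (div_le_one hβ0).2 hβ
  have hβ2 : 0 < 1 / β := by positivity
  -- One constant for each of the two products left by `interaction_le`. The second has θ₁ = 2 -
  -- 1/β, and its condition p + 1 - 1/β < q is `hβq`, the only restriction on how large β may be.
  obtain ⟨C₁, hC₁⟩ := hls_product (E := E) (θ₁ := 1) (θ₂ := 1) hμ hp hpq zero_le_one zero_le_one
    (by norm_num) (by linarith) (by linarith)
  obtain ⟨C₂, hC₂⟩ := hls_product (E := E) (θ₁ := 2 - 1 / β) (θ₂ := 1 / β) hμ hp hpq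
    (by linarith) hβ2.le (by ring) (by linarith) (by linarith)
  have hη : Tendsto (fun k : ℕ => (C : ℝ≥0∞) * (C₁ + C₂) *
      (∫⁻ x, {z | (k : ℝ≥0∞) < v z}.indicator v x ^ q) ^ (2 * (p - 1) / q)) atTop (𝓝 0) := by
    have hpos : 0 < 2 * (p - 1) / q := by
      have : 0 < p - 1 := by linarith
      positivity
    have h1 := (ENNReal.continuous_rpow_const (y := 2 * (p - 1) / q)).tendsto 0 |>.comp
      (tendsto_lintegral_indicator_lt hv hvt hq hvq)
    rw [ENNReal.zero_rpow_of_pos hpos] at h1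
    have h2 := ENNReal.Tendsto.const_mul (a := (C : ℝ≥0∞) * (C₁ + C₂)) h1
      (Or.inr (by finiteness))
    simpa using h2
  -- The level M makes the coefficient of the concentrated part less than 1/2. It does not depend on
  -- the truncation k, so neither does the remainder A.
  obtain ⟨M, hM⟩ := (hη.eventually (gt_mem_nhds (by simp : (0 : ℝ≥0∞) < 2⁻¹))).exists
  set h : E → ℝ≥0∞ := {z | (M : ℝ≥0∞) < v z}.indicator v with hh
  have hhm : Measurable h := hv.indicator (measurableSet_lt measurable_const hv)
  set η := (∫⁻ x, h x ^ q) ^ (2 * (p - 1) / q) with hη_def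
  set κ := ∫⁻ z : E, localRiesz D μ z with hκ
  have hκt : κ < ⊤ := lintegral_localRiesz_lt_top D hμ
  have hMt : ∀ r : ℝ, 0 ≤ r → (M : ℝ≥0∞) ^ r ≠ ⊤ := fun r hr =>
    ENNReal.rpow_ne_top_of_nonneg hr (ENNReal.natCast_ne_top M)
  set A : ℝ≥0∞ := (M : ℝ≥0∞) ^ p * (∫⁻ x, v x ^ (p + 2 * β - 2)) * κ +
    (M : ℝ≥0∞) ^ (p + 2 * β - 2) * (∫⁻ x, v x ^ p) * κ + lam * ∫⁻ x, v x ^ (2 * β) with hA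
  have hlow : ∀ l : ℝ, 0 < l → l ≤ m → ∫⁻ x, v x ^ l < ⊤ := fun l hl hlm =>
    lintegral_rpow_lt_top_of_le hΩ hΩm hvΩ hl hlm hvm
  have hAt : A ≠ ⊤ := by
    refine ENNReal.add_ne_top.2 ⟨ENNReal.add_ne_top.2 ⟨?_, ?_⟩, ?_⟩
    · exact ENNReal.mul_ne_top (ENNReal.mul_ne_top (hMt _ (by linarith))
        (hlow _ (by linarith) hm₂).ne) hκt.ne
    · exact ENNReal.mul_ne_top (ENNReal.mul_ne_top (hMt _ (by linarith))
        (hlow _ (by linarith) (by linarith)).ne) hκt.ne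
    · exact ENNReal.mul_ne_top ENNReal.coe_ne_top (hlow _ (by linarith) hm₃).ne
  refine lintegral_rpow_lt_top_of_truncPow hv hq hβ (B := 2 * (C * A)) (by finiteness)
    fun k hk => ?_
  set W : E → ℝ≥0∞ := fun x => truncPow k (β - 1) (v x) with hW
  have hWm : Measurable W := (measurable_truncPow _ _).comp hv
  set I := (∫⁻ x, W x ^ q) ^ (2 / q) with hI
  -- Absorbing I/2 into the left side needs I finite beforehand. The truncated power is at most
  -- k^(β-1) v, so v ∈ L^q is enough; the bound obtained here depends on k but is not used further.
  have hIt : I ≠ ⊤ := by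
    refine ENNReal.rpow_ne_top_of_nonneg (by positivity) (ne_of_lt ?_)
    calc ∫⁻ x, W x ^ q ≤ ∫⁻ x, ((k : ℝ≥0∞) ^ (β - 1)) ^ q * v x ^ q := by
          refine lintegral_mono fun x => ?_
          rw [← ENNReal.mul_rpow_of_nonneg _ _ hq.le]
          exact ENNReal.rpow_le_rpow (truncPow_le_mul (by linarith) _ _) hq.le
      _ < ⊤ := by
          rw [lintegral_const_mul _ (hv.pow_const q)]
          exact ENNReal.mul_lt_top (ENNReal.rpow_lt_top_of_nonneg hq.le
            (ENNReal.rpow_ne_top_of_nonneg (by linarith) (ENNReal.natCast_ne_top k))) hvq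
  have hbound : ∫⁻ x, forcing μ p lam v x * truncPow k (2 * β - 2) (v x) ≤
      A + (C₁ + C₂) * η * I := by
    rw [lintegral_forcing_mul hv (w := fun x => truncPow k (2 * β - 2) (v x))
      ((measurable_truncPow _ _).comp hv)]
    have m1 : Measurable (Function.uncurry fun x y : E =>
        (M : ℝ≥0∞) ^ p * v x ^ (p + 2 * β - 2) * localRiesz D μ (x - y)) := by
      simp only [Function.uncurry_def]; fun_prop
    have m2 : Measurable (Function.uncurry fun x y : E =>
        (M : ℝ≥0∞) ^ (p + 2 * β - 2) * v y ^ p * localRiesz D μ (x - y)) := by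
      simp only [Function.uncurry_def]; fun_prop
    have m3 : Measurable (Function.uncurry fun x y : E =>
        h x ^ (p - 1) * W x ^ (1 : ℝ) * (h y ^ (p - 1) * W y ^ (1 : ℝ)) * riesz μ (x - y)) := by
      simp only [Function.uncurry_def]; fun_prop
    have m4 : Measurable (Function.uncurry fun x y : E =>
        h x ^ (p - 1) * W x ^ (2 - 1 / β) * (h y ^ (p - 1) * W y ^ (1 / β)) *
          riesz μ (x - y)) := by
      simp only [Function.uncurry_def]; fun_prop
    have hsplit : ∫⁻ x, ∫⁻ y, v y ^ p * (v x ^ (p - 1) * truncPow k (2 * β - 2) (v x)) *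
        riesz μ (x - y) ≤
        (∫⁻ x, ∫⁻ y, (M : ℝ≥0∞) ^ p * v x ^ (p + 2 * β - 2) * localRiesz D μ (x - y)) +
        (∫⁻ x, ∫⁻ y, (M : ℝ≥0∞) ^ (p + 2 * β - 2) * v y ^ p * localRiesz D μ (x - y)) +
        (∫⁻ x, ∫⁻ y, h x ^ (p - 1) * W x ^ (1 : ℝ) * (h y ^ (p - 1) * W y ^ (1 : ℝ)) *
          riesz μ (x - y)) +
        ∫⁻ x, ∫⁻ y, h x ^ (p - 1) * W x ^ (2 - 1 / β) * (h y ^ (p - 1) * W y ^ (1 / β)) *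
          riesz μ (x - y) := by
      rw [← lintegral_add_left m1.lintegral_prod_right,
        ← lintegral_add_right _ m3.lintegral_prod_right,
        ← lintegral_add_right _ m4.lintegral_prod_right]
      refine lintegral_mono fun x => ?_
      rw [← lintegral_add_left (m1.of_uncurry_left (x := x)),
        ← lintegral_add_right _ (m3.of_uncurry_left (x := x)),
        ← lintegral_add_right _ (m4.of_uncurry_left (x := x))]
      exact lintegral_mono fun y => interaction_le hD hvΩ hp hβ _ _ x y
    have hI1 : (∫⁻ x, W x ^ q) ^ (1 / q) * (∫⁻ x, W x ^ q) ^ (1 / q) = I := by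
      rw [← ENNReal.rpow_add_of_nonneg _ _ (by positivity) (by positivity), hI]
      congr 1
      ring
    have hI2 : (∫⁻ x, W x ^ q) ^ ((2 - 1 / β) / q) * (∫⁻ x, W x ^ q) ^ (1 / β / q) = I := by
      rw [← ENNReal.rpow_add_of_nonneg _ _ (div_nonneg (by linarith) hq.le) (by positivity), hI]
      congr 1
      ring
    have b1 := hC₁ h W W hhm hWm hWm
    have b2 := hC₂ h W W hhm hWm hWm
    rw [mul_assoc, hI1] at b1
    rw [mul_assoc, hI2] at b2
    rw [lintegral_lintegral_mul_localRiesz (hv.pow_const _) _ (hMt _ (by linarith)),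
      lintegral_lintegral_mul_localRiesz' (hv.pow_const _) _ (hMt _ (by linarith))] at hsplit
    have hlamle : (lam : ℝ≥0∞) * ∫⁻ x, v x * truncPow k (2 * β - 2) (v x) ≤
        lam * ∫⁻ x, v x ^ (2 * β) := mul_le_mul_right (lintegral_mul_truncPow_le v hβ _) _
    calc _ ≤ _ := add_le_add (hsplit.trans (add_le_add (add_le_add le_rfl b1) b2)) hlamle
      _ = _ := by rw [hA, hη_def]; ring
  have habs : I ≤ C * A + 2⁻¹ * I := by
    refine (hC k hk).trans ?_
    calc (C : ℝ≥0∞) * ∫⁻ x, forcing μ p lam v x * truncPow k (2 * β - 2) (v x)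
        ≤ C * (A + (C₁ + C₂) * η * I) := mul_le_mul_right hbound _
      _ = C * A + C * (C₁ + C₂) * η * I := by ring
      _ ≤ _ := by gcongr
  have hhalf : 2⁻¹ * I ≤ C * A := by
    have h2 : 2⁻¹ * I + 2⁻¹ * I = I := by rw [← add_mul, ENNReal.inv_two_add_inv_two, one_mul]
    have h3 : 2⁻¹ * I + 2⁻¹ * I ≤ C * A + 2⁻¹ * I := h2.le.trans habs
    exact (ENNReal.add_le_add_iff_right (ENNReal.mul_ne_top (by simp) hIt)).1 h3
  calc I = 2 * (2⁻¹ * I) := by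
        rw [← mul_assoc, ENNReal.mul_inv_cancel two_ne_zero ENNReal.ofNat_ne_top, one_mul]
    _ ≤ _ := mul_le_mul_right hhalf _

end Bootstrap

/-! ### Bounded potential, all Lebesgue exponents, and level sets -/

section Boundedness

variable {v : E → ℝ≥0∞} {Ω : Set E} {p q μ : ℝ}

/-- High integrability of `v` bounds its potential on `Ω`. -/
theorem exists_potential_le [Nontrivial E] {D : ℝ}
    (hD : ∀ x ∈ Ω, ∀ y ∈ Ω, x - y ∈ ball (0 : E) D) (hv : Measurable v) (hvΩ : ∀ x ∉ Ω, v x = 0)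
    (hp : 0 < p) {σ : ℝ} (hσ0 : 0 < σ) (hσ : σ < 1) (hσμ : μ < (1 - σ) * finrank ℝ E)
    (hvσ : ∫⁻ x, v x ^ (p / σ) < ⊤) :
    ∃ κ : ℝ≥0, ∀ x ∈ Ω, potential μ (fun y => v y ^ p) x ≤ κ := by
  have hσ' : 0 < 1 - σ := by linarith
  have hloc : ∫⁻ z : E, localRiesz D (μ / (1 - σ)) z < ⊤ :=
    lintegral_localRiesz_lt_top D (by rwa [div_lt_iff₀ hσ', mul_comm])
  have hfin : (∫⁻ x, v x ^ (p / σ)) ^ σ * (∫⁻ z : E, localRiesz D (μ / (1 - σ)) z) ^ (1 - σ) ≠ ⊤ :=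
    ENNReal.mul_ne_top (ENNReal.rpow_ne_top_of_nonneg hσ0.le hvσ.ne)
      (ENNReal.rpow_ne_top_of_nonneg hσ'.le hloc.ne)
  refine ⟨_, fun x hx => le_trans ?_ (ENNReal.coe_toNNReal hfin).ge⟩
  -- Hölder with weights σ and 1 - σ: v^p is controlled in L^(1/σ), and |x - y|^(-μ) to the power
  -- 1/(1-σ) is still locally integrable because μ/(1-σ) < d.
  have hol := ENNReal.lintegral_mul_norm_pow_le (μ := (volume : Measure E))
    (f := fun y => v y ^ (p / σ)) (g := fun y => localRiesz D (μ / (1 - σ)) (x - y))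
    (by fun_prop) (by fun_prop) hσ0.le hσ'.le (by ring)
  rw [lintegral_sub_left_eq_self (fun z => localRiesz D (μ / (1 - σ)) z) x] at hol
  refine le_trans (lintegral_mono fun y => ?_) hol
  rw [← ENNReal.rpow_mul, div_mul_cancel₀ _ hσ0.ne']
  by_cases hy : y ∈ Ω
  · refine mul_le_mul_right (le_of_eq ?_) _
    rw [localRiesz, indicator_of_mem (hD x hx y hy), riesz, riesz,
      ENNReal.ofReal_rpow_of_nonneg (by positivity) hσ'.le, ← Real.rpow_mul (norm_nonneg _)]
    congr 2
    field_simp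
  · simp [hvΩ y hy, hp]

theorem forcing_le_of_potential_le (hvΩ : ∀ x ∉ Ω, v x = 0) (hp : 1 < p) {lam κ : ℝ≥0}
    (hκ : ∀ x ∈ Ω, potential μ (fun y => v y ^ p) x ≤ κ) (x : E) :
    forcing μ p lam v x ≤ κ * v x ^ (p - 1) + lam * v x := by
  by_cases hx : x ∈ Ω
  · rw [forcing]
    gcongr
    exact hκ x hx
  · simp [forcing, hvΩ x hx, hp]

/-- Gain of integrability when the potential is bounded. -/
theorem lintegral_rpow_lt_top_of_potential_le (hp : 1 < p) (hq : 0 < q) (hΩ : volume Ω ≠ ⊤)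
    (hΩm : MeasurableSet Ω) (hv : Measurable v) (hvΩ : ∀ x ∉ Ω, v x = 0)
    {lam κ : ℝ≥0} (hκ : ∀ x ∈ Ω, potential μ (fun y => v y ^ p) x ≤ κ)
    {β : ℝ} (hβ : 1 ≤ β) {m : ℝ}
    (hm₂ : p + 2 * β - 2 ≤ m) (hm₃ : 2 * β ≤ m) (hvm : ∫⁻ x, v x ^ m < ⊤)
    {C : ℝ≥0} (hC : ∀ k : ℕ, 1 ≤ k → (∫⁻ x, truncPow k (β - 1) (v x) ^ q) ^ (2 / q) ≤
      C * ∫⁻ x, forcing μ p lam v x * truncPow k (2 * β - 2) (v x)) :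
    ∫⁻ x, v x ^ (q * β) < ⊤ := by
  have hlow : ∀ l : ℝ, 0 < l → l ≤ m → ∫⁻ x, v x ^ l < ⊤ := fun l hl hlm =>
    lintegral_rpow_lt_top_of_le hΩ hΩm hvΩ hl hlm hvm
  have h1 := hlow (p + 2 * β - 2) (by linarith) hm₂
  have h2 := hlow (2 * β) (by linarith) hm₃
  refine lintegral_rpow_lt_top_of_truncPow hv hq hβ
    (B := C * (κ * (∫⁻ x, v x ^ (p + 2 * β - 2)) + lam * ∫⁻ x, v x ^ (2 * β))) (by finiteness)
    fun k hk => (hC k hk).trans (mul_le_mul_right ?_ _)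
  calc ∫⁻ x, forcing μ p lam v x * truncPow k (2 * β - 2) (v x)
      ≤ ∫⁻ x, (κ * v x ^ (p + 2 * β - 2) + lam * v x ^ (2 * β)) := by
        refine lintegral_mono fun x => ?_
        refine (mul_le_mul' (forcing_le_of_potential_le hvΩ hp hκ x)
          (truncPow_le (by linarith) _ _)).trans (le_of_eq ?_)
        have e1 : v x ^ (p + 2 * β - 2) = v x ^ (p - 1) * v x ^ (1 + (2 * β - 2)) := by
          rw [← ENNReal.rpow_add_of_nonneg _ _ (by linarith) (by linarith)]
          ring_nf
        have e2 : v x ^ (2 * β) = v x * v x ^ (1 + (2 * β - 2)) := by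
          nth_rw 2 [← ENNReal.rpow_one (v x)]
          rw [← ENNReal.rpow_add_of_nonneg _ _ zero_le_one (by linarith)]
          ring_nf
        rw [e1, e2]
        ring
    _ = _ := by
        rw [lintegral_add_left (by fun_prop), lintegral_const_mul _ (by fun_prop),
          lintegral_const_mul _ (by fun_prop)]

/-- Stampacchia's lemma: superlinear decay of a nonincreasing function forces it to vanish. -/
theorem exists_eq_zero_of_stampacchia {φ : ℝ → ℝ} (hφ : ∀ k, 0 ≤ φ k) (hanti : Antitone φ)
    {C γ δ : ℝ} (hC : 0 ≤ C) (hγ : 0 < γ) (hδ : 1 < δ)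
    (h : ∀ k l, 0 ≤ k → k < l → φ l ≤ C * (l - k) ^ (-γ) * φ k ^ δ) : ∃ D, 0 ≤ D ∧ φ D = 0 := by
  rcases (hφ 0).eq_or_lt with h0 | h0
  · exact ⟨0, le_rfl, h0.symm⟩
  have hδ' : 0 < δ - 1 := by linarith
  -- Chosen so that r^δ = r · 2^(-γ): the gain from the exponent δ > 1 cancels the factor 2^γ lost
  -- each time the gap between levels is halved.
  set r : ℝ := 2 ^ (-γ / (δ - 1)) with hr
  have hr0 : 0 < r := by positivity
  have hr1 : r < 1 := Real.rpow_lt_one_of_one_lt_of_neg one_lt_two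
    (div_neg_of_neg_of_pos (by linarith) hδ')
  have hsplit : ∀ a : ℝ, 0 < a → a ^ δ = a * a ^ (δ - 1) := fun a ha => by
    nth_rw 2 [← Real.rpow_one a]
    rw [← Real.rpow_add ha, add_sub_cancel]
  have hrδ : r ^ δ = r * 2 ^ (-γ) := by
    rw [hsplit r hr0, hr, ← Real.rpow_mul (by norm_num) _ (δ - 1), div_mul_cancel₀ _ hδ'.ne']
  obtain ⟨D, hD0, hD⟩ : ∃ D : ℝ, 0 < D ∧ C * D ^ (-γ) * 2 ^ γ * φ 0 ^ (δ - 1) ≤ r := by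
    have hlim : Tendsto (fun D : ℝ => C * D ^ (-γ) * 2 ^ γ * φ 0 ^ (δ - 1)) atTop (𝓝 0) := by
      have := ((tendsto_rpow_neg_atTop hγ).const_mul C).mul_const (2 ^ γ) |>.mul_const
        (φ 0 ^ (δ - 1))
      simpa using this
    obtain ⟨D, hD1, hD2⟩ := ((hlim.eventually (gt_mem_nhds hr0)).and
      (eventually_gt_atTop (0 : ℝ))).exists
    exact ⟨D, hD2, hD1.le⟩
  refine ⟨D, hD0.le, ?_⟩
  -- Levels increasing to D, with φ(t j) decaying geometrically. The choice of D makes the constant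
  -- in each step at most r, and monotonicity bounds φ(D) by every φ(t j).
  set t : ℕ → ℝ := fun j => D * (1 - (2⁻¹ : ℝ) ^ j) with ht
  have main : ∀ j : ℕ, φ (t j) ≤ φ 0 * r ^ j := by
    intro j
    induction j with
    | zero => simp [ht]
    | succ j ih =>
      have hpj : 0 < (2⁻¹ : ℝ) ^ j := by positivity
      have hpj1 : (2⁻¹ : ℝ) ^ j ≤ 1 := pow_le_one₀ (by norm_num) (by norm_num)
      have hdiff : t (j + 1) - t j = D * 2⁻¹ * 2⁻¹ ^ j := by
        simp only [ht, pow_succ]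
        ring
      have ht0 : 0 ≤ t j := mul_nonneg hD0.le (by linarith)
      have hlt : t j < t (j + 1) := by
        have : 0 < D * 2⁻¹ * 2⁻¹ ^ j := by positivity
        linarith
      refine (h _ _ ht0 hlt).trans ?_
      have e0 : (2⁻¹ : ℝ) ^ (-γ) = 2 ^ γ := by
        rw [Real.inv_rpow (by norm_num), Real.rpow_neg (by norm_num), inv_inv]
      have e1 : (D * 2⁻¹ * 2⁻¹ ^ j) ^ (-γ) = D ^ (-γ) * 2 ^ γ * (2 ^ γ) ^ j := by
        rw [Real.mul_rpow (by positivity) hpj.le, Real.mul_rpow hD0.le (by norm_num), e0,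
          ← Real.rpow_natCast 2⁻¹, ← Real.rpow_mul (by norm_num), mul_comm (j : ℝ),
          Real.rpow_mul (by norm_num), e0, Real.rpow_natCast]
      have e2 : (φ 0 * r ^ j) ^ δ = φ 0 * φ 0 ^ (δ - 1) * (r ^ j * (2 ^ (-γ)) ^ j) := by
        rw [Real.mul_rpow h0.le (by positivity), ← Real.rpow_natCast r, ← Real.rpow_mul hr0.le,
          mul_comm (j : ℝ), Real.rpow_mul hr0.le, Real.rpow_natCast, hrδ, mul_pow,
          Real.rpow_natCast, hsplit _ h0]
      have e3 : ((2 : ℝ) ^ γ) ^ j * (2 ^ (-γ)) ^ j = 1 := by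
        rw [← mul_pow, ← Real.rpow_add (by norm_num), add_neg_cancel, Real.rpow_zero, one_pow]
      calc C * (t (j + 1) - t j) ^ (-γ) * φ (t j) ^ δ
          ≤ C * (t (j + 1) - t j) ^ (-γ) * (φ 0 * r ^ j) ^ δ := by
            have : 0 ≤ (t (j + 1) - t j) ^ (-γ) := Real.rpow_nonneg (by linarith) _
            gcongr
            exact hφ _
        _ = C * D ^ (-γ) * 2 ^ γ * φ 0 ^ (δ - 1) * (φ 0 * r ^ j) *
            (((2 : ℝ) ^ γ) ^ j * (2 ^ (-γ)) ^ j) := by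
            rw [hdiff, e1, e2]; ring
        _ ≤ r * (φ 0 * r ^ j) := by
            rw [e3, mul_one]
            gcongr
        _ = φ 0 * r ^ (j + 1) := by ring
  have hle : ∀ j, φ D ≤ φ 0 * r ^ j := fun j => (hanti (by
    have : 0 < (2⁻¹ : ℝ) ^ j := by positivity
    simp only [ht]
    nlinarith)).trans (main j)
  have hlim : Tendsto (fun j : ℕ => φ 0 * r ^ j) atTop (𝓝 0) := by
    simpa using (tendsto_pow_atTop_nhds_zero_of_lt_one hr0.le hr1).const_mul (φ 0)
  exact le_antisymm (ge_of_tendsto' hlim hle) (hφ D)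

/-- Level-set iteration: energy bounds with a forcing in all Lebesgue spaces give boundedness. -/
theorem exists_ae_le_of_levels (hq : 2 < q) (hΩ : volume Ω ≠ ⊤) (hv : Measurable v)
    (hvΩ : ∀ x ∉ Ω, v x = 0) {F : E → ℝ≥0∞} (hF : Measurable F)
    (hFm : ∀ m : ℝ, 1 ≤ m → ∫⁻ x, (F x * v x) ^ m < ⊤) {C : ℝ≥0}
    (hC : ∀ k : ℝ≥0, (∫⁻ x, (v x - k) ^ q) ^ (2 / q) ≤ C * ∫⁻ x, F x * (v x - k)) :
    ∃ M : ℝ≥0, ∀ᵐ x, v x ≤ M := by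
  have hq0 : 0 < q := by linarith
  -- Any τ in (0, 1 - 2/q) would do: Hölder puts Fv in L^(1/τ) and leaves |A k|^(1-τ), and 1 - τ >
  -- 2/q makes the exponent (1 - τ)q/2 in Stampacchia's lemma exceed 1.
  set τ : ℝ := (1 - 2 / q) / 2 with hτ
  have h2q : 2 / q < 1 := (div_lt_one hq0).2 hq
  have h2q0 : 0 < 2 / q := by positivity
  have hτ0 : 0 < τ := by rw [hτ]; linarith
  have hτ1 : τ < 1 - 2 / q := by rw [hτ]; linarith
  set J : ℝ≥0∞ := ∫⁻ x, (F x * v x) ^ (1 / τ) with hJ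
  have hJt : J < ⊤ := hFm _ (by rw [le_div_iff₀ hτ0]; linarith)
  set A : ℝ → Set E := fun k => {x | ENNReal.ofReal k < v x} with hA
  have hAm : ∀ k, MeasurableSet (A k) := fun k => measurableSet_lt measurable_const hv
  have hAt : ∀ k, volume (A k) ≠ ⊤ := fun k => by
    refine ((measure_mono fun x hx => ?_).trans_lt hΩ.lt_top).ne
    by_contra hxΩ
    have hx' : ENNReal.ofReal k < v x := hx
    rw [hvΩ x hxΩ] at hx'
    exact not_lt_zero hx'
  have hanti : Antitone A := fun k l hkl x hx => (ENNReal.ofReal_le_ofReal hkl).trans_lt hx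
  have step : ∀ k l : ℝ, 0 ≤ k → k < l →
      ENNReal.ofReal (l - k) ^ (2 : ℝ) * volume (A l) ^ (2 / q) ≤
        C * J ^ τ * volume (A k) ^ (1 - τ) := by
    intro k l hk hkl
    have hup : ∫⁻ x, F x * (v x - k.toNNReal) ≤ J ^ τ * volume (A k) ^ (1 - τ) := by
      have hol := ENNReal.lintegral_mul_norm_pow_le (μ := (volume : Measure E))
        (f := fun x => (F x * v x) ^ (1 / τ)) (g := (A k).indicator fun _ => 1)
        (by fun_prop) (measurable_const.indicator (hAm k)).aemeasurable hτ0.le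
        (by linarith : 0 ≤ 1 - τ) (by ring)
      rw [lintegral_indicator_const (hAm k), one_mul] at hol
      refine le_trans (lintegral_mono fun x => ?_) hol
      rw [← ENNReal.rpow_mul, one_div_mul_cancel hτ0.ne', ENNReal.rpow_one]
      by_cases hx : x ∈ A k
      · rw [indicator_of_mem hx, ENNReal.one_rpow, mul_one]
        gcongr
        exact tsub_le_self
      · have : v x ≤ ENNReal.ofReal k := not_lt.1 hx
        rw [show v x - k.toNNReal = 0 from tsub_eq_zero_of_le this, mul_zero]
        exact zero_le
    have hlow : ENNReal.ofReal (l - k) ^ q * volume (A l) ≤ ∫⁻ x, (v x - k.toNNReal) ^ q := by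
      rw [← setLIntegral_const]
      refine (setLIntegral_mono' (hAm l) fun x hx => ?_).trans (setLIntegral_le_lintegral _ _)
      have hx' : ENNReal.ofReal l < v x := hx
      refine ENNReal.rpow_le_rpow ?_ hq0.le
      rw [ENNReal.ofReal_sub _ hk]
      exact tsub_le_tsub_right hx'.le _
    have h1 := ENNReal.rpow_le_rpow hlow h2q0.le
    rw [ENNReal.mul_rpow_of_nonneg _ _ h2q0.le, ← ENNReal.rpow_mul,
      mul_div_cancel₀ _ hq0.ne'] at h1
    calc _ ≤ _ := h1
      _ ≤ _ := hC k.toNNReal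
      _ ≤ C * (J ^ τ * volume (A k) ^ (1 - τ)) := mul_le_mul_right hup _
      _ = _ := by ring
  set φ : ℝ → ℝ := fun k => (volume (A k)).toReal with hφ
  have hφ0 : ∀ k, 0 ≤ φ k := fun k => ENNReal.toReal_nonneg
  have hφanti : Antitone φ := fun k l hkl =>
    ENNReal.toReal_mono (hAt k) (measure_mono (hanti hkl))
  set B : ℝ := (C * J ^ τ).toReal with hB
  have hB0 : 0 ≤ B := ENNReal.toReal_nonneg
  have stepR : ∀ k l : ℝ, 0 ≤ k → k < l →
      φ l ≤ B ^ (q / 2) * (l - k) ^ (-q) * φ k ^ ((1 - τ) * (q / 2)) := by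
    intro k l hk hkl
    have hlk : 0 < l - k := by linarith
    have hJτ : J ^ τ ≠ ⊤ := ENNReal.rpow_ne_top_of_nonneg hτ0.le hJt.ne
    have h1 := ENNReal.toReal_mono (ENNReal.mul_ne_top (ENNReal.mul_ne_top ENNReal.coe_ne_top hJτ)
      (ENNReal.rpow_ne_top_of_nonneg (by linarith) (hAt k))) (step k l hk hkl)
    rw [ENNReal.toReal_mul, ENNReal.toReal_mul, ← ENNReal.toReal_rpow, ← ENNReal.toReal_rpow,
      ← ENNReal.toReal_rpow, ENNReal.toReal_ofReal hlk.le] at h1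
    change (l - k) ^ (2 : ℝ) * φ l ^ (2 / q) ≤ B * φ k ^ (1 - τ) at h1
    have h2 := Real.rpow_le_rpow (mul_nonneg (by positivity) (Real.rpow_nonneg (hφ0 l) _)) h1
      (by positivity : 0 ≤ q / 2)
    rw [Real.mul_rpow (by positivity) (Real.rpow_nonneg (hφ0 l) _),
      Real.mul_rpow hB0 (Real.rpow_nonneg (hφ0 k) _), ← Real.rpow_mul hlk.le,
      ← Real.rpow_mul (hφ0 l), ← Real.rpow_mul (hφ0 k),
      show 2 * (q / 2) = q by ring, show 2 / q * (q / 2) = 1 by field_simp, Real.rpow_one] at h2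
    rw [Real.rpow_neg hlk.le]
    have hpos : 0 < (l - k) ^ q := Real.rpow_pos_of_pos hlk q
    rw [mul_right_comm, ← div_eq_mul_inv, le_div_iff₀ hpos, mul_comm]
    exact h2
  obtain ⟨M, hM0, hM⟩ := exists_eq_zero_of_stampacchia hφ0 hφanti (Real.rpow_nonneg hB0 _) hq0
    (by
      have : 1 < (1 - τ) * (q / 2) := by
        have h3 : 2 / q * (q / 2) = 1 := by field_simp
        have h4 : 2 / q * (q / 2) < (1 - τ) * (q / 2) :=
          mul_lt_mul_of_pos_right (by linarith) (by positivity)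
        linarith
      exact this) stepR
  refine ⟨M.toNNReal, ?_⟩
  have hM' : volume (A M) = 0 := by
    rcases (ENNReal.toReal_eq_zero_iff _).1 hM with h | h
    · exact h
    · exact absurd h (hAt M)
  rw [ae_iff]
  simpa [hA, ENNReal.ofReal] using hM'

/-- Energy inequalities for the Choquard nonlinearity imply boundedness. -/
theorem exists_ae_le_of_energy [Nontrivial E] (hμ0 : 0 < μ) (hμ : μ < finrank ℝ E) (hp : 1 < p)
    (hpq' : p < q) (hq2 : 2 < q) (hpq : 2 * p / q + μ / finrank ℝ E = 2)
    (hΩb : Bornology.IsBounded Ω) (hΩm : MeasurableSet Ω)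
    (hv : Measurable v) (hvt : ∀ x, v x ≠ ⊤) (hvΩ : ∀ x ∉ Ω, v x = 0) (hvq : ∫⁻ x, v x ^ q < ⊤)
    {lam : ℝ≥0}
    (hpow : ∀ β : ℝ, 1 ≤ β → ∃ C : ℝ≥0, ∀ k : ℕ, 1 ≤ k →
      (∫⁻ x, truncPow k (β - 1) (v x) ^ q) ^ (2 / q) ≤
      C * ∫⁻ x, forcing μ p lam v x * truncPow k (2 * β - 2) (v x))
    (hlev : ∃ C : ℝ≥0, ∀ k : ℝ≥0, (∫⁻ x, (v x - k) ^ q) ^ (2 / q) ≤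
      C * ∫⁻ x, forcing μ p lam v x * (v x - k)) :
    ∃ M : ℝ≥0, ∀ᵐ x, v x ≤ M := by
  have hd : (0 : ℝ) < finrank ℝ E := by exact_mod_cast finrank_pos (R := ℝ) (M := E)
  have hΩ : volume Ω ≠ ⊤ := hΩb.measure_lt_top.ne
  have hq0 : 0 < q := by linarith
  have hp0 : 0 < p := by linarith
  obtain ⟨D, hD⟩ : ∃ D : ℝ, ∀ x ∈ Ω, ∀ y ∈ Ω, x - y ∈ ball (0 : E) D := by
    obtain ⟨R, hR⟩ := hΩb.subset_ball 0
    refine ⟨R + R, fun x hx y hy => ?_⟩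
    have h1 := hR hx
    have h2 := hR hy
    rw [mem_ball_zero_iff] at h1 h2 ⊢
    linarith [norm_sub_le x y]
  set P : ℝ := max p 2 with hP
  have hPp : p ≤ P := le_max_left _ _
  have hP2 : 2 ≤ P := le_max_right _ _
  have hPq : P < q := max_lt hpq' hq2
  -- a first exponent reached through absorption, large enough to bound the potential
  set t : ℝ := μ / finrank ℝ E with ht
  have ht0 : 0 < t := by positivity
  have ht1 : t < 1 := (div_lt_one hd).2 hμ
  have hpt : 2 * p = (2 - t) * q := by
    have : 2 * p / q = 2 - t := by linarith
    rw [div_eq_iff hq0.ne'] at this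
    exact this
  -- The first stage runs up to β = 1/θ. The lower bound on θ is what absorption allows; the upper
  -- one is what boundedness of the potential requires. They are compatible because (1 - t)q = 2p -
  -- q, and p(p + 1 - q) < 2p - q is the same as (p - 1)(p - q) < 0.
  obtain ⟨θ, hθ1, hθ2⟩ : ∃ θ, max (p + 1 - q) 0 < θ ∧ θ < (1 - t) * (q / p) := by
    refine exists_between (max_lt ?_ (by have : 0 < 1 - t := by linarith
                                         positivity))
    rw [← mul_div_assoc, lt_div_iff₀ hp0]
    nlinarith [mul_pos ht0 (by linarith : 0 < p - 1), mul_pos ht0 hq0]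
  have hθ0 : 0 < θ := (le_max_right _ _).trans_lt hθ1
  have hθlt1 : θ ≤ 1 := by
    refine hθ2.le.trans ?_
    rw [← mul_div_assoc, div_le_one hp0]
    nlinarith [mul_pos ht0 hq0]
  set βf : ℝ := 1 / θ with hβf
  have hβf1 : 1 ≤ βf := (le_div_iff₀ hθ0).2 (by linarith)
  have hβfinv : 1 / βf = θ := by rw [hβf, one_div_one_div]
  have first : ∫⁻ x, v x ^ (q * βf) < ⊤ := by
    refine lintegral_rpow_lt_top_of_step hP2 hPq hβf1 hvq fun β m h1 h2 h3 h4 h5 => ?_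
    obtain ⟨C, hC⟩ := hpow β h1
    refine lintegral_rpow_lt_top_of_energy hμ hp hpq' hpq hΩ hΩm hD hv hvt hvΩ hvq h1 ?_ h3
      (by linarith) (by linarith) h5 hC
    calc p + 1 - q < θ := (le_max_left _ _).trans_lt hθ1
      _ = 1 / βf := hβfinv.symm
      _ ≤ 1 / β := one_div_le_one_div_of_le (by linarith) h2
  obtain ⟨κ, hκ⟩ : ∃ κ : ℝ≥0, ∀ x ∈ Ω, potential μ (fun y => v y ^ p) x ≤ κ := by
    have hσ : p * θ / q < 1 - t := by
      rw [div_lt_iff₀ hq0]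
      calc p * θ < p * ((1 - t) * (q / p)) := by gcongr
        _ = (1 - t) * q := by field_simp
    refine exists_potential_le hD hv hvΩ hp0 (σ := p * θ / q) (by positivity) (by linarith) ?_ ?_
    · have : t * finrank ℝ E = μ := div_mul_cancel₀ _ hd.ne'
      rw [← this]
      exact mul_lt_mul_of_pos_right (by linarith) hd
    · have : p / (p * θ / q) = q * βf := by rw [hβf]; field_simp
      rwa [this]
  -- Once the potential is bounded, the step no longer restricts β from above, so the same iteration
  -- reaches any exponent.
  have all : ∀ l : ℝ, 0 < l → ∫⁻ x, v x ^ l < ⊤ := by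
    intro l hl
    have hβ1 : 1 ≤ max 1 (l / q) := le_max_left _ _
    have h := lintegral_rpow_lt_top_of_step hP2 hPq hβ1 hvq fun β m h1 _ h3 h4 h5 => by
      obtain ⟨C, hC⟩ := hpow β h1
      exact lintegral_rpow_lt_top_of_potential_le hp hq0 hΩ hΩm hv hvΩ hκ h1 (by linarith)
        (by linarith) h5 hC
    refine lintegral_rpow_lt_top_of_le hΩ hΩm hvΩ hl ?_ h
    have h6 : l / q ≤ max 1 (l / q) := le_max_right _ _
    rw [div_le_iff₀ hq0] at h6
    linarith
  obtain ⟨C, hC⟩ := hlev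
  refine exists_ae_le_of_levels hq2 hΩ hv hvΩ (measurable_forcing hv) (fun m hm => ?_) hC
  have hm0 : 0 < m := by linarith
  calc ∫⁻ x, (forcing μ p lam v x * v x) ^ m
      ≤ ∫⁻ x, 2 ^ (m - 1) * ((κ : ℝ≥0∞) ^ m * v x ^ (p * m) + (lam : ℝ≥0∞) ^ m * v x ^ (2 * m)) := by
        refine lintegral_mono fun x => ?_
        have h1 : forcing μ p lam v x * v x ≤ κ * v x ^ p + lam * v x ^ (2 : ℝ) := by
          refine (mul_le_mul_left (forcing_le_of_potential_le hvΩ hp hκ x) _).trans (le_of_eq ?_)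
          have e1 : v x ^ p = v x ^ (p - 1) * v x := by
            nth_rw 3 [← ENNReal.rpow_one (v x)]
            rw [← ENNReal.rpow_add_of_nonneg _ _ (by linarith) zero_le_one, sub_add_cancel]
          rw [e1, ENNReal.rpow_two]
          ring
        refine (ENNReal.rpow_le_rpow h1 hm0.le).trans
          ((ENNReal.rpow_add_le_mul_rpow_add_rpow _ _ hm).trans (le_of_eq ?_))
        rw [ENNReal.mul_rpow_of_nonneg _ _ hm0.le, ENNReal.mul_rpow_of_nonneg _ _ hm0.le,
          ← ENNReal.rpow_mul, ← ENNReal.rpow_mul]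
    _ < ⊤ := by
        rw [lintegral_const_mul _ (by fun_prop), lintegral_add_left (by fun_prop),
          lintegral_const_mul _ (by fun_prop), lintegral_const_mul _ (by fun_prop)]
        have h1 := all (p * m) (by positivity)
        have h2 := all (2 * m) (by positivity)
        have h3 : (κ : ℝ≥0∞) ^ m ≠ ⊤ := ENNReal.rpow_ne_top_of_nonneg hm0.le ENNReal.coe_ne_top
        have h4 : (lam : ℝ≥0∞) ^ m ≠ ⊤ := ENNReal.rpow_ne_top_of_nonneg hm0.le ENNReal.coe_ne_top
        have h5 : (2 : ℝ≥0∞) ^ (m - 1) ≠ ⊤ :=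
          ENNReal.rpow_ne_top_of_nonneg (by linarith) ENNReal.ofNat_ne_top
        exact ENNReal.mul_lt_top h5.lt_top (ENNReal.add_lt_top.2
          ⟨ENNReal.mul_lt_top h3.lt_top h1, ENNReal.mul_lt_top h4.lt_top h2⟩)

end Boundedness

/-! ### The right-hand side as a functional, and the weak equation on the whole space -/

/-- For the Choquard term this is HLS applied to v^(p-1)k and v^(p-1)v. For the linear term it is
Hölder, since v lies in the dual of L^q: the conjugate exponent 1/r is at most q and Ω has finite
measure. This boundedness is what lets test functions be approximated in L^q. -/
theorem exists_lintegral_forcing_mul_le [Nontrivial E] {v : E → ℝ≥0∞} {Ω : Set E} {p q μ : ℝ}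
    (hμ : μ < finrank ℝ E) (hp : 1 < p) (hpq' : p < q) (hq2 : 2 < q)
    (hpq : 2 * p / q + μ / finrank ℝ E = 2) (hΩ : volume Ω ≠ ⊤) (hΩm : MeasurableSet Ω)
    (hv : Measurable v) (hvΩ : ∀ x ∉ Ω, v x = 0) (hvq : ∫⁻ x, v x ^ q < ⊤) (lam : ℝ≥0) :
    ∃ C : ℝ≥0, ∀ k : E → ℝ≥0∞, Measurable k →
      ∫⁻ x, forcing μ p lam v x * k x ≤ C * (∫⁻ x, k x ^ q) ^ (1 / q) := by
  have hq0 : 0 < q := by linarith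
  obtain ⟨C₁, hC₁⟩ := hls_product (E := E) (θ₁ := 1) (θ₂ := 1) hμ hp hpq zero_le_one zero_le_one
    (by norm_num) (by linarith) (by linarith)
  set r : ℝ := 1 - 1 / q with hr
  have h1q : 1 / q < 1 := (div_lt_one hq0).2 (by linarith)
  have h1q0 : 0 < 1 / q := by positivity
  have hr0 : 0 < r := by linarith
  have hrq : 1 / r ≤ q := by
    rw [div_le_iff₀ hr0, hr, mul_sub, mul_one_div_cancel hq0.ne']
    linarith
  have hJ : ∫⁻ x, v x ^ (1 / r) < ⊤ :=
    lintegral_rpow_lt_top_of_le hΩ hΩm hvΩ (by positivity) hrq hvq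
  have hfin : (C₁ : ℝ≥0∞) * (∫⁻ x, v x ^ q) ^ (2 * (p - 1) / q) * (∫⁻ x, v x ^ q) ^ (1 / q) +
      lam * (∫⁻ x, v x ^ (1 / r)) ^ r ≠ ⊤ := by
    have h1 : (∫⁻ x, v x ^ q) ^ (2 * (p - 1) / q) ≠ ⊤ :=
      ENNReal.rpow_ne_top_of_nonneg (div_nonneg (by linarith) hq0.le) hvq.ne
    have h2 : (∫⁻ x, v x ^ q) ^ (1 / q) ≠ ⊤ := ENNReal.rpow_ne_top_of_nonneg h1q0.le hvq.ne
    have h3 : (∫⁻ x, v x ^ (1 / r)) ^ r ≠ ⊤ := ENNReal.rpow_ne_top_of_nonneg hr0.le hJ.ne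
    finiteness
  refine ⟨_, fun k hk => le_trans ?_
    (mul_le_mul_left (ENNReal.coe_toNNReal hfin).ge ((∫⁻ x, k x ^ q) ^ (1 / q)))⟩
  rw [lintegral_forcing_mul hv hk, add_mul]
  refine add_le_add ?_ ?_
  · have h1 := hC₁ v k v hv hk hv
    refine le_trans (le_of_eq ?_) (h1.trans (le_of_eq (by ring)))
    refine lintegral_congr fun x => lintegral_congr fun y => ?_
    have e : v y ^ p = v y ^ (p - 1) * v y := by
      nth_rw 3 [← ENNReal.rpow_one (v y)]
      rw [← ENNReal.rpow_add_of_nonneg _ _ (by linarith) zero_le_one, sub_add_cancel]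
    rw [e, ENNReal.rpow_one, ENNReal.rpow_one]
    ring
  · rw [mul_assoc]
    refine mul_le_mul_right ?_ _
    have hol := ENNReal.lintegral_mul_norm_pow_le (μ := (volume : Measure E))
      (f := fun x => v x ^ (1 / r)) (g := fun x => k x ^ q)
      (by fun_prop) (by fun_prop) hr0.le h1q0.le (by ring)
    refine le_trans (le_of_eq (lintegral_congr fun x => ?_)) hol
    rw [← ENNReal.rpow_mul, ← ENNReal.rpow_mul, one_div_mul_cancel hr0.ne',
      mul_one_div_cancel hq0.ne', ENNReal.rpow_one, ENNReal.rpow_one]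

theorem ofReal_mul_min_rpow {t T γ : ℝ} (ht : 0 ≤ t) (hT : 0 ≤ T) (hγ : 0 ≤ γ) :
    ENNReal.ofReal (t * min t T ^ γ) = truncPow (ENNReal.ofReal T) γ (ENNReal.ofReal t) := by
  rw [truncPow, ENNReal.ofReal_mul ht, ← ENNReal.ofReal_rpow_of_nonneg (le_min ht hT) hγ,
    ENNReal.ofReal_min]

/-- Finite-energy subsolutions with Choquard forcing are bounded, given the weak formulation on
the whole energy space. -/
theorem exists_ae_le_of_weak [Nontrivial E] {s p q μ : ℝ} (hs0 : 0 < s)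
    (hsd : 2 * s < finrank ℝ E) (hqs : q = 2 * finrank ℝ E / (finrank ℝ E - 2 * s))
    (hμ0 : 0 < μ) (hμ : μ < finrank ℝ E) (hp : 1 < p) (hpq' : p < q) (hq2 : 2 < q)
    (hpq : 2 * p / q + μ / finrank ℝ E = 2) {Ω : Set E} (hΩb : Bornology.IsBounded Ω)
    (hΩm : MeasurableSet Ω) {u f : E → ℝ} (hu : IsAdmissible s (ENNReal.ofReal q) Ω u)
    (hu0 : ∀ x, 0 ≤ u x) (hvq : ∫⁻ x, ENNReal.ofReal (u x) ^ q < ⊤) {lam : ℝ≥0}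
    (hf0 : ∀ x, 0 ≤ f x)
    (hf : ∀ᵐ x, ENNReal.ofReal (f x) = forcing μ p lam (fun x => ENNReal.ofReal (u x)) x)
    (hfint : ∀ w, IsAdmissible s (ENNReal.ofReal q) Ω w → Integrable fun x => f x * w x)
    (hweak : ∀ w, IsAdmissible s (ENNReal.ofReal q) Ω w →
      ∫ p, diffQuot s u p * diffQuot s w p ∂(volume.prod volume) = ∫ x, f x * w x) :
    ∃ M : ℝ≥0, ∀ᵐ x, ENNReal.ofReal (u x) ≤ M := by
  have hΩ : volume Ω ≠ ⊤ := hΩb.measure_lt_top.ne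
  obtain ⟨CS, hCS⟩ := sobolev (E := E) hs0 hsd hqs
  have hforce : ∀ w : E → ℝ≥0∞, ∫⁻ x, ENNReal.ofReal (f x) * w x =
      ∫⁻ x, forcing μ p lam (fun x => ENNReal.ofReal (u x)) x * w x := fun w => by
    refine lintegral_congr_ae ?_
    filter_upwards [hf] with x hx
    rw [hx]
  refine exists_ae_le_of_energy (lam := lam) hμ0 hμ hp hpq' hq2 hpq hΩb hΩm
    hu.measurable.ennreal_ofReal (fun x => ENNReal.ofReal_ne_top)
    (fun x hx => by rw [hu.eq_zero x hx, ENNReal.ofReal_zero]) hvq (fun β hβ => ?_) ?_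
  · refine ⟨CS * β.toNNReal, fun k hk => ?_⟩
    have hk0 : (0 : ℝ) < k := by exact_mod_cast hk
    have hγ : 0 ≤ 2 * β - 2 := by linarith
    have hγ' : 0 ≤ β - 1 := by linarith
    -- The Lipschitz constant of g depends on k and serves only to make g(u) admissible. The
    -- constant entering the estimate is c = β, uniform in k, so that k can later tend to infinity.
    have h := energy_inequality hCS hΩ hu hu0 hf0 hfint hweak
      (g := fun t => t * min t k ^ (2 * β - 2)) (G := fun t => t * min t k ^ (β - 1))
      (measurable_id.mul ((measurable_id.min measurable_const).pow_const _))
      (measurable_id.mul ((measurable_id.min measurable_const).pow_const _))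
      (by simp) (by simp)
      (fun t ht => mul_nonneg ht (Real.rpow_nonneg (le_min ht hk0.le) _))
      (fun t ht => mul_nonneg ht (Real.rpow_nonneg (le_min ht hk0.le) _))
      (by linarith : 0 ≤ β)
      (fun a b ha hb => abs_mul_min_rpow_sub_le ha hb hk0 hγ)
      (fun a b ha hb => sq_mul_min_rpow_sub_le ha hb hk0 hβ)
    rw [hforce] at h
    simp_rw [ofReal_mul_min_rpow (hu0 _) hk0.le hγ, ofReal_mul_min_rpow (hu0 _) hk0.le hγ',
      ENNReal.ofReal_natCast] at h
    rw [ENNReal.coe_mul]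
    exact h
  · refine ⟨CS, fun k => ?_⟩
    have hmax : ∀ a b : ℝ, b ≤ a → max (b - k) 0 ≤ max (a - k) 0 ∧
        max (a - k) 0 - max (b - k) 0 ≤ a - b := fun a b hab => by
      refine ⟨max_le_max_right _ (by linarith), ?_⟩
      rcases le_total (b - k) 0 with h | h <;> rcases le_total (a - k) 0 with h' | h' <;>
        simp only [max_eq_left, max_eq_right, h, h'] <;> linarith
    -- For the level sets g = G = (t - k)⁺, which is monotone and 1-Lipschitz, so c = 1 works for
    -- every k.
    have h := energy_inequality hCS hΩ hu hu0 hf0 hfint hweak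
      (g := fun t => max (t - k) 0) (G := fun t => max (t - k) 0) (L := 1) (c := 1)
      (by fun_prop) (by fun_prop) (by simp) (by simp)
      (fun t _ => le_max_right _ _) (fun t _ => le_max_right _ _) zero_le_one
      (fun a b _ _ => by
        rw [one_mul]
        rcases le_total b a with hab | hab
        · obtain ⟨h1, h2⟩ := hmax a b hab
          rw [abs_of_nonneg (by linarith), abs_of_nonneg (by linarith)]
          exact h2
        · obtain ⟨h1, h2⟩ := hmax b a hab
          rw [abs_of_nonpos (by linarith), abs_of_nonpos (by linarith)]
          linarith)
      (fun a b _ _ => by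
        rw [one_mul]
        rcases le_total b a with hab | hab
        · obtain ⟨h1, h2⟩ := hmax a b hab
          nlinarith
        · obtain ⟨h1, h2⟩ := hmax b a hab
          nlinarith)
    rw [hforce] at h
    have e : ∀ t : ℝ, ENNReal.ofReal (max (t - k) 0) = ENNReal.ofReal t - k := fun t => by
      rw [ENNReal.ofReal_max, ENNReal.ofReal_zero, max_eq_left zero_le,
        ENNReal.ofReal_sub _ (NNReal.coe_nonneg k), ENNReal.ofReal_coe_nnreal]
    simp_rw [e] at h
    rw [ENNReal.ofReal_one, mul_one] at h
    exact h

theorem eLpNorm_ofReal_eq_lintegral {q : ℝ} (hq : 0 < q) (k : E → ℝ) :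
    eLpNorm k (ENNReal.ofReal q) volume = (∫⁻ x, ‖k x‖ₑ ^ q) ^ (1 / q) := by
  rw [eLpNorm_eq_lintegral_rpow_enorm_toReal (ENNReal.ofReal_pos.2 hq).ne' ENNReal.ofReal_ne_top,
    ENNReal.toReal_ofReal hq.le]

/-- The real-valued double integral of the Choquard nonlinearity against a function. -/
theorem integral_toReal_forcing_mul {μ p : ℝ} {lam : ℝ≥0} {u φ : E → ℝ} (hp : 1 ≤ p)
    (hu : Measurable u) (hu0 : ∀ x, 0 ≤ u x) (hφ : Measurable φ)
    (hfin : ∫⁻ x, forcing μ p lam (fun x => ENNReal.ofReal (u x)) x * ‖φ x‖ₑ < ⊤)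
    (hae : ∀ᵐ x, forcing μ p lam (fun x => ENNReal.ofReal (u x)) x ≠ ⊤)
    (hint : Integrable fun x => u x * φ x) :
    ∫ x, (forcing μ p lam (fun x => ENNReal.ofReal (u x)) x).toReal * φ x =
      ∫ z, u z.1 ^ p * u z.2 ^ (p - 1) * φ z.2 / ‖z.1 - z.2‖ ^ μ ∂(volume.prod volume) +
        lam * ∫ x, u x * φ x := by
  set v : E → ℝ≥0∞ := fun x => ENNReal.ofReal (u x) with hv
  have hvm : Measurable v := hu.ennreal_ofReal
  set F : E × E → ℝ := fun z => u z.1 ^ p * u z.2 ^ (p - 1) * φ z.2 / ‖z.1 - z.2‖ ^ μ with hF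
  have hFm : Measurable F := by
    have h1 : Measurable fun z : E × E => ‖z.1 - z.2‖ ^ μ :=
      (by fun_prop : Measurable fun z : E × E => ‖z.1 - z.2‖).pow_const _
    have h2 : Measurable fun z : E × E => u z.1 ^ p := (hu.comp measurable_fst).pow_const _
    have h3 : Measurable fun z : E × E => u z.2 ^ (p - 1) := (hu.comp measurable_snd).pow_const _
    exact ((h2.mul h3).mul (hφ.comp measurable_snd)).div h1
  have hker : ∀ x y, ENNReal.ofReal (u x ^ p / ‖x - y‖ ^ μ) = v x ^ p * riesz μ (y - x) :=
    fun x y => by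
      rw [riesz_sub_comm, riesz, Real.rpow_neg (norm_nonneg _), div_eq_mul_inv,
        ENNReal.ofReal_mul (Real.rpow_nonneg (hu0 x) _), hv,
        ENNReal.ofReal_rpow_of_nonneg (hu0 x) (by linarith)]
  have hpot : ∀ y, ∫⁻ x, ENNReal.ofReal (u x ^ p / ‖x - y‖ ^ μ) =
      potential μ (fun x => v x ^ p) y := fun y => by
    simp_rw [hker]
    rfl
  have hFint : Integrable F (volume.prod volume) := by
    refine ⟨hFm.aestronglyMeasurable, ?_⟩
    rw [hasFiniteIntegral_iff_enorm, lintegral_prod_symm _ hFm.enorm.aemeasurable]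
    refine lt_of_le_of_lt (lintegral_mono fun y => ?_) hfin
    have e : ∀ x, ‖F (x, y)‖ₑ =
        v x ^ p * riesz μ (y - x) * (v y ^ (p - 1) * ‖φ y‖ₑ) := fun x => by
      have : F (x, y) = u x ^ p / ‖x - y‖ ^ μ * (u y ^ (p - 1) * φ y) := by
        simp only [hF]
        ring
      rw [this, enorm_mul, enorm_mul, ← hker,
        Real.enorm_of_nonneg (div_nonneg (Real.rpow_nonneg (hu0 x) _) (by positivity)),
        Real.enorm_of_nonneg (Real.rpow_nonneg (hu0 y) _), hv,
        ENNReal.ofReal_rpow_of_nonneg (hu0 y) (by linarith)]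
    simp_rw [e]
    rw [lintegral_mul_const _ (by fun_prop), ← mul_assoc]
    gcongr
    exact le_self_add
  have hinner : ∀ y, ∫ x, F (x, y) =
      (potential μ (fun x => v x ^ p) y).toReal * u y ^ (p - 1) * φ y := fun y => by
    have : ∀ x, F (x, y) = u x ^ p / ‖x - y‖ ^ μ * (u y ^ (p - 1) * φ y) := fun x => by
      simp only [hF]
      ring
    have hm : Measurable fun x : E => u x ^ p / ‖x - y‖ ^ μ :=
      (hu.pow_const _).div ((by fun_prop : Measurable fun x : E => ‖x - y‖).pow_const _)
    simp_rw [this]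
    rw [integral_mul_const, integral_eq_lintegral_of_nonneg_ae
      (Eventually.of_forall fun x => div_nonneg (Real.rpow_nonneg (hu0 x) _) (by positivity))
      hm.aestronglyMeasurable, hpot, mul_assoc]
  rw [integral_prod_symm _ hFint]
  simp_rw [hinner]
  have hint' : Integrable fun y =>
      (potential μ (fun x => v x ^ p) y).toReal * u y ^ (p - 1) * φ y := by
    refine hFint.integral_prod_right.congr (Eventually.of_forall fun y => ?_)
    exact hinner y
  rw [← integral_const_mul, ← integral_add hint' (hint.const_mul _)]
  refine integral_congr_ae ?_
  filter_upwards [hae] with x hx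
  rw [forcing, ENNReal.add_ne_top] at hx
  rw [forcing, ENNReal.toReal_add hx.1 hx.2, ENNReal.toReal_mul, ENNReal.toReal_mul,
    ← ENNReal.toReal_rpow, hv, ENNReal.toReal_ofReal (hu0 x), ENNReal.coe_toReal]
  ring

/-- A nonnegative element of `X₀` has a measurable, nonnegative representative vanishing
outside `Ω` with finite Gagliardo seminorm. -/
theorem MemX₀.exists_representative {n : ℕ} {s : ℝ} {Ω : Set (EuclideanSpace ℝ (Fin n))}
    {u : EuclideanSpace ℝ (Fin n) → ℝ} (hu : MemX₀ s Ω u) (hΩ : MeasurableSet Ω)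
    (hu0 : ∀ᵐ x, 0 ≤ u x) :
    ∃ w : EuclideanSpace ℝ (Fin n) → ℝ, Measurable w ∧ (∀ x, 0 ≤ w x) ∧ (∀ x ∉ Ω, w x = 0) ∧
      u =ᵐ[volume] w ∧ MemLp w 2 ∧ gagliardo s w < ⊤ := by
  set w := Ω.indicator fun x => max (hu.aemeasurable.mk u x) 0 with hw
  have hwm : Measurable w := (hu.aemeasurable.measurable_mk.max measurable_const).indicator hΩ
  have hw0 : ∀ x ∉ Ω, w x = 0 := fun x hx => indicator_of_notMem hx _
  have huw : u =ᵐ[volume] w := by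
    filter_upwards [hu.aemeasurable.ae_eq_mk, hu0,
      (ae_restrict_iff' hΩ.compl).1 hu.ae_eq_zero] with x h1 h2 h3
    by_cases hx : x ∈ Ω
    · rw [hw, indicator_of_mem hx, ← h1, max_eq_left h2]
    · rw [h3 hx, hw0 x hx]
  refine ⟨w, hwm, indicator_nonneg fun x _ => le_max_right _ _, hw0, huw, ?_, ?_⟩
  · have h1 : MemLp w 2 (volume.restrict Ω) := hu.memLp_two.ae_eq (ae_restrict_of_ae huw)
    have h2 := (memLp_indicator_iff_restrict hΩ).2 h1
    rwa [indicator_eq_self.2 fun x hx => by_contra fun h => hx (hw0 x h)] at h2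
  · rw [← memLp_diffQuot_iff s hwm]
    have hQ : MeasurableSet (regionQ Ω) := (hΩ.compl.prod hΩ.compl).compl
    have hfst : ∀ᵐ p : EuclideanSpace ℝ (Fin n) × EuclideanSpace ℝ (Fin n), u p.1 = w p.1 :=
      Measure.quasiMeasurePreserving_fst.ae huw
    have hsnd : ∀ᵐ p : EuclideanSpace ℝ (Fin n) × EuclideanSpace ℝ (Fin n), u p.2 = w p.2 :=
      Measure.quasiMeasurePreserving_snd.ae huw
    have h1 : MemLp (diffQuot s w) 2 (volume.restrict (regionQ Ω)) := by
      refine hu.memLp_quotient.ae_eq (ae_restrict_of_ae ?_)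
      filter_upwards [hfst, hsnd] with p h1 h2
      rw [diffQuot, h1, h2, finrank_euclideanSpace_fin]
    have h2 := (memLp_indicator_iff_restrict hQ).2 h1
    rwa [indicator_eq_self.2] at h2
    intro p hp
    by_contra h
    rw [regionQ, notMem_compl_iff] at h
    refine hp ?_
    rw [diffQuot, hw0 _ h.1, hw0 _ h.2, sub_zero, zero_div]

/-- Off Q, and off Ω × Ω, the integrands vanish identically for the representative w and the test
function φ, so the restricted integrals are integrals over the whole product. Replacing u by w
changes them only on null sets. -/
theorem IsWeakSolution.integral_diffQuot_eq {n : ℕ} {s μ lam : ℝ}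
    {Ω : Set (EuclideanSpace ℝ (Fin n))} {u w : EuclideanSpace ℝ (Fin n) → ℝ}
    (hu : IsWeakSolution s μ lam Ω u) (hp : 1 < critExp n s μ)
    (hw0 : ∀ x, 0 ≤ w x) (hwΩ : ∀ x ∉ Ω, w x = 0) (huw : u =ᵐ[volume] w)
    {φ : EuclideanSpace ℝ (Fin n) → ℝ} (hφ : IsTestFunction Ω φ) :
    ∫ p, diffQuot s w p * diffQuot s φ p ∂(volume.prod volume) =
      ∫ z, w z.1 ^ critExp n s μ * w z.2 ^ (critExp n s μ - 1) * φ z.2 / ‖z.1 - z.2‖ ^ μ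
        ∂(volume.prod volume) + lam * ∫ x, w x * φ x := by
  have hφ0 : ∀ x ∉ Ω, φ x = 0 := fun x hx =>
    image_eq_zero_of_notMem_tsupport fun h => hx (hφ.tsupport_subset h)
  have hfst : ∀ᵐ p : EuclideanSpace ℝ (Fin n) × EuclideanSpace ℝ (Fin n), u p.1 = w p.1 :=
    Measure.quasiMeasurePreserving_fst.ae huw
  have hsnd : ∀ᵐ p : EuclideanSpace ℝ (Fin n) × EuclideanSpace ℝ (Fin n), u p.2 = w p.2 :=
    Measure.quasiMeasurePreserving_snd.ae huw
  have h := hu.weak_eq φ hφ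
  have e1 : ∫ p in regionQ Ω,
        (u p.1 - u p.2) * (φ p.1 - φ p.2) / ‖p.1 - p.2‖ ^ ((n : ℝ) + 2 * s) =
      ∫ p, diffQuot s w p * diffQuot s φ p ∂(volume.prod volume) := by
    have : ∫ p in regionQ Ω, diffQuot s w p * diffQuot s φ p =
        ∫ p, diffQuot s w p * diffQuot s φ p := by
      refine setIntegral_eq_integral_of_forall_compl_eq_zero fun p hp => ?_
      rw [regionQ, notMem_compl_iff] at hp
      rw [diffQuot, hwΩ _ hp.1, hwΩ _ hp.2, sub_zero, zero_div, zero_mul]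
    rw [← Measure.volume_eq_prod, ← this]
    refine integral_congr_ae (ae_restrict_of_ae ?_)
    filter_upwards [hfst, hsnd] with p h1 h2
    rw [diffQuot_mul_diffQuot, h1, h2, finrank_euclideanSpace_fin]
  have e2 : ∫ p in Ω ×ˢ Ω, |u p.1| ^ critExp n s μ * |u p.2| ^ (critExp n s μ - 2) * u p.2 * φ p.2
          / ‖p.1 - p.2‖ ^ μ =
      ∫ z, w z.1 ^ critExp n s μ * w z.2 ^ (critExp n s μ - 1) * φ z.2 / ‖z.1 - z.2‖ ^ μ
        ∂(volume.prod volume) := by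
    set F : EuclideanSpace ℝ (Fin n) × EuclideanSpace ℝ (Fin n) → ℝ := fun z =>
      w z.1 ^ critExp n s μ * w z.2 ^ (critExp n s μ - 1) * φ z.2 / ‖z.1 - z.2‖ ^ μ with hF
    have : ∫ p in Ω ×ˢ Ω, F p = ∫ p, F p := by
      refine setIntegral_eq_integral_of_forall_compl_eq_zero fun p hp => ?_
      rw [mem_prod, not_and_or] at hp
      rcases hp with hp | hp
      · simp only [hF, hwΩ _ hp]
        rw [Real.zero_rpow (by linarith)]
        simp
      · simp only [hF, hφ0 _ hp, mul_zero, zero_div]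
    rw [← Measure.volume_eq_prod, ← this]
    refine integral_congr_ae (ae_restrict_of_ae ?_)
    filter_upwards [hfst, hsnd] with p h1 h2
    -- The exponent p - 2 may be negative or zero, but where w = 0 the factor w kills the right side
    -- and p > 1 kills the left, in agreement with the convention for |t|^(p-2)t at 0.
    have e : w p.2 ^ (critExp n s μ - 1) = w p.2 ^ (critExp n s μ - 2) * w p.2 := by
      rcases (hw0 p.2).eq_or_lt with h0 | h0
      · rw [← h0, mul_zero, Real.zero_rpow (by linarith)]
      · nth_rw 3 [← Real.rpow_one (w p.2)]
        rw [← Real.rpow_add h0]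
        congr 1
        ring
    simp only [hF]
    rw [h1, h2, abs_of_nonneg (hw0 _), abs_of_nonneg (hw0 _), e]
    ring
  have e3 : ∫ x in Ω, u x * φ x = ∫ x, w x * φ x := by
    rw [setIntegral_eq_integral_of_forall_compl_eq_zero
      fun x hx => by rw [hφ0 x hx, mul_zero]]
    refine integral_congr_ae ?_
    filter_upwards [huw] with x hx
    rw [hx]
  rw [← e1, ← e2, ← e3, h]

end Choquard

end

/-! ### The theorem -/

open Choquard Set Metric Module Filter
open scoped ENNReal Topology

theorem theorem2p4 (n : ℕ) (s μ lam : ℝ) (hs0 : 0 < s) (hs1 : s < 1) (hn : 2 * s < (n : ℝ))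
    (hμ0 : 0 < μ) (hμn : μ < (n : ℝ)) (hlam : 0 < lam)
    (Ω : Set (EuclideanSpace ℝ (Fin n))) (hΩ : Choquard.IsBoundedLipschitzDomain Ω)
    (u : EuclideanSpace ℝ (Fin n) → ℝ) (hu0 : ∀ᵐ x : EuclideanSpace ℝ (Fin n), 0 ≤ u x)
    (hu : Choquard.IsWeakSolution s μ lam Ω u) :
    MemLp u ⊤ (volume.restrict Ω) := by
  have hn0 : 0 < n := by
    have : (0 : ℝ) < n := by linarith
    exact_mod_cast this
  have : NeZero n := ⟨hn0.ne'⟩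
  have hd : finrank ℝ (EuclideanSpace ℝ (Fin n)) = n := finrank_euclideanSpace_fin
  have : Nontrivial (EuclideanSpace ℝ (Fin n)) :=
    Module.nontrivial_of_finrank_pos (R := ℝ) (by rw [hd]; exact hn0)
  have hden : 0 < (n : ℝ) - 2 * s := by linarith
  have hnpos : (0 : ℝ) < n := by linarith
  set p := critExp n s μ with hp_def
  set q : ℝ := 2 * n / (n - 2 * s) with hq_def
  have hp1 : 1 < p := by
    rw [hp_def, critExp, lt_div_iff₀ hden]
    linarith
  have hpq' : p < q := by
    rw [hp_def, critExp, hq_def]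
    gcongr
    linarith
  have hq2 : 2 < q := by
    rw [hq_def, lt_div_iff₀ hden]
    linarith
  have hq0 : 0 < q := by linarith
  have hpq : 2 * p / q + μ / finrank ℝ (EuclideanSpace ℝ (Fin n)) = 2 := by
    rw [hd, hp_def, critExp, hq_def]
    field_simp
    ring
  have hsd : 2 * s < finrank ℝ (EuclideanSpace ℝ (Fin n)) := by rwa [hd]
  have hμd : μ < finrank ℝ (EuclideanSpace ℝ (Fin n)) := by rwa [hd]
  have hqs : q = 2 * finrank ℝ (EuclideanSpace ℝ (Fin n)) /
      (finrank ℝ (EuclideanSpace ℝ (Fin n)) - 2 * s) := by rw [hd]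
  have hΩm : MeasurableSet Ω := hΩ.isOpen.measurableSet
  have hΩfin : volume Ω ≠ ⊤ := hΩ.isBounded.measure_lt_top.ne
  obtain ⟨w, hwm, hw0, hwΩ, huw, hw2, hwg⟩ := hu.memX₀.exists_representative hΩm hu0
  set v : EuclideanSpace ℝ (Fin n) → ℝ≥0∞ := fun x => ENNReal.ofReal (w x) with hv
  have hvm : Measurable v := hwm.ennreal_ofReal
  have hvΩ : ∀ x ∉ Ω, v x = 0 := fun x hx => by simp [hv, hwΩ x hx]
  have hvq : ∫⁻ x, v x ^ q < ⊤ := by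
    obtain ⟨C, hC⟩ := sobolev hs0 hsd hqs
    have h := (hC w hwm hw0 (measure_ne_top_of_subset (Function.support_subset_iff'.2 hwΩ)
      hΩfin)).trans_lt (ENNReal.mul_lt_top ENNReal.coe_lt_top hwg)
    exact (ENNReal.rpow_lt_top_iff_of_pos (by positivity)).1 h
  have hadm : IsAdmissible s (ENNReal.ofReal q) Ω w := by
    refine ⟨hwm, hwΩ, ⟨hwm.aestronglyMeasurable, ?_⟩, hw2, hwg⟩
    rw [eLpNorm_ofReal_eq_lintegral hq0]
    refine ENNReal.rpow_lt_top_of_nonneg (by positivity) (ne_of_lt ?_)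
    simpa only [Real.enorm_of_nonneg (hw0 _)] using hvq
  set l : ℝ≥0 := ⟨lam, hlam.le⟩ with hl
  obtain ⟨C, hC⟩ := exists_lintegral_forcing_mul_le hμd hp1 hpq' hq2 hpq hΩfin hΩm hvm hvΩ hvq l
  have hF : Measurable (forcing μ p l v) := measurable_forcing hvm
  -- Testing the functional bound with the indicator of Ω shows that the forcing is integrable on Ω;
  -- outside Ω it vanishes with v. Passing to the real-valued f below therefore loses nothing almost
  -- everywhere.
  have hFfin : ∀ᵐ x, forcing μ p l v x ≠ ⊤ := by
    have h := hC (Ω.indicator 1) (measurable_one.indicator hΩm)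
    have hlt : ∫⁻ x, forcing μ p l v x * Ω.indicator 1 x < ⊤ := by
      refine h.trans_lt (ENNReal.mul_lt_top ENNReal.coe_lt_top
        (ENNReal.rpow_lt_top_of_nonneg (by positivity) ?_))
      have e : ∀ x, (Ω.indicator 1 x : ℝ≥0∞) ^ q = Ω.indicator 1 x := fun x => by
        by_cases hx : x ∈ Ω <;> simp [hx, hq0]
      simp_rw [e]
      rwa [lintegral_indicator_one hΩm]
    filter_upwards [ae_lt_top (hF.mul (measurable_one.indicator hΩm)) hlt.ne] with x hx
    by_cases hxΩ : x ∈ Ω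
    · simpa [hxΩ] using hx.ne
    · have h1 : v x = 0 := hvΩ x hxΩ
      have hp' : 0 < p - 1 := by linarith
      simp [forcing, h1, hp']
  set f : EuclideanSpace ℝ (Fin n) → ℝ := fun x => (forcing μ p l v x).toReal with hf
  have hfF : ∀ᵐ x, ENNReal.ofReal (f x) = forcing μ p l v x := by
    filter_upwards [hFfin] with x hx
    exact ENNReal.ofReal_toReal hx
  have hf0 : ∀ x, 0 ≤ f x := fun x => ENNReal.toReal_nonneg
  have hFk : ∀ k : EuclideanSpace ℝ (Fin n) → ℝ, Measurable k →
      ∫⁻ x, forcing μ p l v x * ‖k x‖ₑ ≤ C * eLpNorm k (ENNReal.ofReal q) volume := fun k hk => by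
    rw [eLpNorm_ofReal_eq_lintegral hq0]
    exact hC _ hk.enorm
  have hfC : ∀ k : EuclideanSpace ℝ (Fin n) → ℝ, Measurable k →
      ∫⁻ x, ‖f x‖ₑ * ‖k x‖ₑ ≤ C * eLpNorm k (ENNReal.ofReal q) volume := fun k hk => by
    refine le_trans (le_of_eq (lintegral_congr_ae ?_)) (hFk k hk)
    filter_upwards [hfF] with x hx
    rw [Real.enorm_of_nonneg (hf0 x), hx]
  have hweak : ∀ φ : EuclideanSpace ℝ (Fin n) → ℝ, ContDiff ℝ ∞ φ → HasCompactSupport φ →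
      tsupport φ ⊆ Ω →
      ∫ p, diffQuot s w p * diffQuot s φ p ∂(volume.prod volume) = ∫ x, f x * φ x := by
    intro φ hφ hφc hφΩ
    rw [hu.integral_diffQuot_eq hp1 hw0 hwΩ huw ⟨hφ, hφc, hφΩ⟩]
    refine (integral_toReal_forcing_mul (lam := l) hp1.le hwm hw0 hφ.continuous.measurable ?_
      hFfin (hw2.integrable_mul (q := 2) (hφ.continuous.memLp_of_hasCompactSupport hφc))).symm
    exact (hFk φ hφ.continuous.measurable).trans_lt (ENNReal.mul_lt_top ENNReal.coe_lt_top
      (hφ.continuous.memLp_of_hasCompactSupport hφc).eLpNorm_lt_top)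
  have : Fact (1 ≤ ENNReal.ofReal q) :=
    ⟨by rw [ENNReal.one_le_ofReal]; linarith⟩
  obtain ⟨M, hM⟩ := exists_ae_le_of_weak hs0 hsd hqs hμ0 hμd hp1 hpq' hq2 hpq hΩ.isBounded hΩm hadm
    hw0 hvq hf0 hfF
    (fun k hk => ⟨(hF.ennreal_toReal.mul hk.measurable).aestronglyMeasurable, by
      rw [hasFiniteIntegral_iff_enorm]
      simp_rw [enorm_mul]
      exact (hfC k hk.measurable).trans_lt
        (ENNReal.mul_lt_top ENNReal.coe_lt_top hk.memLp.eLpNorm_lt_top)⟩)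
    -- The Lipschitz boundary enters only here, through the local pushes that make smooth test
    -- functions sufficient.
    (fun k hk => integral_diffQuot_eq_of_isAdmissible ENNReal.ofReal_ne_top hs0 hs1 hwm hwg
      hF.ennreal_toReal ENNReal.coe_ne_top hfC hweak hΩ.isBounded
      (fun x hx => hΩ.exists_pushesInto hx) hk)
  refine memLp_top_of_bound hu.memX₀.memLp_two.aestronglyMeasurable M (ae_restrict_of_ae ?_)
  filter_upwards [hM, huw] with x h1 h2
  rw [h2, Real.norm_of_nonneg (hw0 x)]
  exact (ENNReal.ofReal_le_coe).1 h1
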